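/- **Setting.** Let $P\subset\mathbb{R}^d$ be a set of $n\ge 2$ distinct points with a coloring $f:P\to\{1,\dots,\ell\}$, let $k\ge 1$, $0<\varepsilon\le 1$, and let $m=1$ ($k$-median) or $m=2$ ($k$-means). Let $$\mathrm{opt}_P=\inf_{C\subset\mathbb{R}^d,\ |C|=k}\ \sum_{x\in P}\min_{c\in C}\|x-c\|^m ,$$ and let the spread $\Delta$ of $P$ be its maximum pairwise distance divided by its minimum pairwise distance. A finite multiset $S$ of points of $\mathbb{R}^d$ with weights $w:S\to\mathbb{Z}_{>0}$ and colors $f':S\to\{1,\dots,\ell\}$, in which every location occurs at most once per color, is a *movement-based $(k,\ell,\varepsilon)$-color coreset* of $P$ if there is a mapping $\pi:P\to S$ with $f'(\pi(x))=f(x)$ for all $x\in P$, with $|\{x\in P:\pi(x)=s,\ f(x)=f'(s)\}|=w(s)$ for all $s\in S$, and with $$\sum_{x\in P}\|x-\pi(x)\|^m\le\Big(\frac{\varepsilon}{2m}\Big)^m\,\mathrm{opt}_P .$$ The machine is a real RAM: it has integer cells (constants, addition, truncated subtraction, comparison), real cells ($+,-,\times,\div,\sqrt{\cdot}$, comparison,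 conversion of integers to reals, no rounding) and indirect addressing; every operation costs one step. A *streaming algorithm* is a single deterministic program for this machine that gets $d,k,\ell,\varepsilon$, but not $n$, reads the colored points of $P$ once, one after the other in an arbitrary order (insertion-only; reading a point costs $d+1$ steps), and afterwards leaves its output in its memory. **Statement.** For $m=1$ and for $m=2$ there are a streaming algorithm, an absolute constant $a\in\mathbb{N}$, and constants $A_d,B_d\in\mathbb{R}$, $e_d\in\mathbb{N}$ that depend only on $d$, such that for all $d,k,\ell,\varepsilon,n,P,f$ as above and every order of the stream, the algorithm outputs a movement-based $(k,\ell,\varepsilon)$-color coreset of $P$ of size (number of weighted points) - at most $A_d\,\ell\,k\,\varepsilon^{-d}\log^2 n$ if $m=1$ ($k$-median), - at most $A_d\,\ell\,k\,\varepsilon^{-d}\log n$ if $m=2$ ($k$-means). Its total running time is at most $a^{d+1}\,(n+k+\ell+\log\Delta)^a$ steps, that is, polynomial in $n$, $k$, $\ell$ and $\log\Delta$ and exponential in $d$. It uses at most $B_d\,(\ell k\varepsilon^{-1}\log n)^{e_d}$ integer cells and as many real cells, so for fixed $d$ its memory is polynomial in $\ell$, $k$, $1/\varepsilon$ and $\log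 n$. -/

import Mathlib

/-! ### Clustering cost, spread, and movement-based colour coresets -/

/-- The `k`-clustering cost `∑ x ∈ P, dist(x, C) ^ m` of the points `x i` with centre set `C`. -/
noncomputable def clusterCost {d n : ℕ} (m : ℕ) (x : Fin n → EuclideanSpace ℝ (Fin d))
    (C : Finset (EuclideanSpace ℝ (Fin d))) : ℝ :=
  ∑ i, Metric.infDist (x i) (C : Set (EuclideanSpace ℝ (Fin d))) ^ m

/-- The optimal cost over all sets of `k` centres in `ℝ^d`
(`m = 1` is `k`-median, `m = 2` is `k`-means). -/
noncomputable def optCost {d n : ℕ} (m k : ℕ) (x : Fin n → EuclideanSpace ℝ (Fin d)) : ℝ :=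
  ⨅ C : {C : Finset (EuclideanSpace ℝ (Fin d)) // C.card = k}, clusterCost m x C.1

/-- The spread: maximum pairwise distance divided by minimum pairwise distance. -/
noncomputable def spread {d n : ℕ} (x : Fin n → EuclideanSpace ℝ (Fin d)) : ℝ :=
  (⨆ p : {p : Fin n × Fin n // p.1 ≠ p.2}, dist (x p.1.1) (x p.1.2)) /
    (⨅ p : {p : Fin n × Fin n // p.1 ≠ p.2}, dist (x p.1.1) (x p.1.2))

/-- The weighted coloured multiset `(p, g, w)` (points, colours, weights) is a movement-based
`(k, ℓ, ε)`-colour coreset of the points `x` coloured by `f`, for the exponent `m`. -/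
structure IsMovementColorCoreset {d n ℓ N : ℕ} (m k : ℕ) (ε : ℝ)
    (x : Fin n → EuclideanSpace ℝ (Fin d)) (f : Fin n → Fin ℓ)
    (p : Fin N → EuclideanSpace ℝ (Fin d)) (g : Fin N → Fin ℓ) (w : Fin N → ℕ) : Prop where
  weight_pos : ∀ s, 0 < w s
  /-- every location occurs with at most one copy per colour -/
  one_copy_per_color : Function.Injective fun s => (p s, g s)
  /-- the movement `π` sends points to copies of their own colour, the weights count the
  points moved, and the total movement is small -/
  exists_movement : ∃ π : Fin n → Fin N,
    (∀ i, g (π i) = f i) ∧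
    (∀ s, (Finset.univ.filter fun i => π i = s ∧ f i = g s).card = w s) ∧
    ∑ i, dist (x i) (p (π i)) ^ m ≤ (ε / (2 * m)) ^ m * optCost m k x

/-! ### A real RAM

The machine has integer cells `Z 0, Z 1, …` (natural numbers) and real cells `R 0, R 1, …`.
Integer instructions are constants, addition and truncated subtraction; real instructions are
the field operations, the square root and the conversion of an integer; there is no
rounding. Cells are addressed directly or through an integer cell. A division by zero and the
square root of a negative number return zero. -/

/-- A memory configuration. -/
@[ext] structure RamState where
  Z : ℕ → ℕ
  R : ℕ → ℝ

/-- `dir a` is the cell `a`; `ind a` is the cell whose address is held in the integer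
cell `a`. -/
inductive Addr
  | dir (a : ℕ)
  | ind (a : ℕ)

/-- The address that is referred to. -/
def Addr.loc (σ : RamState) : Addr → ℕ
  | .dir a => a
  | .ind a => σ.Z a

/-- All cells used to resolve the address, and the cell itself, exist on a machine with `s`
integer cells and `s` real cells. -/
def Addr.Fits (s : ℕ) (σ : RamState) : Addr → Prop
  | .dir a => a < s
  | .ind a => a < s ∧ σ.Z a < s

/-- The elementary instructions; the first argument is the destination. -/
inductive Instr
  | zconst (u : Addr) (c : ℕ)
  | zcopy (u v : Addr)
  | zadd (u v v' : Addr)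
  | zsub (u v v' : Addr)
  | rcast (u v : Addr)
  | rcopy (u v : Addr)
  | radd (u v v' : Addr)
  | rsub (u v v' : Addr)
  | rmul (u v v' : Addr)
  | rdiv (u v v' : Addr)
  | rsqrt (u v : Addr)

/-- Contents of an integer cell. -/
def RamState.getZ (σ : RamState) (u : Addr) : ℕ := σ.Z (u.loc σ)

/-- Contents of a real cell. -/
def RamState.getR (σ : RamState) (u : Addr) : ℝ := σ.R (u.loc σ)

/-- Write to an integer cell. -/
def RamState.setZ (σ : RamState) (u : Addr) (a : ℕ) : RamState :=
  { σ with Z := Function.update σ.Z (u.loc σ) a }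

/-- Write to a real cell. -/
def RamState.setR (σ : RamState) (u : Addr) (a : ℝ) : RamState :=
  { σ with R := Function.update σ.R (u.loc σ) a }

/-- Effect of an elementary instruction. -/
noncomputable def Instr.apply (σ : RamState) : Instr → RamState
  | .zconst u c => σ.setZ u c
  | .zcopy u v => σ.setZ u (σ.getZ v)
  | .zadd u v v' => σ.setZ u (σ.getZ v + σ.getZ v')
  | .zsub u v v' => σ.setZ u (σ.getZ v - σ.getZ v')
  | .rcast u v => σ.setR u (σ.getZ v : ℝ)
  | .rcopy u v => σ.setR u (σ.getR v)
  | .radd u v v' => σ.setR u (σ.getR v + σ.getR v')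
  | .rsub u v v' => σ.setR u (σ.getR v - σ.getR v')
  | .rmul u v v' => σ.setR u (σ.getR v * σ.getR v')
  | .rdiv u v v' => σ.setR u (σ.getR v / σ.getR v')
  | .rsqrt u v => σ.setR u (Real.sqrt (σ.getR v))

/-- All cells that the instruction touches exist. -/
def Instr.Fits (s : ℕ) (σ : RamState) : Instr → Prop
  | .zconst u _ => u.Fits s σ
  | .zcopy u v | .rcast u v | .rcopy u v | .rsqrt u v => u.Fits s σ ∧ v.Fits s σ
  | .zadd u v v' | .zsub u v v' | .radd u v v' | .rsub u v v' | .rmul u v v'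
  | .rdiv u v v' => u.Fits s σ ∧ v.Fits s σ ∧ v'.Fits s σ

/-- Comparisons of two integer cells or two real cells. -/
inductive RamTest
  | zle (v v' : Addr)
  | zlt (v v' : Addr)
  | rle (v v' : Addr)
  | rlt (v v' : Addr)

/-- The comparison is true. -/
def RamTest.Holds (σ : RamState) : RamTest → Prop
  | .zle v v' => σ.getZ v ≤ σ.getZ v'
  | .zlt v v' => σ.getZ v < σ.getZ v'
  | .rle v v' => σ.getR v ≤ σ.getR v'
  | .rlt v v' => σ.getR v < σ.getR v'

/-- All cells that the comparison touches exist. -/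
def RamTest.Fits (s : ℕ) (σ : RamState) : RamTest → Prop
  | .zle v v' | .zlt v v' | .rle v v' | .rlt v v' => v.Fits s σ ∧ v'.Fits s σ

/-- Programs. -/
inductive RamProg
  | skip
  | instr (i : Instr)
  | seq (a b : RamProg)
  | ite (b : RamTest) (p q : RamProg)
  | loop (b : RamTest) (p : RamProg)

/-- `Exec s p σ t τ`: on a machine with `s` integer cells and `s` real cells, the program `p`
started in `σ` halts in `τ` after `t` steps. Every elementary instruction and every
comparison is one step. The program is stuck, hence does not halt, if it touches a cell that
does not exist. -/
inductive Exec (s : ℕ) : RamProg → RamState → ℕ → RamState → Prop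
  | skip (σ : RamState) : Exec s .skip σ 0 σ
  | instr {i : Instr} {σ : RamState} (h : i.Fits s σ) : Exec s (.instr i) σ 1 (i.apply σ)
  | seq {a b : RamProg} {σ σ₁ σ₂ : RamState} {t₁ t₂ : ℕ}
      (ha : Exec s a σ t₁ σ₁) (hb : Exec s b σ₁ t₂ σ₂) : Exec s (.seq a b) σ (t₁ + t₂) σ₂
  | iteTrue {b : RamTest} {p q : RamProg} {σ σ₁ : RamState} {t : ℕ}
      (hf : b.Fits s σ) (hb : b.Holds σ) (hp : Exec s p σ t σ₁) :
      Exec s (.ite b p q) σ (1 + t) σ₁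
  | iteFalse {b : RamTest} {p q : RamProg} {σ σ₁ : RamState} {t : ℕ}
      (hf : b.Fits s σ) (hb : ¬ b.Holds σ) (hq : Exec s q σ t σ₁) :
      Exec s (.ite b p q) σ (1 + t) σ₁
  | loopTrue {b : RamTest} {p : RamProg} {σ σ₁ σ₂ : RamState} {t₁ t₂ : ℕ}
      (hf : b.Fits s σ) (hb : b.Holds σ) (hp : Exec s p σ t₁ σ₁)
      (hl : Exec s (.loop b p) σ₁ t₂ σ₂) : Exec s (.loop b p) σ (1 + t₁ + t₂) σ₂
  | loopFalse {b : RamTest} {p : RamProg} {σ : RamState}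
      (hf : b.Fits s σ) (hb : ¬ b.Holds σ) : Exec s (.loop b p) σ 1 σ

/-! ### One-pass streaming algorithms on the real RAM -/

/-- A streaming algorithm in the insertion-only model: `init` runs before the stream starts,
`update` runs once for every arriving point, `report` runs after the last point. One
algorithm serves all dimensions and all parameters, and it is not told the length of the
stream. -/
structure StreamAlg where
  init : RamProg
  update : RamProg
  report : RamProg

/-- The initial memory: `Z 0, Z 1, Z 2` hold `d, k, ℓ`, and `R 0` holds `ε`. All other cells
hold zero. -/
noncomputable def RamState.start (d k ℓ : ℕ) (ε : ℝ) : RamState where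
  Z := fun a => if a = 0 then d else if a = 1 then k else if a = 2 then ℓ else 0
  R := fun a => if a = 0 then ε else 0

/-- The arrival of a point: its coordinates are put into `R 1, …, R d`, its colour
into `Z 3`. -/
noncomputable def RamState.load {d ℓ : ℕ} (σ : RamState) (y : EuclideanSpace ℝ (Fin d))
    (c : Fin ℓ) : RamState where
  Z := Function.update σ.Z 3 c
  R := fun a => if h : 1 ≤ a ∧ a - 1 < d then y ⟨a - 1, h.2⟩ else σ.R a

/-- Processing the stream from left to right in `t` steps. The arrival of a point counts
`d + 1` steps. -/
inductive StreamAlg.Feed (M : StreamAlg) (s : ℕ) {d ℓ : ℕ} :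
    List (EuclideanSpace ℝ (Fin d) × Fin ℓ) → RamState → ℕ → RamState → Prop
  | nil (σ : RamState) : StreamAlg.Feed M s [] σ 0 σ
  | cons {y : EuclideanSpace ℝ (Fin d)} {c : Fin ℓ}
      {l : List (EuclideanSpace ℝ (Fin d) × Fin ℓ)} {σ σ₁ σ₂ : RamState} {t₁ t₂ : ℕ}
      (hu : Exec s M.update (σ.load y c) t₁ σ₁) (hl : StreamAlg.Feed M s l σ₁ t₂ σ₂) :
      StreamAlg.Feed M s ((y, c) :: l) σ (d + 1 + t₁ + t₂) σ₂

/-- On a machine with `s` integer and `s` real cells, the algorithm `M` with parameters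
`k, ℓ, ε` processes the stream `(x 0, f 0), (x 1, f 1), …` in one pass and halts in `τ` after
`t` steps in total. -/
def StreamAlg.Runs (M : StreamAlg) (s : ℕ) {d n ℓ : ℕ} (k : ℕ) (ε : ℝ)
    (x : Fin n → EuclideanSpace ℝ (Fin d)) (f : Fin n → Fin ℓ) (t : ℕ) (τ : RamState) : Prop :=
  d + 8 ≤ s ∧ ∃ (t₁ t₂ t₃ : ℕ) (σ₁ σ₂ : RamState),
    Exec s M.init (RamState.start d k ℓ ε) t₁ σ₁ ∧
    M.Feed s (List.ofFn fun i => (x i, f i)) σ₁ t₂ σ₂ ∧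
    Exec s M.report σ₂ t₃ τ ∧ t = t₁ + t₂ + t₃

/-- The output left in the memory of a machine with `s` integer and `s` real cells: `Z 4` holds
the number `N` of elements, and `Z 5, Z 6, Z 7` hold the start addresses of the arrays of
their coordinates, colours and weights. -/
def RamState.Outputs (τ : RamState) (s : ℕ) {d ℓ N : ℕ}
    (p : Fin N → EuclideanSpace ℝ (Fin d)) (g : Fin N → Fin ℓ) (w : Fin N → ℕ) : Prop :=
  τ.Z 4 = N ∧ τ.Z 5 + N * d ≤ s ∧ τ.Z 6 + N ≤ s ∧ τ.Z 7 + N ≤ s ∧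
  (∀ (i : Fin N) (j : Fin d), p i j = τ.R (τ.Z 5 + i * d + j)) ∧
  (∀ i : Fin N, (g i : ℕ) = τ.Z (τ.Z 6 + i)) ∧
  (∀ i : Fin N, w i = τ.Z (τ.Z 7 + i))

/-- `M` is a streaming construction of movement-based `(k, ℓ, ε)`-colour coresets, for the
exponent `m`, of size at most `size d k ℓ ε n`, in at most `time d k ℓ n Δ` steps and with at
most `space d k ℓ ε n` integer cells and as many real cells. Here `n ≥ 2` is the number of
points and `Δ` is their spread. -/
def StreamAlg.ConstructsColorCoresets (M : StreamAlg) (m : ℕ)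
    (size : (d k ℓ : ℕ) → (ε : ℝ) → (n : ℕ) → ℝ)
    (time : (d k ℓ n : ℕ) → (Δ : ℝ) → ℝ)
    (space : (d k ℓ : ℕ) → (ε : ℝ) → (n : ℕ) → ℝ) : Prop :=
  ∀ (d k ℓ : ℕ) (ε : ℝ) (n : ℕ) (x : Fin n → EuclideanSpace ℝ (Fin d)) (f : Fin n → Fin ℓ),
    1 ≤ k → 0 < ε → ε ≤ 1 → 2 ≤ n → Function.Injective x →
    ∃ (s t : ℕ) (τ : RamState) (N : ℕ) (p : Fin N → EuclideanSpace ℝ (Fin d))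
      (g : Fin N → Fin ℓ) (w : Fin N → ℕ),
      M.Runs s k ε x f t τ ∧ τ.Outputs s p g w ∧
      IsMovementColorCoreset m k ε x f p g w ∧
      (N : ℝ) ≤ size d k ℓ ε n ∧ (t : ℝ) ≤ time d k ℓ n (spread x) ∧
      (s : ℝ) ≤ space d k ℓ ε n

/-!
The algorithm keeps weighted representatives in a single structure; it does not merge coresets.
The stream is cut into blocks, where the block of level `L = 1, 2, 4, …` consists of `2 ^ L`
points, and the representatives of a finished block are never touched again. Any `k` centres
serve all blocks at once, so it suffices that in each block the movement is small compared with
the cost of *every* set of `k` centres on the points of this block (`Block.movement_le`); these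
bounds add up (`Frozen.append`).

A block has a radius `r`, and `θ = r ^ m`. A representative has a capacity `c = 2 ^ j` and covers
the points at distance `ρ` with `ρ ^ m * c ≤ θ`, so that filling it costs a movement of at most `θ`.
A point joins a representative of its colour that covers it and is not full; if all that cover
it are full, it becomes a new representative with twice the largest capacity among them, or with
capacity one if there are none. Hence
representatives of the same colour and capacity are separated, and each one is either of
capacity one or close to a full one of half its capacity. If there are more than
`K = levelBound * L` representatives, then every clustering with `k` centres costs at least
`(16 m / ε) ^ m * 2 K θ` (`Summary.le_cost_of_overflow`): by packing, a constant fraction of the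
representatives is full (`Summary.sub_le_mul_card_full`); by packing again, few full ones are
close to a centre relative to their covering radius (`Summary.card_near_le`), because only
`L + 1` capacities occur among full ones; and the points on a full one that is far from all
centres pay at least a large multiple of `θ` (`Summary.card_far_mul_le`).

So an overflow proves that the radius is too small. It is doubled, and the representatives are
inserted again, with their weights, in place (`rebuildProg_wp`); the movements at the successive
radii form a geometric series, and the lower bound for the cost pays for it (`Block.rescale`).
The radius starts at zero and becomes positive at the first overflow, as a small multiple of the
least distance of the representatives, which bounds the cost from below because there are
more than `k` of them (`le_cost_of_pairwise_le_dist`). The radius never exceeds the diameter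
times the number of points (`Block.radius_le`), which bounds the number of doublings by the
logarithm of the spread and of `n`.

The bound `K` doubles from block to block, so at most `2 K` representatives are in the memory,
and `L ≤ 2 log₂ n`. This gives a single logarithmic factor for both exponents, which for
`k`-median is stronger than what is claimed.

The program is verified with the total-correctness triples `Wp`, which bound the running time.
-/

/-! ### Packing and scale radii -/

/-- A `ρ`-separated family of points in a ball of radius `R` of `ℝ^d` has at most
`(1 + 2 R / ρ) ^ d` members. -/
theorem card_le_of_separated_of_dist_le {d : ℕ} {ι : Type*} (A : Finset ι)
    (f : ι → EuclideanSpace ℝ (Fin d)) (z : EuclideanSpace ℝ (Fin d)) {R ρ : ℝ} (hρ : 0 < ρ)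
    (hR : 0 ≤ R) (hA : ∀ i ∈ A, dist (f i) z ≤ R)
    (hs : ∀ i ∈ A, ∀ j ∈ A, i ≠ j → ρ ≤ dist (f i) (f j)) :
    (A.card : ℝ) ≤ (1 + 2 * R / ρ) ^ d := by
  classical
  let μ : MeasureTheory.Measure (EuclideanSpace ℝ (Fin d)) := MeasureTheory.volume
  have hρ2 : 0 < ρ / 2 := by positivity
  have hR2 : 0 < R + ρ / 2 := by positivity
  have D : (A : Set ι).Pairwise (Function.onFun Disjoint fun i => Metric.ball (f i) (ρ / 2)) := by
    intro i hi j hj hij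
    apply Metric.ball_disjoint_ball
    linarith [hs i hi j hj hij]
  have hsub : (⋃ i ∈ A, Metric.ball (f i) (ρ / 2)) ⊆ Metric.ball z (R + ρ / 2) := by
    refine Set.iUnion₂_subset fun i hi => ?_
    apply Metric.ball_subset_ball'
    linarith [hA i hi]
  have hvol : (A.card : ENNReal) * ENNReal.ofReal ((ρ / 2) ^ d) * μ (Metric.ball 0 1) ≤
      ENNReal.ofReal ((R + ρ / 2) ^ d) * μ (Metric.ball 0 1) := by
    have h := MeasureTheory.measure_mono (μ := μ) hsub
    rw [MeasureTheory.measure_biUnion_finset D fun i _ => measurableSet_ball] at h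
    simpa only [μ.addHaar_ball_of_pos _ hρ2, μ.addHaar_ball_of_pos _ hR2, finrank_euclideanSpace,
      Fintype.card_fin, Finset.sum_const, nsmul_eq_mul, mul_assoc] using h
  have J := (ENNReal.mul_le_mul_iff_left
    (Metric.measure_ball_pos μ _ zero_lt_one).ne' MeasureTheory.measure_ball_lt_top.ne).1 hvol
  have K := ENNReal.toReal_le_of_le_ofReal (pow_nonneg hR2.le _) J
  rw [ENNReal.toReal_mul, ENNReal.toReal_ofReal (by positivity), ENNReal.toReal_natCast] at K
  have hx : 1 + 2 * R / ρ = (R + ρ / 2) / (ρ / 2) := by field_simp; ring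
  rw [hx, div_pow, le_div_iff₀ (by positivity)]
  exact K

/-- The radius `ρ` with `ρ ^ m * c = θ`. -/
noncomputable def scaleRad (m : ℕ) (θ : ℝ) (c : ℕ) : ℝ := (θ / c) ^ ((m : ℝ)⁻¹)

theorem scaleRad_nonneg {m : ℕ} {θ : ℝ} (hθ : 0 ≤ θ) (c : ℕ) : 0 ≤ scaleRad m θ c := by
  unfold scaleRad; positivity

theorem scaleRad_pos {m : ℕ} {θ : ℝ} (hθ : 0 < θ) {c : ℕ} (hc : 0 < c) :
    0 < scaleRad m θ c := by
  unfold scaleRad; positivity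

theorem scaleRad_pow {m : ℕ} (hm : m ≠ 0) {θ : ℝ} (hθ : 0 ≤ θ) {c : ℕ} (hc : 0 < c) :
    scaleRad m θ c ^ m * c = θ := by
  unfold scaleRad
  rw [Real.rpow_inv_natCast_pow (by positivity) hm]
  field_simp

theorem le_scaleRad_iff {m : ℕ} (hm : m ≠ 0) {θ : ℝ} (hθ : 0 ≤ θ) {c : ℕ} (hc : 0 < c) {a : ℝ}
    (ha : 0 ≤ a) : a ≤ scaleRad m θ c ↔ a ^ m * c ≤ θ := by
  have hc' : (0 : ℝ) < c := by exact_mod_cast hc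
  conv_rhs => rw [← scaleRad_pow hm hθ hc]
  rw [mul_le_mul_iff_left₀ hc', pow_le_pow_iff_left₀ ha (scaleRad_nonneg hθ c) hm]

theorem scaleRad_le_two_mul {m : ℕ} (hm : m ≠ 0) {θ : ℝ} (hθ : 0 ≤ θ) {c : ℕ} (hc : 0 < c) :
    scaleRad m θ c ≤ 2 * scaleRad m θ (2 * c) := by
  have h0 := scaleRad_nonneg (m := m) hθ (2 * c)
  rw [← pow_le_pow_iff_left₀ (scaleRad_nonneg hθ c) (by positivity) hm]
  have h1 := scaleRad_pow hm hθ hc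
  have h2 := scaleRad_pow hm hθ (c := 2 * c) (by omega)
  have hc' : (0 : ℝ) < c := by exact_mod_cast hc
  push_cast at h2
  have h3 : scaleRad m θ c ^ m = 2 * scaleRad m θ (2 * c) ^ m :=
    mul_right_cancel₀ hc'.ne' (by linarith)
  rw [h3, mul_pow]
  have : (2 : ℝ) ^ 1 ≤ 2 ^ m := pow_le_pow_right₀ (by norm_num) (by omega)
  have h4 : 0 ≤ scaleRad m θ (2 * c) ^ m := by positivity
  nlinarith

/-! ### Summaries of one radius -/

/-- A weighted coloured representative. A representative of capacity `cap` covers the points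
at distance at most `scaleRad m θ cap`, and it is full if its weight is at least its capacity. -/
@[ext] structure Delegate (d : ℕ) where
  loc : EuclideanSpace ℝ (Fin d)
  col : ℕ
  wt : ℕ
  cap : ℕ

/-- The representative covers the location `y` at the movement bound `θ`. -/
def Delegate.Covers {d : ℕ} (m : ℕ) (θ : ℝ) (ρ : Delegate d) (y : EuclideanSpace ℝ (Fin d)) :
    Prop :=
  dist y ρ.loc ^ m * ρ.cap ≤ θ

/-- The representative may take another point that is at `y`: it has the colour of the point,
covers it, and is not full, unless the point is not moved at all. -/
def Delegate.Accepts {d : ℕ} (m : ℕ) (θ : ℝ) (ρ : Delegate d) (y : EuclideanSpace ℝ (Fin d))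
    (c : ℕ) : Prop :=
  ρ.col = c ∧ ρ.Covers m θ y ∧ (ρ.wt < ρ.cap ∨ y = ρ.loc)

/-- `Inserts m θ b N S y c s N' S'`: inserting a point of colour `c` at `y` into the
representatives `S b, …, S (N - 1)` puts it on `S s` and leaves the representatives
`S' b, …, S' (N' - 1)`. Either an accepting representative takes the point, or a new
representative is opened, with twice the largest capacity among those that cover `y`. -/
inductive Inserts {d : ℕ} (m : ℕ) (θ : ℝ) (b N : ℕ) (S : ℕ → Delegate d)
    (y : EuclideanSpace ℝ (Fin d)) (c : ℕ) : ℕ → ℕ → (ℕ → Delegate d) → Prop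
  | join (s : ℕ) (hb : b ≤ s) (hN : s < N) (h : (S s).Accepts m θ y c) :
      Inserts m θ b N S y c s N
        (Function.update S s ⟨(S s).loc, (S s).col, (S s).wt + 1, (S s).cap⟩)
  | new (cp : ℕ) (h : ∀ s, b ≤ s → s < N → ¬ (S s).Accepts m θ y c)
      (hcp : ∀ s, b ≤ s → s < N → (S s).col = c → (S s).Covers m θ y → 2 * (S s).cap ≤ cp)
      (hcp' : cp = 1 ∨ ∃ s, b ≤ s ∧ s < N ∧ (S s).col = c ∧ (S s).Covers m θ y ∧
        cp = 2 * (S s).cap) :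
      Inserts m θ b N S y c N (N + 1) (Function.update S N ⟨y, c, 1, cp⟩)

/-- The representatives `S b, …, S (N - 1)` summarize the points `i ∈ I`, which have colours
`col i`, were inserted at `q i`, and are now on the representatives `tgt i`, at the movement
bound `θ`. -/
structure Summary {d : ℕ} {ι : Type*} [DecidableEq ι] (m : ℕ) (θ : ℝ) (b N : ℕ)
    (S : ℕ → Delegate d) (I : Finset ι) (q : ι → EuclideanSpace ℝ (Fin d)) (col : ι → ℕ)
    (tgt : ι → ℕ) : Prop where
  le : b ≤ N
  tgt_mem : ∀ i ∈ I, b ≤ tgt i ∧ tgt i < N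
  col_eq : ∀ i ∈ I, (S (tgt i)).col = col i
  wt_eq : ∀ s, b ≤ s → s < N → (S s).wt = (I.filter fun i => tgt i = s).card
  wt_pos : ∀ s, b ≤ s → s < N → 0 < (S s).wt
  /-- each point is on a representative that covers it -/
  near : ∀ i ∈ I, (S (tgt i)).Covers m θ (q i)
  cap_pow : ∀ s, b ≤ s → s < N → ∃ j, (S s).cap = 2 ^ j
  /-- a representative of capacity more than one was opened because a full one of half the
  capacity was in the way -/
  parent : ∀ s, b ≤ s → s < N → (S s).cap = 1 ∨ ∃ s', b ≤ s' ∧ s' < N ∧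
    (S s').col = (S s).col ∧ (S s).cap = 2 * (S s').cap ∧ (S s').cap ≤ (S s').wt ∧
    (S s').Covers m θ (S s).loc
  sep : ∀ s, b ≤ s → s < N → ∀ s', b ≤ s' → s' < N → s ≠ s' → (S s).col = (S s').col →
    (S s).cap = (S s').cap → ¬ (S s).Covers m θ (S s').loc
  inj : ∀ s, b ≤ s → s < N → ∀ s', b ≤ s' → s' < N → s ≠ s' → (S s).col = (S s').col →
    (S s).loc ≠ (S s').loc
  /-- the movement is charged to the capacities that are in use; points beyond the capacity are
  accepted only where they are not moved, and are free -/
  movement : ∑ i ∈ I, dist (q i) (S (tgt i)).loc ^ m ≤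
    ∑ s ∈ Finset.Ico b N, θ * ((min (S s).wt (S s).cap : ℕ) / (S s).cap : ℝ)

namespace Summary

variable {d : ℕ} {ι : Type*} [DecidableEq ι] {m : ℕ} {θ : ℝ} {b N : ℕ} {S : ℕ → Delegate d}
  {I : Finset ι} {q : ι → EuclideanSpace ℝ (Fin d)} {col : ι → ℕ} {tgt : ι → ℕ}

theorem empty (m : ℕ) (θ : ℝ) (b : ℕ) (S : ℕ → Delegate d) (q : ι → EuclideanSpace ℝ (Fin d))
    (col : ι → ℕ) (tgt : ι → ℕ) : Summary m θ b b S ∅ q col tgt := by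
  constructor <;> first | (intros; omega) | simp

/-- A summary depends only on the representatives `S b, …, S (N - 1)` and on the data of the
points of `I`. -/
theorem congr (h : Summary m θ b N S I q col tgt) {S' : ℕ → Delegate d}
    {q' : ι → EuclideanSpace ℝ (Fin d)} {tgt' : ι → ℕ}
    (hS : ∀ s, b ≤ s → s < N → S' s = S s) (hq : ∀ i ∈ I, q' i = q i)
    (ht : ∀ i ∈ I, tgt' i = tgt i) : Summary m θ b N S' I q' col tgt' := by
  have hT : ∀ i ∈ I, S' (tgt' i) = S (tgt i) := fun i hi => by
    rw [ht i hi, hS _ (h.tgt_mem i hi).1 (h.tgt_mem i hi).2]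
  constructor
  · exact h.le
  · intro i hi; rw [ht i hi]; exact h.tgt_mem i hi
  · intro i hi; rw [hT i hi]; exact h.col_eq i hi
  · intro s hs hs'
    rw [hS s hs hs', h.wt_eq s hs hs']
    congr 1
    exact Finset.filter_congr fun i hi => by rw [ht i hi]
  · intro s hs hs'; rw [hS s hs hs']; exact h.wt_pos s hs hs'
  · intro i hi; rw [hT i hi, hq i hi]; exact h.near i hi
  · intro s hs hs'; rw [hS s hs hs']; exact h.cap_pow s hs hs'
  · intro s hs hs'
    rw [hS s hs hs']
    refine (h.parent s hs hs').imp id ?_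
    rintro ⟨s', h1, h2, h3⟩
    exact ⟨s', h1, h2, by rw [hS s' h1 h2]; exact h3⟩
  · intro s hs hs' s' h1 h2
    rw [hS s hs hs', hS s' h1 h2]; exact h.sep s hs hs' s' h1 h2
  · intro s hs hs' s' h1 h2
    rw [hS s hs hs', hS s' h1 h2]; exact h.inj s hs hs' s' h1 h2
  · have e1 : ∑ i ∈ I, dist (q' i) (S' (tgt' i)).loc ^ m =
        ∑ i ∈ I, dist (q i) (S (tgt i)).loc ^ m :=
      Finset.sum_congr rfl fun i hi => by rw [hT i hi, hq i hi]
    have e2 : ∑ s ∈ Finset.Ico b N, θ * ((min (S' s).wt (S' s).cap : ℕ) / (S' s).cap : ℝ) =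
        ∑ s ∈ Finset.Ico b N, θ * ((min (S s).wt (S s).cap : ℕ) / (S s).cap : ℝ) :=
      Finset.sum_congr rfl fun s hs => by
        rw [hS s (Finset.mem_Ico.1 hs).1 (Finset.mem_Ico.1 hs).2]
    rw [e1, e2]; exact h.movement

theorem cap_pos (h : Summary m θ b N S I q col tgt) {s : ℕ} (hs : b ≤ s) (hs' : s < N) :
    0 < (S s).cap := by
  obtain ⟨j, hj⟩ := h.cap_pow s hs hs'
  rw [hj]; positivity

/-- A representative is charged `θ` when it is full, whatever its capacity. -/
theorem movement_le (h : Summary m θ b N S I q col tgt) (hθ : 0 ≤ θ) :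
    ∑ i ∈ I, dist (q i) (S (tgt i)).loc ^ m ≤ (N - b : ℕ) * θ := by
  refine h.movement.trans ?_
  have : ∀ s ∈ Finset.Ico b N, θ * ((min (S s).wt (S s).cap : ℕ) / (S s).cap : ℝ) ≤ θ := by
    intro s hs
    refine mul_le_of_le_one_right hθ
      (div_le_one_of_le₀ (Nat.cast_le.2 (min_le_right _ _)) (Nat.cast_nonneg _))
  refine (Finset.sum_le_sum this).trans ?_
  simp

/-- The number of representatives is at most the number of points. -/
theorem sub_le_card (h : Summary m θ b N S I q col tgt) : N - b ≤ I.card := by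
  have h1 : I.card = ∑ s ∈ Finset.Ico b N, (I.filter fun i => tgt i = s).card :=
    Finset.card_eq_sum_card_fiberwise fun i hi => by
      simpa using h.tgt_mem i hi
  rw [h1]
  calc N - b = ∑ s ∈ Finset.Ico b N, 1 := by simp
    _ ≤ _ := Finset.sum_le_sum fun s hs => by
      have hs := Finset.mem_Ico.1 hs
      rw [← h.wt_eq s hs.1 hs.2]; exact h.wt_pos s hs.1 hs.2

theorem inserts (h : Summary m θ b N S I q col tgt) (hθ : 0 ≤ θ) (hm : m ≠ 0) {i₀ : ι}
    (hi₀ : i₀ ∉ I)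
    {s₀ N' : ℕ} {S' : ℕ → Delegate d} (hins : Inserts m θ b N S (q i₀) (col i₀) s₀ N' S') :
    Summary m θ b N' S' (insert i₀ I) q col (Function.update tgt i₀ s₀) := by
  have hne : ∀ i ∈ I, i ≠ i₀ := fun i hi e => hi₀ (e ▸ hi)
  cases hins with
  | join s₀ hb hN hacc =>
    obtain ⟨hcol, hcov, hfull⟩ := hacc
    set S' := Function.update S s₀ ⟨(S s₀).loc, (S s₀).col, (S s₀).wt + 1, (S s₀).cap⟩ with hS'
    have hloc : ∀ s, (S' s).loc = (S s).loc := fun s => by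
      by_cases e : s = s₀
      · subst e; simp [hS']
      · simp [hS', e]
    have hcol' : ∀ s, (S' s).col = (S s).col := fun s => by
      by_cases e : s = s₀
      · subst e; simp [hS']
      · simp [hS', e]
    have hcap : ∀ s, (S' s).cap = (S s).cap := fun s => by
      by_cases e : s = s₀
      · subst e; simp [hS']
      · simp [hS', e]
    have hwt : ∀ s, (S' s).wt = (S s).wt + if s = s₀ then 1 else 0 := fun s => by
      by_cases e : s = s₀
      · subst e; simp [hS']
      · simp [hS', e]
    have hC : ∀ s y, (S' s).Covers m θ y ↔ (S s).Covers m θ y := fun s y => by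
      simp only [Delegate.Covers, hloc, hcap]
    constructor
    · exact h.le
    · intro i hi
      rcases Finset.mem_insert.1 hi with rfl | hi
      · simp [hb, hN]
      · simpa [hne i hi] using h.tgt_mem i hi
    · intro i hi
      rw [hcol']
      rcases Finset.mem_insert.1 hi with rfl | hi
      · simpa using hcol
      · simpa [hne i hi] using h.col_eq i hi
    · intro s hs hs'
      rw [hwt, h.wt_eq s hs hs', Finset.filter_insert]
      have e : (I.filter fun i => Function.update tgt i₀ s₀ i = s) = I.filter fun i => tgt i = s :=
        Finset.filter_congr fun i hi => by simp [hne i hi]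
      rw [e]
      by_cases hss : s = s₀
      · subst hss; simp [hi₀]
      · simp [hss, Ne.symm hss]
    · intro s hs hs'; rw [hwt]; have := h.wt_pos s hs hs'; omega
    · intro i hi
      rw [hC]
      rcases Finset.mem_insert.1 hi with rfl | hi
      · simpa using hcov
      · simpa [hne i hi] using h.near i hi
    · intro s hs hs'; rw [hcap]; exact h.cap_pow s hs hs'
    · intro s hs hs'
      rw [hcap]
      refine (h.parent s hs hs').imp id ?_
      rintro ⟨s', h1, h2, h3, h4, h5, h6⟩
      refine ⟨s', h1, h2, ?_, ?_, ?_, ?_⟩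
      · rw [hcol', hcol']; exact h3
      · rw [hcap]; exact h4
      · rw [hcap, hwt]; omega
      · rw [hC, hloc]; exact h6
    · intro s hs hs' s' h1 h2
      rw [hcol', hcol', hcap, hcap, hC, hloc]; exact h.sep s hs hs' s' h1 h2
    · intro s hs hs' s' h1 h2
      rw [hcol', hcol', hloc, hloc]; exact h.inj s hs hs' s' h1 h2
    · rw [Finset.sum_insert hi₀]
      have e1 : ∑ i ∈ I, dist (q i) (S' (Function.update tgt i₀ s₀ i)).loc ^ m =
          ∑ i ∈ I, dist (q i) (S (tgt i)).loc ^ m :=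
        Finset.sum_congr rfl fun i hi => by simp [hne i hi, hloc]
      have e2 : ∑ s ∈ Finset.Ico b N, θ * ((min (S' s).wt (S' s).cap : ℕ) / (S' s).cap : ℝ) =
          ∑ s ∈ Finset.Ico b N, θ * ((min (S s).wt (S s).cap : ℕ) / (S s).cap : ℝ) +
          θ * (((min ((S s₀).wt + 1) (S s₀).cap : ℕ) - (min (S s₀).wt (S s₀).cap : ℕ)) /
            (S s₀).cap : ℝ) := by
        have hmem : s₀ ∈ Finset.Ico b N := Finset.mem_Ico.2 ⟨hb, hN⟩
        rw [← Finset.sum_erase_add _ _ hmem, ← Finset.sum_erase_add (Finset.Ico b N) _ hmem,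
          add_assoc]
        congr 1
        · refine Finset.sum_congr rfl fun s hs => ?_
          have : s ≠ s₀ := (Finset.mem_erase.1 hs).1
          simp [hwt, hcap, this]
        · rw [hwt, hcap]; simp; ring
      rw [e1, e2, hloc, Function.update_self, add_comm]
      refine add_le_add h.movement ?_
      have hc : (0 : ℝ) < (S s₀).cap := by exact_mod_cast h.cap_pos hb hN
      -- the point pays with its unit of the capacity, or it is not moved
      rcases hfull with hlt | heq
      · rw [min_eq_left (by omega : (S s₀).wt + 1 ≤ (S s₀).cap), min_eq_left hlt.le]
        rw [Delegate.Covers] at hcov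
        rw [Nat.cast_succ, add_sub_cancel_left, ← mul_div_assoc, mul_one, le_div_iff₀ hc]
        exact hcov
      · rw [heq, dist_self, zero_pow hm]
        refine mul_nonneg hθ (div_nonneg (sub_nonneg.2 (Nat.cast_le.2 ?_)) hc.le)
        exact min_le_min_right _ (Nat.le_succ _)
  | new cp hrej hcp hcp' =>
    set S' := Function.update S N ⟨q i₀, col i₀, 1, cp⟩ with hS'
    have hold : ∀ s, s < N → S' s = S s := fun s hs => by simp [hS', hs.ne]
    have hnew : S' N = ⟨q i₀, col i₀, 1, cp⟩ := by simp [hS']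
    have hfullcov : ∀ s, b ≤ s → s < N → (S s).col = col i₀ → (S s).Covers m θ (q i₀) →
        (S s).cap ≤ (S s).wt ∧ q i₀ ≠ (S s).loc := by
      intro s hs hs' h1 h2
      have := hrej s hs hs'
      simp only [Delegate.Accepts, h1, h2, true_and, not_or, not_lt] at this
      exact this
    have hcov0 : ∀ y : EuclideanSpace ℝ (Fin d), dist y y ^ m = 0 := fun y => by simp [hm]
    have hcpp : ∃ j, cp = 2 ^ j := by
      rcases hcp' with rfl | ⟨s, hs, hs', -, -, rfl⟩
      · exact ⟨0, rfl⟩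
      · obtain ⟨j, hj⟩ := h.cap_pow s hs hs'
        exact ⟨j + 1, by rw [hj]; ring⟩
    have hcp0 : 0 < cp := by obtain ⟨j, rfl⟩ := hcpp; positivity
    -- a representative with the new capacity cannot cover the new one: the new capacity is
    -- at least twice that of each covering representative
    have hsepnew : ∀ s, b ≤ s → s < N → (S s).col = col i₀ → (S s).cap = cp →
        ¬ (S s).Covers m θ (q i₀) := by
      intro s hs hs' h1 h2 h3
      have := hcp s hs hs' h1 h3
      omega
    constructor
    · have := h.le; omega
    · intro i hi
      rcases Finset.mem_insert.1 hi with rfl | hi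
      · simp [h.le]
      · have := h.tgt_mem i hi
        simp only [ne_eq, hne i hi, not_false_eq_true, Function.update_of_ne]; omega
    · intro i hi
      rcases Finset.mem_insert.1 hi with rfl | hi
      · simp [hnew]
      · have := h.tgt_mem i hi
        simp only [ne_eq, hne i hi, not_false_eq_true, Function.update_of_ne]
        rw [hold _ this.2]; exact h.col_eq i hi
    · intro s hs hs'
      rw [Finset.filter_insert]
      have e : (I.filter fun i => Function.update tgt i₀ N i = s) = I.filter fun i => tgt i = s :=
        Finset.filter_congr fun i hi => by simp [hne i hi]
      rw [e]
      rcases Nat.lt_succ_iff_lt_or_eq.1 hs' with hs' | rfl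
      · rw [hold s hs', h.wt_eq s hs hs']; simp [hs'.ne']
      · have e2 : (I.filter fun i => tgt i = s) = ∅ :=
          Finset.filter_eq_empty_iff.2 fun i hi => (h.tgt_mem i hi).2.ne
        simp [hnew, e2]
    · intro s hs hs'
      rcases Nat.lt_succ_iff_lt_or_eq.1 hs' with hs' | rfl
      · rw [hold s hs']; exact h.wt_pos s hs hs'
      · simp [hnew]
    · intro i hi
      rcases Finset.mem_insert.1 hi with rfl | hi
      · simp only [Function.update_self, hnew, Delegate.Covers, hcov0]; simpa using hθ
      · have := h.tgt_mem i hi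
        simp only [ne_eq, hne i hi, not_false_eq_true, Function.update_of_ne]
        rw [hold _ this.2]; exact h.near i hi
    · intro s hs hs'
      rcases Nat.lt_succ_iff_lt_or_eq.1 hs' with hs' | rfl
      · rw [hold s hs']; exact h.cap_pow s hs hs'
      · rw [hnew]; exact hcpp
    · intro s hs hs'
      rcases Nat.lt_succ_iff_lt_or_eq.1 hs' with hs' | rfl
      · rw [hold s hs']
        refine (h.parent s hs hs').imp id ?_
        rintro ⟨s', h1, h2, h3⟩
        exact ⟨s', h1, by omega, by rw [hold s' h2]; exact h3⟩
      · rw [hnew]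
        refine hcp'.imp id ?_
        rintro ⟨s', h1, h2, h3, h4, h5⟩
        exact ⟨s', h1, by omega, by
          rw [hold s' h2]; exact ⟨h3, h5, (hfullcov s' h1 h2 h3 h4).1, h4⟩⟩
    · intro s hs hs' s' h1 h2 hss
      rcases Nat.lt_succ_iff_lt_or_eq.1 hs' with hs' | rfl <;>
        rcases Nat.lt_succ_iff_lt_or_eq.1 h2 with h2 | rfl
      · rw [hold s hs', hold s' h2]; exact h.sep s hs hs' s' h1 h2 hss
      · rw [hold s hs', hnew]; exact fun e1 e2 => hsepnew s hs hs' e1 e2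
      · rw [hold s' h2, hnew]
        intro e1 e2
        have := hsepnew s' h1 h2 e1.symm e2.symm
        simp only [Delegate.Covers] at this e2 ⊢
        rwa [dist_comm, e2]
      · exact absurd rfl hss
    · -- a representative at the same place would have accepted the point
      have key : ∀ s, b ≤ s → s < N → (S s).col = col i₀ → (S s).loc ≠ q i₀ := by
        intro s hs hs' e1 e2
        refine (hfullcov s hs hs' e1 ?_).2 e2.symm
        rw [Delegate.Covers, e2, hcov0]; simpa using hθ
      intro s hs hs' s' h1 h2 hss
      rcases Nat.lt_succ_iff_lt_or_eq.1 hs' with hs' | rfl <;>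
        rcases Nat.lt_succ_iff_lt_or_eq.1 h2 with h2 | rfl
      · rw [hold s hs', hold s' h2]; exact h.inj s hs hs' s' h1 h2 hss
      · rw [hold s hs', hnew]; exact fun e1 => key s hs hs' e1
      · rw [hold s' h2, hnew]; exact fun e1 e2 => key s' h1 h2 e1.symm e2.symm
      · exact absurd rfl hss
    · rw [Finset.sum_insert hi₀, Finset.sum_Ico_succ_top h.le]
      have e1 : ∑ i ∈ I, dist (q i) (S' (Function.update tgt i₀ N i)).loc ^ m =
          ∑ i ∈ I, dist (q i) (S (tgt i)).loc ^ m :=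
        Finset.sum_congr rfl fun i hi => by
          simp only [ne_eq, hne i hi, not_false_eq_true, Function.update_of_ne]
          rw [hold _ (h.tgt_mem i hi).2]
      have e2 : ∑ s ∈ Finset.Ico b N, θ * ((min (S' s).wt (S' s).cap : ℕ) / (S' s).cap : ℝ) =
          ∑ s ∈ Finset.Ico b N, θ * ((min (S s).wt (S s).cap : ℕ) / (S s).cap : ℝ) :=
        Finset.sum_congr rfl fun s hs => by rw [hold s (Finset.mem_Ico.1 hs).2]
      rw [e1, e2, Function.update_self, hnew, hcov0, zero_add]
      have := h.movement
      have h3 : 0 ≤ θ * ((min 1 cp : ℕ) / (cp : ℝ)) := by positivity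
      linarith

end Summary

/-! ### A summary with many representatives is expensive to cluster -/

namespace Summary

variable {d : ℕ} {ι : Type*} [DecidableEq ι] {m : ℕ} {θ : ℝ} {b N : ℕ} {S : ℕ → Delegate d}
  {I : Finset ι} {q : ι → EuclideanSpace ℝ (Fin d)} {col : ι → ℕ} {tgt : ι → ℕ}

theorem covers_iff (h : Summary m θ b N S I q col tgt) (hθ : 0 ≤ θ) (hm : m ≠ 0) {s : ℕ}
    (hs : b ≤ s) (hs' : s < N) (y : EuclideanSpace ℝ (Fin d)) :
    (S s).Covers m θ y ↔ dist y (S s).loc ≤ scaleRad m θ (S s).cap :=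
  (le_scaleRad_iff hm hθ (h.cap_pos hs hs') dist_nonneg).symm

/-- Full representatives are a constant fraction of all representatives, since each of the
others has a full one in its way and is in the way of few others. -/
theorem sub_le_mul_card_full (h : Summary m θ b N S I q col tgt) (hθ : 0 < θ) (hm : m ≠ 0) :
    N - b ≤ (1 + 5 ^ d) * ((Finset.Ico b N).filter fun s => (S s).cap ≤ (S s).wt).card := by
  classical
  have hex : ∀ s, b ≤ s → s < N → ∃ s', (b ≤ s' ∧ s' < N ∧ (S s').cap ≤ (S s').wt) ∧
      (s' = s ∨ ((S s').col = (S s).col ∧ (S s).cap = 2 * (S s').cap ∧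
        (S s').Covers m θ (S s).loc)) := by
    intro s hs hs'
    rcases h.parent s hs hs' with h1 | ⟨s', h1, h2, h3, h4, h5, h6⟩
    · exact ⟨s, ⟨hs, hs', by rw [h1]; exact h.wt_pos s hs hs'⟩, Or.inl rfl⟩
    · exact ⟨s', ⟨h1, h2, h5⟩, Or.inr ⟨h3, h4, h6⟩⟩
  -- at most `5 ^ d` representatives and the full one itself share it: those of twice its capacity
  -- are in a ball of its radius, and separated by at least half of this radius
  choose! par hpar using hex
  have key := Finset.card_le_mul_card_image_of_maps_to (f := par) (s := Finset.Ico b N)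
    (t := (Finset.Ico b N).filter fun s => (S s).cap ≤ (S s).wt) (fun s hs => by
      obtain ⟨⟨h1, h2, h3⟩, -⟩ := hpar s (Finset.mem_Ico.1 hs).1 (Finset.mem_Ico.1 hs).2
      exact Finset.mem_filter.2 ⟨Finset.mem_Ico.2 ⟨h1, h2⟩, h3⟩) (1 + 5 ^ d) (fun p hp => by
    obtain ⟨hp1, hp2⟩ := Finset.mem_filter.1 hp
    obtain ⟨hp3, hp4⟩ := Finset.mem_Ico.1 hp1
    set A := (Finset.Ico b N).filter fun s => (S s).col = (S p).col ∧ (S s).cap = 2 * (S p).cap ∧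
      (S p).Covers m θ (S s).loc with hA
    have hsub : ((Finset.Ico b N).filter fun s => par s = p) ⊆ insert p A := by
      intro s hs
      obtain ⟨hs1, hs2⟩ := Finset.mem_filter.1 hs
      obtain ⟨-, h5⟩ := hpar s (Finset.mem_Ico.1 hs1).1 (Finset.mem_Ico.1 hs1).2
      rw [hs2] at h5
      rcases h5 with rfl | ⟨h5, h6, h7⟩
      · exact Finset.mem_insert_self _ _
      · exact Finset.mem_insert_of_mem (Finset.mem_filter.2 ⟨hs1, h5.symm, h6, h7⟩)
    have hcp := h.cap_pos hp3 hp4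
    have hρ : 0 < scaleRad m θ (2 * (S p).cap) := scaleRad_pos hθ (by omega)
    have hcard : (A.card : ℝ) ≤ 5 ^ d := by
      refine (card_le_of_separated_of_dist_le A (fun s => (S s).loc) (S p).loc hρ
        (scaleRad_nonneg (m := m) hθ.le (S p).cap) ?_ ?_).trans ?_
      · intro s hs
        obtain ⟨-, -, -, hs2⟩ := Finset.mem_filter.1 hs
        exact (h.covers_iff hθ.le hm hp3 hp4 _).1 hs2
      · intro s hs s' hs' hss
        obtain ⟨hs1, hs2, hs3, -⟩ := Finset.mem_filter.1 hs
        obtain ⟨hs1', hs2', hs3', -⟩ := Finset.mem_filter.1 hs'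
        rw [Finset.mem_Ico] at hs1 hs1'
        have := h.sep s' hs1'.1 hs1'.2 s hs1.1 hs1.2 hss.symm (by rw [hs2, hs2'])
          (by rw [hs3, hs3'])
        rw [h.covers_iff hθ.le hm hs1'.1 hs1'.2, hs3'] at this
        exact (not_le.1 this).le
      · have hnn := scaleRad_nonneg (m := m) hθ.le (S p).cap
        refine pow_le_pow_left₀ (by positivity) ?_ d
        have := scaleRad_le_two_mul hm hθ.le hcp
        have h2 : 2 * scaleRad m θ (S p).cap / scaleRad m θ (2 * (S p).cap) ≤ 4 := by
          rw [div_le_iff₀ hρ]; linarith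
        linarith
    have hcard' : A.card ≤ 5 ^ d := by exact_mod_cast hcard
    calc _ ≤ (insert p A).card := Finset.card_le_card hsub
      _ ≤ A.card + 1 := Finset.card_insert_le _ _
      _ ≤ 1 + 5 ^ d := by omega)
  simpa using key

/-- Packing bounds the number of full representatives that are close to the centres, relative
to their radius, for each capacity, colour and nearest centre. A full representative has at
least as many points as its capacity, so at most `L + 1` capacities occur. -/
theorem card_near_le (h : Summary m θ b N S I q col tgt) (hθ : 0 < θ) (hm : m ≠ 0) {ℓ L : ℕ}
    (hcol : ∀ i ∈ I, col i < ℓ) (hI : I.card ≤ 2 ^ L) {C : Finset (EuclideanSpace ℝ (Fin d))}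
    (hC : C.Nonempty) {Λ : ℝ} (hΛ : 0 ≤ Λ) :
    (((Finset.Ico b N).filter fun s => (S s).cap ≤ (S s).wt ∧
      Metric.infDist (S s).loc (C : Set (EuclideanSpace ℝ (Fin d))) ≤
        Λ * scaleRad m θ (S s).cap).card : ℝ) ≤
      (L + 1) * ℓ * C.card * (1 + 2 * Λ) ^ d := by
  classical
  have hnear : ∀ y : EuclideanSpace ℝ (Fin d), ∃ c ∈ C,
      Metric.infDist y (C : Set (EuclideanSpace ℝ (Fin d))) = dist y c := fun y => by
    simpa using C.finite_toSet.isCompact.exists_infDist_eq_dist (by simpa using hC) y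
  choose nc hnc hncd using hnear
  set A := (Finset.Ico b N).filter fun s => (S s).cap ≤ (S s).wt ∧
      Metric.infDist (S s).loc (C : Set (EuclideanSpace ℝ (Fin d))) ≤
        Λ * scaleRad m θ (S s).cap with hA
  have hmaps : ∀ s ∈ A, ((S s).cap, (S s).col, nc (S s).loc) ∈
      ((Finset.range (L + 1)).image fun j => 2 ^ j) ×ˢ (Finset.range ℓ ×ˢ C) := by
    intro s hs
    obtain ⟨hs1, hs2, -⟩ := Finset.mem_filter.1 hs
    obtain ⟨h1, h2⟩ := Finset.mem_Ico.1 hs1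
    simp only [Finset.mem_product, Finset.mem_image, Finset.mem_range]
    refine ⟨?_, ?_, hnc _⟩
    · obtain ⟨j, hj⟩ := h.cap_pow s h1 h2
      refine ⟨j, ?_, hj.symm⟩
      have h3 : 2 ^ j ≤ 2 ^ L := by
        rw [← hj]
        refine hs2.trans ((h.wt_eq s h1 h2).le.trans ((Finset.card_filter_le _ _).trans hI))
      have := (Nat.pow_le_pow_iff_right (by norm_num : 1 < 2)).1 h3
      omega
    · have h3 := h.wt_pos s h1 h2
      rw [h.wt_eq s h1 h2, Finset.card_pos] at h3
      obtain ⟨i, hi⟩ := h3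
      obtain ⟨hi1, hi2⟩ := Finset.mem_filter.1 hi
      rw [← hi2, h.col_eq i hi1]; exact hcol i hi1
  have hfib : ∀ z ∈ ((Finset.range (L + 1)).image fun j => 2 ^ j) ×ˢ (Finset.range ℓ ×ˢ C),
      ((A.filter fun s => ((S s).cap, (S s).col, nc (S s).loc) = z).card : ℝ) ≤
        (1 + 2 * Λ) ^ d := by
    rintro ⟨e, c, z⟩ hz
    have he : 0 < e := by
      simp only [Finset.mem_product, Finset.mem_image] at hz
      obtain ⟨⟨j, -, rfl⟩, -⟩ := hz
      positivity
    have hρ : 0 < scaleRad m θ e := scaleRad_pos hθ he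
    have h0 : (1 + 2 * Λ) = 1 + 2 * (Λ * scaleRad m θ e) / scaleRad m θ e := by field_simp
    rw [h0]
    refine card_le_of_separated_of_dist_le _ (fun s => (S s).loc) z hρ (by positivity) ?_ ?_
    · intro s hs
      obtain ⟨hs1, hs2⟩ := Finset.mem_filter.1 hs
      obtain ⟨-, -, hs3⟩ := Finset.mem_filter.1 hs1
      simp only [Prod.mk.injEq] at hs2
      rw [hncd, hs2.1, hs2.2.2] at hs3
      exact hs3
    · intro s hs s' hs' hss
      obtain ⟨hs1, hs2⟩ := Finset.mem_filter.1 hs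
      obtain ⟨hs1', hs2'⟩ := Finset.mem_filter.1 hs'
      have h1 := Finset.mem_Ico.1 (Finset.mem_filter.1 hs1).1
      have h1' := Finset.mem_Ico.1 (Finset.mem_filter.1 hs1').1
      simp only [Prod.mk.injEq] at hs2 hs2'
      have := h.sep s' h1'.1 h1'.2 s h1.1 h1.2 hss.symm (by rw [hs2.2.1, hs2'.2.1])
          (by rw [hs2.1, hs2'.1])
      rw [h.covers_iff hθ.le hm h1'.1 h1'.2, hs2'.1] at this
      exact (not_le.1 this).le
  have h1 := Finset.card_eq_sum_card_fiberwise hmaps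
  have h2 : (A.card : ℝ) = ∑ z ∈ ((Finset.range (L + 1)).image fun j => 2 ^ j) ×ˢ
      (Finset.range ℓ ×ˢ C),
      ((A.filter fun s => ((S s).cap, (S s).col, nc (S s).loc) = z).card : ℝ) := by
    exact_mod_cast h1
  rw [h2]
  refine (Finset.sum_le_sum hfib).trans ?_
  rw [Finset.sum_const, nsmul_eq_mul, Finset.card_product, Finset.card_product, Finset.card_range]
  refine mul_le_mul_of_nonneg_right ?_ (by positivity)
  have h3 : ((Finset.range (L + 1)).image fun j => 2 ^ j).card ≤ L + 1 :=
    Finset.card_image_le.trans (Finset.card_range _).le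
  have h4 : ((((Finset.range (L + 1)).image fun j => 2 ^ j).card : ℕ) : ℝ) ≤ (L + 1 : ℕ) := by
    exact_mod_cast h3
  push_cast at h4 ⊢
  rw [mul_assoc]
  exact mul_le_mul_of_nonneg_right h4 (by positivity)

/-- Each full representative that is far from the centres, relative to its radius, is
responsible for a fixed amount of the clustering cost. -/
theorem card_far_mul_le (h : Summary m θ b N S I q col tgt) (hθ : 0 < θ) (hm : m ≠ 0)
    (C : Set (EuclideanSpace ℝ (Fin d))) {Λ : ℝ} (hΛ : 1 ≤ Λ) :
    (((Finset.Ico b N).filter fun s => (S s).cap ≤ (S s).wt ∧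
      ¬ Metric.infDist (S s).loc C ≤ Λ * scaleRad m θ (S s).cap).card : ℝ) *
        ((Λ - 1) ^ m * θ) ≤ ∑ i ∈ I, Metric.infDist (q i) C ^ m := by
  set A := (Finset.Ico b N).filter fun s => (S s).cap ≤ (S s).wt ∧
      ¬ Metric.infDist (S s).loc C ≤ Λ * scaleRad m θ (S s).cap with hA
  calc (A.card : ℝ) * ((Λ - 1) ^ m * θ) = ∑ s ∈ A, ((Λ - 1) ^ m * θ) := by simp
    _ ≤ ∑ s ∈ A, ∑ i ∈ I.filter (fun i => tgt i = s), Metric.infDist (q i) C ^ m := by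
      refine Finset.sum_le_sum fun s hs => ?_
      obtain ⟨hs1, hs2, hs3⟩ := Finset.mem_filter.1 hs
      obtain ⟨h1, h2⟩ := Finset.mem_Ico.1 hs1
      have hr := scaleRad_nonneg (m := m) hθ.le (S s).cap
      have hpt : ∀ i ∈ I.filter (fun i => tgt i = s),
          ((Λ - 1) * scaleRad m θ (S s).cap) ^ m ≤ Metric.infDist (q i) C ^ m := by
        intro i hi
        obtain ⟨hi1, hi2⟩ := Finset.mem_filter.1 hi
        have h3 := h.near i hi1
        rw [hi2, h.covers_iff hθ.le hm h1 h2, dist_comm] at h3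
        have h4 := Metric.infDist_le_infDist_add_dist (s := C) (x := (S s).loc) (y := q i)
        refine pow_le_pow_left₀ (mul_nonneg (by linarith) hr) ?_ m
        push Not at hs3
        nlinarith
      have h5 := Finset.card_nsmul_le_sum _ _ _ hpt
      rw [← h.wt_eq s h1 h2, nsmul_eq_mul] at h5
      refine le_trans ?_ h5
      have h6 := scaleRad_pow hm hθ.le (h.cap_pos h1 h2)
      have h7 : ((S s).cap : ℝ) ≤ (S s).wt := by exact_mod_cast hs2
      calc (Λ - 1) ^ m * θ = (S s).cap * ((Λ - 1) * scaleRad m θ (S s).cap) ^ m := by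
            rw [mul_pow]; nth_rewrite 1 [← h6]; ring
        _ ≤ _ := mul_le_mul_of_nonneg_right h7
          (pow_nonneg (mul_nonneg (by linarith) hr) m)
    _ = ∑ i ∈ I.filter (fun i => tgt i ∈ A), Metric.infDist (q i) C ^ m := by
      rw [← Finset.sum_fiberwise_of_maps_to (t := A) (g := tgt)
        (fun i hi => (Finset.mem_filter.1 hi).2)]
      refine Finset.sum_congr rfl fun s hs => Finset.sum_congr ?_ fun _ _ => rfl
      ext i
      simp only [Finset.mem_filter]
      constructor
      · rintro ⟨h1, rfl⟩; exact ⟨⟨h1, hs⟩, rfl⟩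
      · rintro ⟨⟨h1, -⟩, h2⟩; exact ⟨h1, h2⟩
    _ ≤ _ := Finset.sum_le_sum_of_subset_of_nonneg (Finset.filter_subset _ _)
      fun i _ _ => pow_nonneg Metric.infDist_nonneg m

end Summary

/-- The number of representatives that a block of level one may have; a block of level `L` may
have `L` times as many. The base `131072 ^ d` absorbs the constants of the packing arguments
(`le_levelBound`) and takes few steps to compute. -/
noncomputable def levelBound (d k ℓ : ℕ) (ε : ℝ) : ℝ :=
  (131072 ^ d / ε) ^ d * (ℓ * k)

theorem le_levelBound {d k ℓ : ℕ} {ε : ℝ} (hd : 1 ≤ d) (hε : 0 < ε) (hε1 : ε ≤ 1) :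
    4 * (1 + 5 ^ d) * (ℓ * k * (1 + 2 * (256 * (1 + 5 ^ d) / ε)) ^ d) ≤ levelBound d k ℓ ε := by
  unfold levelBound
  have h6 : (1 + 5 ^ d : ℝ) ≤ 6 ^ d := by
    have := pow_add_pow_le (x := (1 : ℝ)) (y := 5) (n := d) (by norm_num) (by norm_num) (by omega)
    norm_num at this; exact this
  have h1 : (1 : ℝ) ≤ 1 + 5 ^ d := le_add_of_nonneg_right (by positivity)
  set g : ℝ := 1 + 5 ^ d with hg
  have hbase : 1 + 2 * (256 * g / ε) ≤ 768 * g / ε := by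
    have : 1 ≤ 256 * g / ε := by rw [le_div_iff₀ hε]; nlinarith
    calc _ ≤ 256 * g / ε + 2 * (256 * g / ε) := by linarith
      _ = _ := by ring
  have hbase0 : 0 ≤ 1 + 2 * (256 * g / ε) := by positivity
  have hq : 4 * g ≤ (4 * g) ^ d := le_self_pow₀ (by linarith) (by omega)
  calc 4 * g * (ℓ * k * (1 + 2 * (256 * g / ε)) ^ d)
      ≤ (4 * g) ^ d * (ℓ * k * (768 * g / ε) ^ d) := by gcongr
    _ = (3072 * (g * g) / ε) ^ d * (ℓ * k) := by
      rw [show (3072 * (g * g) / ε) = (4 * g) * (768 * g / ε) by ring, mul_pow (4 * g)]; ac_rfl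
    _ ≤ (131072 ^ d / ε) ^ d * (ℓ * k) := by
      have h3 : (3072 : ℝ) ≤ 3072 ^ d := le_self_pow₀ (by norm_num) (by omega)
      have h2 : 3072 * (g * g) ≤ 131072 ^ d := by
        calc 3072 * (g * g) ≤ 3072 ^ d * (6 ^ d * 6 ^ d) := by gcongr
          _ = 110592 ^ d := by rw [← mul_pow, ← mul_pow]; norm_num
          _ ≤ _ := by gcongr; norm_num
      gcongr

/-- Every clustering of points whose summary has more than `levelBound * L` representatives is
expensive. Full representatives are many, only few of them are close to the centres, and the
others pay. -/
theorem Summary.le_cost_of_overflow {d : ℕ} {ι : Type*} [DecidableEq ι] {m : ℕ} {θ : ℝ} {b N : ℕ}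
    {S : ℕ → Delegate d} {I : Finset ι} {q : ι → EuclideanSpace ℝ (Fin d)} {col : ι → ℕ}
    {tgt : ι → ℕ} (h : Summary m θ b N S I q col tgt) (hθ : 0 ≤ θ) (hm : m = 1 ∨ m = 2)
    (hd : 1 ≤ d) {k ℓ L : ℕ} {ε : ℝ} (hk : 1 ≤ k) (hε : 0 < ε) (hε1 : ε ≤ 1) (hL : 1 ≤ L)
    (hcol : ∀ i ∈ I, col i < ℓ) (hI : I.card ≤ 2 ^ L)
    {C : Finset (EuclideanSpace ℝ (Fin d))} (hC : C.card = k)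
    (hN : levelBound d k ℓ ε * L < (N - b : ℕ)) :
    (16 * m / ε) ^ m * (2 * (levelBound d k ℓ ε * L)) * θ ≤
      ∑ i ∈ I, Metric.infDist (q i) (C : Set (EuclideanSpace ℝ (Fin d))) ^ m := by
  rcases hθ.eq_or_lt with rfl | hθ
  · rw [mul_zero]; exact Finset.sum_nonneg fun i _ => pow_nonneg Metric.infDist_nonneg m
  have hm0 : m ≠ 0 := by omega
  have hCne : C.Nonempty := Finset.card_pos.1 (by omega)
  -- `g` is the factor between all and full representatives; far means more than `Λ` radii away
  set g : ℝ := 1 + 5 ^ d with hg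
  have hg1 : 1 ≤ g := le_add_of_nonneg_right (by positivity)
  set Λ : ℝ := 256 * g / ε with hΛ
  have hΛ1 : 256 * g ≤ Λ := by rw [hΛ, le_div_iff₀ hε]; nlinarith
  set K : ℝ := levelBound d k ℓ ε * L with hK
  have hKb : 4 * g * (ℓ * k * (1 + 2 * Λ) ^ d) * L ≤ K :=
    mul_le_mul_of_nonneg_right (le_levelBound hd hε hε1) (Nat.cast_nonneg _)
  have hfull := h.sub_le_mul_card_full hθ hm0
  have hnear := h.card_near_le hθ hm0 hcol hI hCne (Λ := Λ) (by linarith)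
  have hfar := h.card_far_mul_le hθ hm0 (C : Set (EuclideanSpace ℝ (Fin d))) (Λ := Λ)
    (by linarith)
  set F := (Finset.Ico b N).filter fun s => (S s).cap ≤ (S s).wt
  set A := (Finset.Ico b N).filter fun s => (S s).cap ≤ (S s).wt ∧
      Metric.infDist (S s).loc (C : Set (EuclideanSpace ℝ (Fin d))) ≤
        Λ * scaleRad m θ (S s).cap
  set B := (Finset.Ico b N).filter fun s => (S s).cap ≤ (S s).wt ∧
      ¬ Metric.infDist (S s).loc (C : Set (EuclideanSpace ℝ (Fin d))) ≤
        Λ * scaleRad m θ (S s).cap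
  have hAB : F.card = A.card + B.card := by
    rw [← Finset.card_filter_add_card_filter_not (s := F) (fun s => Metric.infDist (S s).loc
      (C : Set (EuclideanSpace ℝ (Fin d))) ≤ Λ * scaleRad m θ (S s).cap), Finset.filter_filter,
      Finset.filter_filter]
  have hfull' : ((N - b : ℕ) : ℝ) ≤ g * (A.card + B.card) := by
    have : ((N - b : ℕ) : ℝ) ≤ ((1 + 5 ^ d) * F.card : ℕ) := by exact_mod_cast hfull
    rw [hAB] at this
    push_cast at this
    exact this
  have hL' : (1 : ℝ) ≤ L := by exact_mod_cast hL
  rw [hC] at hnear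
  have hX : 0 ≤ (ℓ * k * (1 + 2 * Λ) ^ d : ℝ) := by
    have : 0 ≤ Λ := by linarith
    positivity
  have hA2 : g * A.card ≤ K / 2 := by
    have h1 : (A.card : ℝ) ≤ 2 * L * (ℓ * k * (1 + 2 * Λ) ^ d) := by
      refine hnear.trans ?_
      calc ((L : ℝ) + 1) * ℓ * k * (1 + 2 * Λ) ^ d = (L + 1) * (ℓ * k * (1 + 2 * Λ) ^ d) := by ring
        _ ≤ _ := mul_le_mul_of_nonneg_right (by linarith) hX
    nlinarith
  have hB2 : K / 2 ≤ g * B.card := by linarith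
  have hpow : 4 * g * (16 * m / ε) ^ m ≤ (Λ - 1) ^ m := by
    have h1 : 128 * g / ε ≤ Λ - 1 := by
      have : 1 ≤ 128 * g / ε := by rw [le_div_iff₀ hε]; nlinarith
      have : Λ = 128 * g / ε + 128 * g / ε := by rw [hΛ]; ring
      linarith
    refine le_trans ?_ (pow_le_pow_left₀ (by positivity) h1 m)
    rcases hm with rfl | rfl
    · rw [pow_one, pow_one, ← mul_div_assoc, div_le_div_iff_of_pos_right hε]
      push_cast; linarith
    · rw [div_pow, div_pow, ← mul_div_assoc, div_le_div_iff_of_pos_right (by positivity)]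
      push_cast; nlinarith
  refine le_trans ?_ hfar
  have hB0 : (0 : ℝ) ≤ B.card := Nat.cast_nonneg _
  have hp0 : 0 ≤ (16 * m / ε) ^ m := by positivity
  calc (16 * m / ε) ^ m * (2 * K) * θ ≤ (16 * m / ε) ^ m * (4 * (g * B.card)) * θ :=
        mul_le_mul_of_nonneg_right (mul_le_mul_of_nonneg_left (by linarith) hp0) hθ.le
    _ = B.card * ((4 * g * (16 * m / ε) ^ m) * θ) := by ring
    _ ≤ _ := by gcongr

/-- In particular a block that overflows has more than `k` representatives. -/
theorem levelBound_ge {d k ℓ : ℕ} {ε : ℝ} (hd : 1 ≤ d) (hk : 1 ≤ k) (hℓ : 1 ≤ ℓ) (hε : 0 < ε)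
    (hε1 : ε ≤ 1) : (16 : ℝ) * k ≤ levelBound d k ℓ ε := by
  unfold levelBound
  have h1 : (131072 : ℝ) ≤ 131072 ^ d := le_self_pow₀ (by norm_num) (by omega)
  have h2 : (131072 : ℝ) ≤ 131072 ^ d / ε := by rw [le_div_iff₀ hε]; nlinarith
  have h3 : 131072 ^ d / ε ≤ (131072 ^ d / ε) ^ d := le_self_pow₀ (by linarith) (by omega)
  have hk' : (1 : ℝ) ≤ k := by exact_mod_cast hk
  have hℓ' : (1 : ℝ) ≤ ℓ := by exact_mod_cast hℓ
  have h4 : (k : ℝ) ≤ ℓ * k := by nlinarith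
  nlinarith

/-- Among more than `k` points two share a nearest centre, so that their distance is a lower
bound for the clustering cost. -/
theorem le_cost_of_pairwise_le_dist {d : ℕ} {ι : Type*} [DecidableEq ι] {m : ℕ}
    (hm : m = 1 ∨ m = 2) {I : Finset ι} {x : ι → EuclideanSpace ℝ (Fin d)} {A : Finset ι}
    (hAI : A ⊆ I)
    {δ : ℝ} (hδ : 0 ≤ δ) (hA : ∀ i ∈ A, ∀ j ∈ A, i ≠ j → δ ≤ dist (x i) (x j))
    {C : Finset (EuclideanSpace ℝ (Fin d))} (hC : C.Nonempty) (hk : C.card < A.card) :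
    δ ^ m / 2 ≤ ∑ i ∈ I, Metric.infDist (x i) (C : Set (EuclideanSpace ℝ (Fin d))) ^ m := by
  classical
  have hnear : ∀ y : EuclideanSpace ℝ (Fin d), ∃ c ∈ C,
      Metric.infDist y (C : Set (EuclideanSpace ℝ (Fin d))) = dist y c := fun y => by
    simpa using C.finite_toSet.isCompact.exists_infDist_eq_dist (by simpa using hC) y
  choose nc hnc hncd using hnear
  obtain ⟨i, hi, j, hj, hij, he⟩ := Finset.exists_ne_map_eq_of_card_lt_of_maps_to hk
    (f := fun i => nc (x i)) (fun i _ => hnc _)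
  have h1 : δ ≤ dist (x i) (nc (x i)) + dist (x j) (nc (x j)) := by
    refine (hA i hi j hj hij).trans ?_
    have he : nc (x i) = nc (x j) := he
    have := dist_triangle_right (x i) (x j) (nc (x i))
    rwa [← he]
  have h2 : ∑ i ∈ ({i, j} : Finset ι), Metric.infDist (x i) (C : Set (EuclideanSpace ℝ (Fin d))) ^ m
      ≤ ∑ i ∈ I, Metric.infDist (x i) (C : Set (EuclideanSpace ℝ (Fin d))) ^ m := by
    refine Finset.sum_le_sum_of_subset_of_nonneg ?_ fun i _ _ => pow_nonneg Metric.infDist_nonneg m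
    intro a ha
    simp only [Finset.mem_insert, Finset.mem_singleton] at ha
    rcases ha with rfl | rfl
    · exact hAI hi
    · exact hAI hj
  refine le_trans ?_ h2
  rw [Finset.sum_pair hij, hncd, hncd]
  have h3 : 0 ≤ dist (x i) (nc (x i)) := dist_nonneg
  have h4 : 0 ≤ dist (x j) (nc (x j)) := dist_nonneg
  rcases hm with rfl | rfl
  · simp only [pow_one]; linarith
  · have h5 : δ ^ 2 ≤ (dist (x i) (nc (x i)) + dist (x j) (nc (x j))) ^ 2 :=
      pow_le_pow_left₀ hδ h1 2
    nlinarith [sq_nonneg (dist (x i) (nc (x i)) - dist (x j) (nc (x j)))]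

/-! ### Changing the radius of a summary -/

/-- The clustering cost of the points `i ∈ I`. -/
noncomputable def costOn {d : ℕ} {ι : Type*} (m : ℕ) (I : Finset ι)
    (x : ι → EuclideanSpace ℝ (Fin d)) (C : Finset (EuclideanSpace ℝ (Fin d))) : ℝ :=
  ∑ i ∈ I, Metric.infDist (x i) (C : Set (EuclideanSpace ℝ (Fin d))) ^ m

theorem costOn_mono {d : ℕ} {ι : Type*} (m : ℕ) {I J : Finset ι} (h : I ⊆ J)
    (x : ι → EuclideanSpace ℝ (Fin d)) (C : Finset (EuclideanSpace ℝ (Fin d))) :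
    costOn m I x C ≤ costOn m J x C :=
  Finset.sum_le_sum_of_subset_of_nonneg h fun _ _ _ => pow_nonneg Metric.infDist_nonneg m

/-- Moving points twice costs at most a factor `2 ^ (m - 1)` more than the two movements. -/
theorem sum_dist_pow_le {d : ℕ} {ι : Type*} (m : ℕ) (I : Finset ι)
    (x y z : ι → EuclideanSpace ℝ (Fin d)) :
    ∑ i ∈ I, dist (x i) (z i) ^ m ≤
      2 ^ (m - 1) * (∑ i ∈ I, dist (x i) (y i) ^ m + ∑ i ∈ I, dist (y i) (z i) ^ m) := by
  rw [← Finset.sum_add_distrib, Finset.mul_sum]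
  refine Finset.sum_le_sum fun i _ => ?_
  exact (pow_le_pow_left₀ dist_nonneg (dist_triangle _ (y i) _) m).trans
    (add_pow_le dist_nonneg dist_nonneg m)

theorem costOn_le_of_movement {d : ℕ} {ι : Type*} (m : ℕ) (I : Finset ι)
    (x y : ι → EuclideanSpace ℝ (Fin d)) (C : Finset (EuclideanSpace ℝ (Fin d))) :
    costOn m I y C ≤ 2 ^ (m - 1) * (costOn m I x C + ∑ i ∈ I, dist (x i) (y i) ^ m) := by
  unfold costOn
  rw [← Finset.sum_add_distrib, Finset.mul_sum]
  refine Finset.sum_le_sum fun i _ => ?_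
  have h := Metric.infDist_le_infDist_add_dist (s := (C : Set (EuclideanSpace ℝ (Fin d))))
    (x := y i) (y := x i)
  rw [dist_comm] at h
  exact (pow_le_pow_left₀ Metric.infDist_nonneg h m).trans
    (add_pow_le Metric.infDist_nonneg dist_nonneg m)

/-- A block is a part of the stream that is summarized at one radius `r`. The points
`i ∈ I` are at `x i`, were inserted at `q i` when the radius became `r`, and are now on the
representatives `tgt i`. The number `u` is the largest reciprocal of a squared distance of
two representatives, as long as the radius is zero. -/
structure Block {d : ℕ} {ι : Type*} [DecidableEq ι] (m k : ℕ) (ε K : ℝ)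
    (x : ι → EuclideanSpace ℝ (Fin d)) (col : ι → ℕ) (r u : ℝ) (b N : ℕ) (S : ℕ → Delegate d)
    (I : Finset ι) (q : ι → EuclideanSpace ℝ (Fin d)) (tgt : ι → ℕ) : Prop where
  summary : Summary m (r ^ m) b N S I q col tgt
  r_nonneg : 0 ≤ r
  source : ∀ s, b ≤ s → s < N → ∃ i ∈ I, (S s).loc = x i ∧ (S s).col = col i
  /-- the movement at the earlier, smaller radii -/
  history : ∑ i ∈ I, dist (x i) (q i) ^ m ≤ 2 * K * r ^ m
  /-- the overflow at the previous radius shows that the points are expensive to cluster -/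
  lower : ∀ C : Finset (EuclideanSpace ℝ (Fin d)), C.card = k →
    (4 * m / ε) ^ m * (2 * K) * r ^ m ≤ costOn m I x C
  /-- at radius zero, `u` determines the least distance of two representatives; it is zero as long
  as there is only one -/
  gap : r = 0 → (∀ s, b ≤ s → s < N → ∀ s', b ≤ s' → s' < N → s ≠ s' →
      (dist (S s).loc (S s').loc ^ 2)⁻¹ ≤ u) ∧
    (u = 0 ∨ ∃ s s', b ≤ s ∧ s < N ∧ b ≤ s' ∧ s' < N ∧ s ≠ s' ∧
      u = (dist (S s).loc (S s').loc ^ 2)⁻¹)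

namespace Block

variable {d : ℕ} {ι : Type*} [DecidableEq ι] {m k : ℕ} {ε K : ℝ}
  {x : ι → EuclideanSpace ℝ (Fin d)} {col : ι → ℕ} {r u : ℝ} {b N : ℕ} {S : ℕ → Delegate d}
  {I : Finset ι} {q : ι → EuclideanSpace ℝ (Fin d)} {tgt : ι → ℕ}

theorem empty (hm : m ≠ 0) (b : ℕ) (S : ℕ → Delegate d) (q : ι → EuclideanSpace ℝ (Fin d))
    (tgt : ι → ℕ) : Block m k ε K x col 0 0 b b S ∅ q tgt where
  summary := Summary.empty _ _ _ _ _ _ _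
  r_nonneg := le_rfl
  source := by intros; omega
  history := by simp [hm]
  lower := by simp [hm, costOn]
  gap := fun _ => ⟨by intros; omega, Or.inl rfl⟩

theorem ne_loc (h : Block m k ε K x col r u b N S I q tgt) (hx : Function.Injective x) {s s' : ℕ}
    (hs : b ≤ s) (hs' : s < N) (h1 : b ≤ s') (h2 : s' < N) (hne : s ≠ s') :
    (S s).loc ≠ (S s').loc := by
  intro e
  obtain ⟨i, -, hi, hi'⟩ := h.source s hs hs'
  obtain ⟨j, -, hj, hj'⟩ := h.source s' h1 h2
  have : i = j := hx (by rw [← hi, ← hj, e])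
  subst this
  exact h.summary.inj s hs hs' s' h1 h2 hne (by rw [hi', hj']) e

/-- At radius zero, two representatives that realize the least distance are points of the
stream. -/
theorem exists_gap_eq (h : Block m k ε K x col 0 u b N S I q tgt) (hx : Function.Injective x)
    (hN : 2 ≤ N - b) : 0 < u ∧ ∃ i j, i ≠ j ∧ u = (dist (x i) (x j) ^ 2)⁻¹ := by
  obtain ⟨g1, g2⟩ := h.gap rfl
  have hu : 0 < u := by
    refine lt_of_lt_of_le ?_ (g1 b le_rfl (by omega) (b + 1) (by omega) (by omega) (by omega))
    have := dist_pos.2 (h.ne_loc hx le_rfl (by omega) (by omega : b ≤ b + 1) (by omega)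
      (by omega))
    positivity
  refine ⟨hu, ?_⟩
  rcases g2 with rfl | ⟨s, s', h1, h2, h3, h4, h5, h6⟩
  · exact absurd hu (lt_irrefl _)
  obtain ⟨i, -, hi, -⟩ := h.source s h1 h2
  obtain ⟨j, -, hj, -⟩ := h.source s' h3 h4
  refine ⟨i, j, fun e => h.ne_loc hx h1 h2 h3 h4 h5 (by rw [hi, hj, e]), by rw [← hi, ← hj, h6]⟩

/-- Inserting the next point of the stream. The new `u` takes the distances from the point to the
representatives into account; at radius zero the point always becomes a representative. -/
theorem inserts (h : Block m k ε K x col r u b N S I q tgt) (hm : m ≠ 0)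
    (hx : Function.Injective x)
    {i₀ : ι} (hi₀ : i₀ ∉ I) {s₀ N' : ℕ} {S' : ℕ → Delegate d} {u' : ℝ}
    (hins : Inserts m (r ^ m) b N S (x i₀) (col i₀) s₀ N' S')
    (hu1 : u ≤ u') (hu2 : ∀ s, b ≤ s → s < N → (dist (x i₀) (S s).loc ^ 2)⁻¹ ≤ u')
    (hu3 : u' = u ∨ ∃ s, b ≤ s ∧ s < N ∧ u' = (dist (x i₀) (S s).loc ^ 2)⁻¹) :
    Block m k ε K x col r u' b N' S' (insert i₀ I) (Function.update q i₀ (x i₀))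
      (Function.update tgt i₀ s₀) := by
  have hne : ∀ i ∈ I, i ≠ i₀ := fun i hi e => hi₀ (e ▸ hi)
  have hqI : ∀ i ∈ I, Function.update q i₀ (x i₀) i = q i := fun i hi => by simp [hne i hi]
  have hsum : Summary m (r ^ m) b N S I (Function.update q i₀ (x i₀)) col tgt :=
    h.summary.congr (fun _ _ _ => rfl) hqI fun _ _ => rfl
  refine ⟨hsum.inserts (pow_nonneg h.r_nonneg m) hm hi₀ (by simpa using hins), h.r_nonneg,
    ?_, ?_, ?_, ?_⟩
  · have hI : ∀ s, b ≤ s → s < N → ∃ i ∈ insert i₀ I, (S s).loc = x i ∧ (S s).col = col i := by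
      intro s hs hs'
      obtain ⟨i, hi, h1⟩ := h.source s hs hs'
      exact ⟨i, Finset.mem_insert_of_mem hi, h1⟩
    cases hins with
    | join s₀ hb hN hacc =>
      intro s hs hs'
      obtain ⟨i, hi, h1, h2⟩ := hI s hs hs'
      refine ⟨i, hi, ?_⟩
      by_cases e : s = s₀
      · subst e; simpa using ⟨h1, h2⟩
      · simpa [e] using ⟨h1, h2⟩
    | new cp hrej hcp hcp' =>
      intro s hs hs'
      by_cases e : s = N
      · subst e; exact ⟨i₀, Finset.mem_insert_self _ _, by simp⟩
      · simpa [e] using hI s hs (by omega)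
  · rw [Finset.sum_insert hi₀, Function.update_self, dist_self, zero_pow hm, zero_add]
    refine le_of_eq_of_le (Finset.sum_congr rfl fun i hi => by rw [hqI i hi]) h.history
  · exact fun C hC => (h.lower C hC).trans (costOn_mono m (Finset.subset_insert _ _) x C)
  · rintro rfl
    obtain ⟨g1, g2⟩ := h.gap rfl
    cases hins with
    | join s₀ hb hN hacc =>
      exfalso
      obtain ⟨-, hcov, -⟩ := hacc
      have hc : (0 : ℝ) < (S s₀).cap := by exact_mod_cast h.summary.cap_pos hb hN
      rw [Delegate.Covers, zero_pow hm] at hcov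
      have h1 : dist (x i₀) (S s₀).loc ^ m = 0 :=
        le_antisymm (nonpos_of_mul_nonpos_left hcov hc) (pow_nonneg dist_nonneg m)
      have h2 := dist_eq_zero.1 ((pow_eq_zero_iff hm).1 h1)
      obtain ⟨i, hi, h3, -⟩ := h.source s₀ hb hN
      exact hne i hi (hx (by rw [← h3, h2]))
    | new cp hrej hcp hcp' =>
      refine ⟨?_, ?_⟩
      · intro s hs hs' s' h1 h2 hss
        by_cases e : s = N <;> by_cases e' : s' = N
        · omega
        · subst e; simpa [e'] using hu2 s' h1 (by omega)
        · subst e'; simpa [e, dist_comm] using hu2 s hs (by omega)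
        · simpa [e, e'] using (g1 s hs (by omega) s' h1 (by omega) hss).trans hu1
      · rcases hu3 with rfl | ⟨s, hs, hs', e⟩
        · rcases g2 with rfl | ⟨s, s', h1, h2, h3, h4, h5, h6⟩
          · exact Or.inl rfl
          · exact Or.inr ⟨s, s', h1, by omega, h3, by omega, h5, by simpa [h2.ne, h4.ne] using h6⟩
        · exact Or.inr ⟨N, s, by omega, by omega, hs, by omega, by omega,
            by simpa [hs'.ne] using e⟩

/-- The movement of the block, at earlier radii and at the current one, is small compared with the
cost of any `k` centres on its points. -/
theorem movement_le (h : Block m k ε K x col r u b N S I q tgt) (hm : m = 1 ∨ m = 2)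
    (hε : 0 < ε) (hK : ((N - b : ℕ) : ℝ) ≤ 2 * K) {C : Finset (EuclideanSpace ℝ (Fin d))}
    (hC : C.card = k) :
    ∑ i ∈ I, dist (x i) (S (tgt i)).loc ^ m ≤ (ε / (2 * m)) ^ m * costOn m I x C := by
  have hr := pow_nonneg h.r_nonneg m
  have h1 := sum_dist_pow_le m I x q fun i => (S (tgt i)).loc
  have h2 := h.summary.movement_le hr
  have h3 := h.history
  have h4 := h.lower C hC
  have h5 : ((N - b : ℕ) : ℝ) * r ^ m ≤ 2 * K * r ^ m := mul_le_mul_of_nonneg_right hK hr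
  have h6 : (2 : ℝ) ^ (m - 1) * (2 * K * r ^ m + 2 * K * r ^ m) =
      (ε / (2 * m)) ^ m * ((4 * m / ε) ^ m * (2 * K) * r ^ m) := by
    have : (ε / (2 * m)) ^ m * (4 * m / ε) ^ m = (2 : ℝ) ^ m := by
      rw [← mul_pow]; congr 1
      rcases hm with rfl | rfl <;> field_simp <;> norm_num
    rw [← mul_assoc, ← mul_assoc, this]
    rcases hm with rfl | rfl <;> norm_num <;> ring
  calc _ ≤ 2 ^ (m - 1) * (2 * K * r ^ m + 2 * K * r ^ m) := by
        refine h1.trans (mul_le_mul_of_nonneg_left ?_ (by positivity)); linarith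
    _ ≤ _ := by rw [h6]; exact mul_le_mul_of_nonneg_left h4 (by positivity)

/-- The representatives of an overflowing block may be summarized again at the radius `r'` that
is `2 r`, or that is small compared with the distances of the points if `r` is zero. -/
theorem rescale (h : Block m k ε K x col r u b N S I q tgt) (hm : m = 1 ∨ m = 2)
    (hx : Function.Injective x) (hε : 0 < ε) (hε1 : ε ≤ 1) (hd : 1 ≤ d) (hk : 1 ≤ k) {ℓ L : ℕ}
    (hL : 1 ≤ L) (hKeq : K = levelBound d k ℓ ε * L) (hK16 : 16 * (k : ℝ) ≤ K)
    (hcol : ∀ i ∈ I, col i < ℓ) (hI : I.card ≤ 2 ^ L)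
    (hN : K < (N - b : ℕ)) (hN' : ((N - b : ℕ) : ℝ) ≤ 2 * K) {r' : ℝ} (hr' : 0 < r')
    (hr0 : r = 0 → r' ^ 2 = (ε / K / K) ^ 2 / u) (hr1 : r ≠ 0 → r' = 2 * r)
    {N₁ : ℕ} {S₁ : ℕ → Delegate d} {q₁ : ι → EuclideanSpace ℝ (Fin d)} {tgt₁ : ι → ℕ}
    (hq₁ : ∀ i ∈ I, q₁ i = (S (tgt i)).loc)
    (hsrc : ∀ s, b ≤ s → s < N₁ → ∃ s', b ≤ s' ∧ s' < N ∧ (S₁ s).loc = (S s').loc ∧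
      (S₁ s).col = (S s').col)
    (h₁ : Summary m (r' ^ m) b N₁ S₁ I q₁ col tgt₁) (u' : ℝ) :
    Block m k ε K x col r' u' b N₁ S₁ I q₁ tgt₁ := by
  have hm0 : m ≠ 0 := by omega
  have hk' : (1 : ℝ) ≤ k := by exact_mod_cast hk
  have hK0 : 0 < K := by linarith
  have hrm := pow_nonneg h.r_nonneg m
  have hhist : ∑ i ∈ I, dist (x i) (q₁ i) ^ m ≤ 2 ^ m * (2 * K * r ^ m) := by
    have e : ∑ i ∈ I, dist (x i) (q₁ i) ^ m = ∑ i ∈ I, dist (x i) (S (tgt i)).loc ^ m :=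
      Finset.sum_congr rfl fun i hi => by rw [hq₁ i hi]
    have h1 := sum_dist_pow_le m I x q fun i => (S (tgt i)).loc
    have h2 := h.summary.movement_le hrm
    have h3 := h.history
    have h5 : ((N - b : ℕ) : ℝ) * r ^ m ≤ 2 * K * r ^ m := mul_le_mul_of_nonneg_right hN' hrm
    rw [e]
    refine h1.trans ?_
    obtain ⟨j, rfl⟩ := Nat.exists_eq_succ_of_ne_zero hm0
    rw [Nat.succ_sub_one, pow_succ 2 j, mul_assoc]
    exact mul_le_mul_of_nonneg_left (by linarith) (by positivity)
  refine ⟨h₁, hr'.le, ?_, ?_, ?_, fun e => absurd e hr'.ne'⟩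
  · intro s hs hs'
    obtain ⟨s', h1, h2, h3, h4⟩ := hsrc s hs hs'
    obtain ⟨i, hi, h5, h6⟩ := h.source s' h1 h2
    exact ⟨i, hi, h3.trans h5, h4.trans h6⟩
  · refine hhist.trans ?_
    by_cases hr : r = 0
    · rw [hr, zero_pow hm0, mul_zero, mul_zero]; positivity
    · rw [hr1 hr, mul_pow]; exact le_of_eq (by ring)
  · intro C hC
    by_cases hr : r = 0
    · -- the first radius: more than `k` points have pairwise distances of at least `u ^ (-1 / 2)`
      subst hr
      obtain ⟨g1, g2⟩ := h.gap rfl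
      have hNb : 2 ≤ N - b := by
        have : (1 : ℝ) < (N - b : ℕ) := by linarith
        exact_mod_cast this
      have hu : 0 < u := (h.exists_gap_eq hx hNb).1
      set δ := Real.sqrt u⁻¹ with hδ
      have hδ2 : δ ^ 2 = u⁻¹ := Real.sq_sqrt (by positivity)
      have hδ0 : 0 < δ := Real.sqrt_pos.2 (by positivity)
      have hr'δ : r' = ε / K / K * δ := by
        have h1 : r' ^ 2 = (ε / K / K * δ) ^ 2 := by
          rw [hr0 rfl, mul_pow, hδ2, div_eq_mul_inv]
        exact (pow_left_inj₀ hr'.le (by positivity) two_ne_zero).1 h1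
      have hsep : ∀ s, b ≤ s → s < N → ∀ s', b ≤ s' → s' < N → s ≠ s' →
          δ ≤ dist (S s).loc (S s').loc := by
        intro s hs hs' s' h1 h2 hss
        have h3 := g1 s hs hs' s' h1 h2 hss
        have h4 := dist_pos.2 (h.ne_loc hx hs hs' h1 h2 hss)
        refine Real.sqrt_le_iff.2 ⟨h4.le, ?_⟩
        rw [inv_le_comm₀ hu (by positivity)]; exact h3
      have hex : ∀ s : ℕ, ∃ i, b ≤ s → s < N → i ∈ I ∧ (S s).loc = x i := by
        intro s
        by_cases hs : b ≤ s ∧ s < N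
        · obtain ⟨i, hi, h1, -⟩ := h.source s hs.1 hs.2
          exact ⟨i, fun _ _ => ⟨hi, h1⟩⟩
        · obtain ⟨i, -⟩ := h.source b le_rfl (by omega)
          exact ⟨i, fun h1 h2 => absurd ⟨h1, h2⟩ hs⟩
      choose src hsrc' using hex
      have hinj : Set.InjOn src (Finset.Ico b N : Set ℕ) := by
        intro s hs s' hs' e
        simp only [Finset.coe_Ico, Set.mem_Ico] at hs hs'
        by_contra hne
        refine h.ne_loc hx hs.1 hs.2 hs'.1 hs'.2 hne ?_
        rw [(hsrc' s hs.1 hs.2).2, (hsrc' s' hs'.1 hs'.2).2, e]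
      have key := le_cost_of_pairwise_le_dist (x := x) hm (I := I) (A := (Finset.Ico b N).image src)
        (by
          intro i hi
          obtain ⟨s, hs, rfl⟩ := Finset.mem_image.1 hi
          exact (hsrc' s (Finset.mem_Ico.1 hs).1 (Finset.mem_Ico.1 hs).2).1) hδ0.le
        (by
          intro i hi j hj hij
          obtain ⟨s, hs, rfl⟩ := Finset.mem_image.1 hi
          obtain ⟨s', hs', rfl⟩ := Finset.mem_image.1 hj
          rw [Finset.mem_Ico] at hs hs'
          rw [← (hsrc' s hs.1 hs.2).2, ← (hsrc' s' hs'.1 hs'.2).2]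
          exact hsep s hs.1 hs.2 s' hs'.1 hs'.2 fun e => hij (by rw [e]))
        (C := C) (Finset.card_pos.1 (by omega)) (by
          rw [Finset.card_image_of_injOn hinj, hC, Nat.card_Ico]
          have : (k : ℝ) < (N - b : ℕ) := by linarith
          exact_mod_cast this)
      refine le_trans ?_ key
      rw [hr'δ, mul_pow, ← mul_assoc, show δ ^ m / 2 = 1 / 2 * δ ^ m by ring]
      refine mul_le_mul_of_nonneg_right ?_ (by positivity)
      have hK16' : 16 ≤ K := by linarith
      rcases hm with rfl | rfl
      · have : (4 * ((1 : ℕ) : ℝ) / ε) ^ 1 * (2 * K) * (ε / K / K) ^ 1 = 8 / K := by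
          push_cast; field_simp; norm_num
        rw [this, div_le_iff₀ hK0]; linarith
      · have : (4 * ((2 : ℕ) : ℝ) / ε) ^ 2 * (2 * K) * (ε / K / K) ^ 2 = 128 / K ^ 3 := by
          push_cast; field_simp; norm_num
        rw [this, div_le_iff₀ (by positivity)]
        have : (16 : ℝ) ^ 3 ≤ K ^ 3 := pow_le_pow_left₀ (by norm_num) hK16' 3
        linarith
    · -- the cost of the inserted locations exceeds that of the points by at most the history
      rw [hr1 hr]
      have h1 := h.summary.le_cost_of_overflow hrm hm hd hk hε hε1 hL hcol hI hC
        (by rw [← hKeq]; exact hN)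
      rw [← hKeq] at h1
      have h2 := costOn_le_of_movement m I x q C
      have h3 := h.history
      change _ ≤ costOn m I q C at h1
      have hb1 : 1 ≤ (8 * m / ε) ^ m := by
        refine one_le_pow₀ ?_
        rw [le_div_iff₀ hε]
        have : (1 : ℝ) ≤ m := by exact_mod_cast Nat.one_le_iff_ne_zero.2 hm0
        linarith
      have e1 : (16 * m / ε : ℝ) ^ m = 2 ^ m * (8 * m / ε) ^ m := by
        rw [← mul_pow]; congr 1; ring
      have e2 : (4 * m / ε) ^ m * (2 * K) * (2 * r) ^ m = (8 * m / ε) ^ m * (2 * K * r ^ m) := by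
        have : (8 * m / ε : ℝ) = 4 * m / ε * 2 := by ring
        rw [this, mul_pow, mul_pow]; ring
      rw [e2]
      rw [e1] at h1
      set X := 2 * K * r ^ m with hX
      have hX0 : 0 ≤ X := by positivity
      set p := (8 * m / ε : ℝ) ^ m with hp
      have h4 : (2 : ℝ) ^ (m - 1) * (2 * (p * X)) ≤ 2 ^ (m - 1) * (costOn m I x C + X) := by
        calc (2 : ℝ) ^ (m - 1) * (2 * (p * X)) = 2 ^ m * p * (2 * K) * r ^ m := by
              obtain ⟨j, rfl⟩ := Nat.exists_eq_succ_of_ne_zero hm0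
              rw [Nat.succ_sub_one, pow_succ 2 j, hX]; ring
          _ ≤ _ := h1
          _ ≤ _ := h2
          _ ≤ _ := mul_le_mul_of_nonneg_left (by linarith) (by positivity)
      have h5 := le_of_mul_le_mul_left h4 (by positivity)
      nlinarith

end Block

/-! ### Reasoning about programs -/

/-- On a machine with `s` cells the program halts from `σ` after at most `T` steps, in a state
that satisfies `Q`. -/
def Wp (s : ℕ) (p : RamProg) (σ : RamState) (T : ℕ) (Q : RamState → Prop) : Prop :=
  ∃ t τ, Exec s p σ t τ ∧ t ≤ T ∧ Q τ

namespace Wp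

variable {s T T₁ T₂ : ℕ} {p p₁ p₂ : RamProg} {σ : RamState} {Q Q' : RamState → Prop}
  {b : RamTest}

theorem mono (h : Wp s p σ T₁ Q) (hT : T₁ ≤ T) (hQ : ∀ τ, Q τ → Q' τ) : Wp s p σ T Q' := by
  obtain ⟨t, τ, h1, h2, h3⟩ := h
  exact ⟨t, τ, h1, h2.trans hT, hQ τ h3⟩

theorem skip (h : Q σ) : Wp s .skip σ T Q := ⟨0, σ, .skip σ, Nat.zero_le _, h⟩

theorem seq (T₁ T₂ : ℕ) (hT : T₁ + T₂ ≤ T)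
    (h : Wp s p₁ σ T₁ fun τ => Wp s p₂ τ T₂ Q) : Wp s (.seq p₁ p₂) σ T Q := by
  obtain ⟨t, τ, h1, h2, t', τ', h3, h4, h5⟩ := h
  exact ⟨t + t', τ', .seq h1 h3, by omega, h5⟩

theorem ite (hf : b.Fits s σ) (hT : T₁ + 1 ≤ T) (h₁ : b.Holds σ → Wp s p₁ σ T₁ Q)
    (h₂ : ¬ b.Holds σ → Wp s p₂ σ T₁ Q) : Wp s (.ite b p₁ p₂) σ T Q := by
  by_cases hb : b.Holds σ
  · obtain ⟨t, τ, h1, h2, h3⟩ := h₁ hb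
    exact ⟨1 + t, τ, .iteTrue hf hb h1, by omega, h3⟩
  · obtain ⟨t, τ, h1, h2, h3⟩ := h₂ hb
    exact ⟨1 + t, τ, .iteFalse hf hb h1, by omega, h3⟩

/-- A loop with an invariant that is indexed by a bound on the remaining number of
iterations. -/
theorem loop (Inv : ℕ → RamState → Prop) (hf : ∀ n τ, Inv n τ → b.Fits s τ)
    (h0 : ∀ τ, Inv 0 τ → ¬ b.Holds τ)
    (hs : ∀ n τ, Inv (n + 1) τ → b.Holds τ → Wp s p τ T₁ (Inv n)) (n : ℕ) (h : Inv n σ)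
    (hT : n * (T₁ + 1) + 1 ≤ T) :
    Wp s (.loop b p) σ T fun τ => ∃ k, Inv k τ ∧ ¬ b.Holds τ := by
  induction n generalizing σ T with
  | zero => exact ⟨1, σ, .loopFalse (hf _ _ h) (h0 _ h), by omega, 0, h, h0 _ h⟩
  | succ n ih =>
    by_cases hb : b.Holds σ
    · obtain ⟨t, τ, h1, h2, h3⟩ := hs n σ h hb
      obtain ⟨t', τ', h4, h5, h6⟩ := ih h3 le_rfl
      refine ⟨1 + t + t', τ', .loopTrue (hf _ _ h) hb h1 h4, ?_, h6⟩
      have : (n + 1) * (T₁ + 1) = n * (T₁ + 1) + T₁ + 1 := by ring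
      omega
    · exact ⟨1, σ, .loopFalse (hf _ _ h) hb, by omega, n + 1, h, hb⟩

/-- A loop with a known number of iterations. -/
theorem loop_count (Inv : ℕ → RamState → Prop) (hf : ∀ n τ, Inv n τ → b.Fits s τ)
    (h0 : ∀ n τ, Inv n τ → (b.Holds τ ↔ n ≠ 0))
    (hs : ∀ n τ, Inv (n + 1) τ → Wp s p τ T₁ (Inv n)) (n : ℕ) (h : Inv n σ)
    (hT : n * (T₁ + 1) + 1 ≤ T) : Wp s (.loop b p) σ T (Inv 0) := by
  refine (loop Inv hf (fun τ h => by simpa using (h0 0 τ h).not) (fun n τ h _ => hs n τ h) n h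
    hT).mono le_rfl ?_
  rintro τ ⟨k, h1, h2⟩
  have : k = 0 := by simpa using (h0 k τ h1).not.1 h2
  exact this ▸ h1

end Wp

/-- Straight-line code. -/
def block : List Instr → RamProg
  | [] => .skip
  | i :: l => .seq (.instr i) (block l)

/-- All instructions of the list find their cells when the list is executed. -/
def FitsAll (s : ℕ) : List Instr → RamState → Prop
  | [], _ => True
  | i :: l, σ => i.Fits s σ ∧ FitsAll s l (i.apply σ)

/-- The effect of straight-line code. -/
noncomputable def applyAll : List Instr → RamState → RamState
  | [], σ => σ
  | i :: l, σ => applyAll l (i.apply σ)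

theorem Wp.block {s T : ℕ} {l : List Instr} {σ : RamState} {Q : RamState → Prop}
    (hT : l.length ≤ T) (hf : FitsAll s l σ) (hQ : Q (applyAll l σ)) :
    Wp s (block l) σ T Q := by
  induction l generalizing σ T with
  | nil => exact Wp.skip hQ
  | cons i l ih =>
    rw [List.length_cons] at hT
    exact Wp.seq 1 (T - 1) (by omega) ⟨1, _, .instr hf.1, le_rfl,
      ih (by omega) hf.2 hQ⟩

/-! ### The memory layout -/

/-- The cells that are constant while the stream is processed. The cell `Z 3` holds the colour of
the input and `R 1, …, R d` its location. The representatives are in two arrays, with three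
integer cells each from `Z 40` on and `d` real cells each from `R (d + 9)` on.

* `Z 10, Z 11` hold the addresses of the first representative of the current block in the two
  arrays, `Z 14, Z 15` the first free addresses, `Z 12, Z 13` the numbers of points and of
  representatives of the current block.
* A scan of the representatives uses `Z 16, Z 17` for the addresses of the one that is compared
  with the input and `Z 22, Z 23` for those of its weight and capacity, and leaves in `Z 18` the
  address of the weight of an accepting one, in `Z 19` the capacity for a new one. The cells
  `Z 20, Z 21` run over coordinates.
* A rebuild uses `Z 24, Z 25` for the addresses of the representative that is inserted again, `Z 26`
  for the end of the first array, `Z 27` for the number of copies that remain.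
* The real variables, which come after the input, are addressed through `Z 30, …, Z 36`: a
  squared distance in `R (d + 1)`, an intermediate result in `R (d + 2)`, the largest reciprocal
  of a squared distance in `R (d + 3)`, the square of the radius in `R (d + 4)`, the bound on the
  number of representatives of the current block in `R (d + 5)`, on the number of its points in
  `R (d + 6)`, and zero in `R (d + 7)`. -/
structure Env (d : ℕ) (σ : RamState) : Prop where
  z0 : σ.Z 0 = d
  z8 : σ.Z 8 = 1
  z9 : σ.Z 9 = 3
  z28 : σ.Z 28 = 0
  z30 : σ.Z 30 = d + 1
  z31 : σ.Z 31 = d + 2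
  z32 : σ.Z 32 = d + 3
  z33 : σ.Z 33 = d + 4
  z34 : σ.Z 34 = d + 5
  z35 : σ.Z 35 = d + 6
  z36 : σ.Z 36 = d + 7
  r7 : σ.R (d + 7) = 0

theorem Env.of_frame {d : ℕ} {σ τ : RamState} (h : Env d σ)
    (hZ : ∀ a, a < 10 ∨ 27 < a → a < 40 → a ≠ 3 → τ.Z a = σ.Z a) (hR : τ.R (d + 7) = σ.R (d + 7)) :
    Env d τ := by
  obtain ⟨h1, h2, h3, h4, h5, h6, h7, h8, h9, h10, h11, h12⟩ := h
  constructor <;> first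
    | rw [hR]; assumption
    | rw [hZ _ (by omega) (by omega) (by omega)]; assumption

/-- The representatives in the memory: colour, weight and capacity are in three consecutive
integer cells. -/
noncomputable def store (d : ℕ) (σ : RamState) (i : ℕ) : Delegate d where
  loc := WithLp.toLp 2 fun j => σ.R (d + 9 + i * d + j)
  col := σ.Z (40 + 3 * i)
  wt := σ.Z (40 + 3 * i + 1)
  cap := σ.Z (40 + 3 * i + 2)

/-- The location in the input cells. -/
noncomputable def input (d : ℕ) (σ : RamState) : EuclideanSpace ℝ (Fin d) :=
  WithLp.toLp 2 fun j => σ.R (1 + j)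

theorem store_congr {d : ℕ} {σ τ : RamState} (hZ : ∀ a, 40 ≤ a → τ.Z a = σ.Z a)
    (hR : ∀ a, d + 9 ≤ a → τ.R a = σ.R a) : store d τ = store d σ := by
  funext i
  simp only [store]
  congr 1
  · congr 1; funext j; exact hR _ (by omega)
  all_goals exact hZ _ (by omega)

theorem input_congr {d : ℕ} {σ τ : RamState} (hR : ∀ a, 1 ≤ a → a ≤ d → τ.R a = σ.R a) :
    input d τ = input d σ := by
  simp only [input]
  congr 1; funext j; exact hR _ (by omega) (by omega)

/-- The addresses of the coordinates of different representatives are different. -/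
theorem coord_lt_or_le {d i N : ℕ} (j : Fin d) (h : i ≠ N) :
    i * d + j < N * d ∨ N * d + d ≤ i * d + j := by
  rcases lt_or_gt_of_ne h with h | h
  · left
    have : (i + 1) * d ≤ N * d := Nat.mul_le_mul_right d h
    have := j.2
    rw [Nat.add_mul, one_mul] at *
    omega
  · right
    have : (N + 1) * d ≤ i * d := Nat.mul_le_mul_right d h
    rw [Nat.add_mul, one_mul] at this
    omega

/-! ### Inserting a point -/

/-- Adds the squared distance of the input and the location at address `Z 21` to the real
variable at `Z 30`. -/
def distProg : RamProg :=
  .loop (.zle (.dir 20) (.dir 0)) (block [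
    .rsub (.ind 31) (.ind 20) (.ind 21),
    .rmul (.ind 31) (.ind 31) (.ind 31),
    .radd (.ind 30) (.ind 30) (.ind 31),
    .zadd (.dir 20) (.dir 20) (.dir 8),
    .zadd (.dir 21) (.dir 21) (.dir 8)])

theorem distProg_wp {s d A : ℕ} {σ : RamState} (hE : Env d σ) (hs : 40 ≤ s) (hs' : d + 9 ≤ s)
    (h20 : σ.Z 20 = 1) (h21 : σ.Z 21 = A) (hA : d + 9 ≤ A) (hA' : A + d ≤ s)
    (hD : σ.R (d + 1) = 0) :
    Wp s distProg σ (6 * d + 1) fun τ =>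
      τ.R (d + 1) = ∑ j ∈ Finset.range d, (σ.R (1 + j) - σ.R (A + j)) ^ 2 ∧
      (∀ a, a < 20 ∨ 21 < a → τ.Z a = σ.Z a) ∧
      (∀ a, a < d + 1 ∨ d + 2 < a → τ.R a = σ.R a) := by
  refine (Wp.loop_count (T₁ := 5) (n := d) (fun k τ => k ≤ d ∧
    τ.Z 20 = 1 + (d - k) ∧ τ.Z 21 = A + (d - k) ∧
    τ.R (d + 1) = ∑ j ∈ Finset.range (d - k), (σ.R (1 + j) - σ.R (A + j)) ^ 2 ∧
    (∀ a, a < 20 ∨ 21 < a → τ.Z a = σ.Z a) ∧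
    (∀ a, a < d + 1 ∨ d + 2 < a → τ.R a = σ.R a)) ?_ ?_ ?_ ?_ (by omega)).mono le_rfl ?_
  · rintro n τ ⟨-, h⟩
    simp only [RamTest.Fits, Addr.Fits]; omega
  · rintro n τ ⟨h1, h2, h3, h4, h5, h6⟩
    have := hE.z0
    simp only [RamTest.Holds, RamState.getZ, Addr.loc, h2, h5 0 (by omega), this]; omega
  · rintro n τ ⟨h1, h2, h3, h4, h5, h6⟩
    have e : d - n = d - (n + 1) + 1 := by omega
    have z8 := hE.z8
    have z30 := hE.z30
    have z31 := hE.z31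
    rw [← h5 _ (by omega)] at z8 z30 z31
    have hr1 := h6 (1 + (d - (n + 1))) (by omega)
    have hr2 := h6 (A + (d - (n + 1))) (by omega)
    refine Wp.block le_rfl ?_ ?_
    · simp (disch := omega) only [FitsAll, Instr.Fits, Addr.Fits, Instr.apply, RamState.setR,
        RamState.getR, Addr.loc, h2, h3, z30, z31, Function.update_self, and_true]
      omega
    · simp (disch := omega) only [applyAll, Instr.apply, RamState.setR,
        RamState.setZ, RamState.getR, RamState.getZ, Addr.loc, h2, h3, h4, z8, z30, z31,
        Function.update_self, Function.update_of_ne, hr1, hr2]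
      refine ⟨by omega, by omega, by omega, ?_, ?_, ?_⟩
      · rw [e, Finset.sum_range_succ]; ring
      · intro a ha
        rw [Function.update_of_ne (by omega), Function.update_of_ne (by omega), h5 a ha]
      · intro a ha
        simp (disch := omega) only [Function.update_of_ne, h6 a ha]
  · refine ⟨le_rfl, by omega, by omega, by simpa using hD, fun _ _ => rfl, fun _ _ => rfl⟩
  · rintro τ ⟨h1, h2, h3, h4, h5, h6⟩
    exact ⟨by simpa using h4, h5, h6⟩

attribute [local simp] FitsAll applyAll Instr.Fits Instr.apply Addr.Fits Addr.loc RamState.setR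
  RamState.setZ RamState.getR RamState.getZ RamTest.Fits RamTest.Holds

/-- Covering in terms of squared distances, which are computed without a square root. -/
theorem covers_iff_sq {d m : ℕ} (hm : m = 1 ∨ m = 2) {r : ℝ} (hr : 0 ≤ r) (ρ : Delegate d)
    (y : EuclideanSpace ℝ (Fin d)) :
    ρ.Covers m (r ^ m) y ↔ dist y ρ.loc ^ 2 * (ρ.cap : ℝ) ^ (2 / m) ≤ r ^ 2 := by
  rcases hm with rfl | rfl
  · rw [Delegate.Covers, pow_one, pow_one, Nat.div_one, ← mul_pow]
    exact (pow_le_pow_iff_left₀ (by positivity) hr two_ne_zero).symm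
  · rw [Delegate.Covers, Nat.div_self two_pos, pow_one]

/-- Compares the input with the representative whose weight and capacity are at the addresses
`Z 22` and `Z 23`, and whose squared distance to the input is known: remembers the
representative if it accepts the input, and takes its capacity into account if it only covers
the input. -/
def selectProg (m : ℕ) : RamProg :=
  .seq (block ([.rcast (.ind 31) (.ind 23)] ++
    (if m = 1 then [.rmul (.ind 31) (.ind 31) (.ind 31)] else []) ++
    [.rmul (.ind 31) (.ind 30) (.ind 31)]))
  (.ite (.rle (.ind 31) (.ind 33))
    (.ite (.zlt (.ind 22) (.ind 23)) (block [.zcopy (.dir 18) (.dir 22)])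
      (.ite (.rle (.ind 30) (.ind 36)) (block [.zcopy (.dir 18) (.dir 22)])
        (.seq (block [.zadd (.dir 20) (.ind 23) (.ind 23)])
          (.ite (.zlt (.dir 19) (.dir 20)) (block [.zcopy (.dir 19) (.dir 20)]) .skip))))
    .skip)

theorem selectProg_wp {m s d i : ℕ} {r : ℝ} {y : EuclideanSpace ℝ (Fin d)} {σ : RamState}
    (hm : m = 1 ∨ m = 2) (hr : 0 ≤ r) (hE : Env d σ) (hs : 40 ≤ s) (hs' : d + 9 ≤ s)
    (hi : 40 + 3 * i + 3 ≤ s) (h22 : σ.Z 22 = 40 + 3 * i + 1) (h23 : σ.Z 23 = 40 + 3 * i + 2)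
    (hD : σ.R (d + 1) = dist y (store d σ i).loc ^ 2) (hr2 : σ.R (d + 4) = r ^ 2) :
    Wp s (selectProg m) σ 9 fun τ =>
      ((store d σ i).Covers m (r ^ m) y ∧
          ((store d σ i).wt < (store d σ i).cap ∨ y = (store d σ i).loc) →
        τ.Z 18 = 40 + 3 * i + 1 ∧ τ.Z 19 = σ.Z 19) ∧
      ((store d σ i).Covers m (r ^ m) y ∧
          ¬((store d σ i).wt < (store d σ i).cap ∨ y = (store d σ i).loc) →
        τ.Z 18 = σ.Z 18 ∧ τ.Z 19 = max (σ.Z 19) (2 * (store d σ i).cap)) ∧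
      (¬ (store d σ i).Covers m (r ^ m) y → τ.Z 18 = σ.Z 18 ∧ τ.Z 19 = σ.Z 19) ∧
      (∀ a, a < 18 ∨ 20 < a → τ.Z a = σ.Z a) ∧
      (∀ a, a < d + 2 ∨ d + 2 < a → τ.R a = σ.R a) := by
  obtain ⟨z0, z8, z9, z28, z30, z31, z32, z33, z34, z35, z36, r7⟩ := hE
  have hw : (store d σ i).wt = σ.Z (40 + 3 * i + 1) := rfl
  have hc : (store d σ i).cap = σ.Z (40 + 3 * i + 2) := rfl
  have hloc : y = (store d σ i).loc ↔ dist y (store d σ i).loc ^ 2 ≤ 0 := by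
    rw [← dist_eq_zero]
    constructor
    · intro h; rw [h]; norm_num
    · intro h; exact pow_eq_zero_iff two_ne_zero |>.1 (le_antisymm h (sq_nonneg _))
  rw [covers_iff_sq hm hr, hloc, hw, hc, ← hD, ← hr2]
  clear hloc
  refine Wp.seq 3 6 le_rfl (Wp.block (by split_ifs <;> simp) ?_ ?_)
  · rcases hm with rfl | rfl <;>
      simp (disch := omega) [z30, z31, h23, Function.update_self] <;> omega
  · have hσ : applyAll ([.rcast (.ind 31) (.ind 23)] ++
        (if m = 1 then [.rmul (.ind 31) (.ind 31) (.ind 31)] else []) ++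
        [.rmul (.ind 31) (.ind 30) (.ind 31)]) σ =
        ⟨σ.Z, Function.update σ.R (d + 2)
          (σ.R (d + 1) * (σ.Z (40 + 3 * i + 2) : ℝ) ^ (2 / m))⟩ := by
      rcases hm with rfl | rfl <;>
        simp (disch := omega) [z30, z31, h23, Function.update_self, sq]
    rw [hσ]
    refine Wp.ite (T₁ := 5) (by simp [z31, z33]; omega) le_rfl ?_ ?_
    · simp (disch := omega) only [RamTest.Holds, RamState.getR, Addr.loc, z31, z33,
        Function.update_self, Function.update_of_ne]
      intro hcov
      simp only [hcov, true_and, not_true_eq_false, false_imp_iff]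
      refine Wp.ite (T₁ := 4) (by simp [h22, h23]; omega) le_rfl ?_ ?_
      · simp only [RamTest.Holds, RamState.getZ, Addr.loc, h22, h23]
        intro hlt
        refine Wp.block (by simp) (by simp; omega) ?_
        simp only [hlt, true_or, not_true_eq_false, false_imp_iff, true_imp_iff, true_and]
        simp (disch := omega) [h22, Function.update_self]
        exact ⟨fun a ha => by simp (disch := omega), fun a ha => by simp (disch := omega)⟩
      · simp only [RamTest.Holds, RamState.getZ, Addr.loc, h22, h23]
        intro hlt
        refine Wp.ite (T₁ := 3) (by simp [z30, z36]; omega) le_rfl ?_ ?_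
        · simp (disch := omega) only [RamTest.Holds, RamState.getR, Addr.loc, z30, z36,
            Function.update_of_ne, r7]
          intro hle
          refine Wp.block (by simp) (by simp; omega) ?_
          simp only [hle, or_true, not_true_eq_false, false_imp_iff, true_imp_iff, true_and]
          simp (disch := omega) [h22, Function.update_self]
          exact ⟨fun a ha => by simp (disch := omega), fun a ha => by simp (disch := omega)⟩
        · simp (disch := omega) only [RamTest.Holds, RamState.getR, Addr.loc, z30, z36,
            Function.update_of_ne, r7]
          intro hle
          simp only [hle, hlt, or_self, not_false_eq_true, false_imp_iff, true_imp_iff, true_and]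
          refine Wp.seq 1 2 le_rfl (Wp.block (by simp) (by simp [h23]; omega) ?_)
          refine Wp.ite (T₁ := 1) (by simp; omega) le_rfl ?_ ?_
          · intro hlt2
            simp (disch := omega) [h23, Function.update_self] at hlt2
            refine Wp.block (by simp) (by simp; omega) ?_
            simp (disch := omega) [h23, Function.update_self]
            refine ⟨by omega, fun a ha => by simp (disch := omega),
              fun a ha => by simp (disch := omega)⟩
          · intro hlt2
            simp (disch := omega) [h23, Function.update_self] at hlt2
            refine Wp.skip ?_
            simp (disch := omega) [h23]
            refine ⟨fun a ha => by simp (disch := omega), fun a ha => by simp (disch := omega)⟩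
    · simp (disch := omega) only [RamTest.Holds, RamState.getR, Addr.loc, z31, z33,
        Function.update_self, Function.update_of_ne]
      intro hcov
      refine Wp.skip ?_
      simp only [hcov, false_and, false_imp_iff, not_false_eq_true, true_imp_iff, true_and]
      exact ⟨fun _ _ => trivial, fun a ha => Function.update_of_ne (by omega) _ _⟩

/-- The outcome of comparing a point with the representatives `S b, …, S (i - 1)`: the address
`cand` of the weight of an accepting one (zero if there is none), the capacity `cap` for a new
one, and the update of the largest reciprocal of a squared distance from `u₀` to `u`. -/
structure Scanned {d : ℕ} (m : ℕ) (θ : ℝ) (b i : ℕ) (S : ℕ → Delegate d)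
    (y : EuclideanSpace ℝ (Fin d)) (c cand cap : ℕ) (u₀ u : ℝ) : Prop where
  cand_spec : (cand = 0 ∧ ∀ s, b ≤ s → s < i → ¬ (S s).Accepts m θ y c) ∨
    ∃ s, b ≤ s ∧ s < i ∧ (S s).Accepts m θ y c ∧ cand = 40 + 3 * s + 1
  cap_le : ∀ s, b ≤ s → s < i → (S s).col = c → (S s).Covers m θ y →
    ¬ (S s).Accepts m θ y c → 2 * (S s).cap ≤ cap
  cap_eq : cap = 1 ∨ ∃ s, b ≤ s ∧ s < i ∧ (S s).col = c ∧ (S s).Covers m θ y ∧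
    cap = 2 * (S s).cap
  u_ge : u₀ ≤ u
  inv_le : ∀ s, b ≤ s → s < i → (dist y (S s).loc ^ 2)⁻¹ ≤ u
  u_eq : u = u₀ ∨ ∃ s, b ≤ s ∧ s < i ∧ u = (dist y (S s).loc ^ 2)⁻¹

namespace Scanned

variable {d m b i : ℕ} {θ : ℝ} {S : ℕ → Delegate d} {y : EuclideanSpace ℝ (Fin d)}
  {c cand cap cand' cap' : ℕ} {u₀ u : ℝ}

theorem start (m : ℕ) (θ : ℝ) (b : ℕ) (S : ℕ → Delegate d) (y : EuclideanSpace ℝ (Fin d))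
    (c : ℕ) (u₀ : ℝ) : Scanned m θ b b S y c 0 1 u₀ u₀ :=
  ⟨Or.inl ⟨rfl, by intros; omega⟩, by intros; omega, Or.inl rfl, le_rfl, by intros; omega,
    Or.inl rfl⟩

theorem step (h : Scanned m θ b i S y c cand cap u₀ u) (hi : b ≤ i)
    (h1 : (S i).col = c → (S i).Covers m θ y ∧ ((S i).wt < (S i).cap ∨ y = (S i).loc) →
      cand' = 40 + 3 * i + 1 ∧ cap' = cap)
    (h2 : (S i).col = c → (S i).Covers m θ y ∧ ¬((S i).wt < (S i).cap ∨ y = (S i).loc) →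
      cand' = cand ∧ cap' = max cap (2 * (S i).cap))
    (h3 : ¬((S i).col = c ∧ (S i).Covers m θ y) → cand' = cand ∧ cap' = cap) :
    Scanned m θ b (i + 1) S y c cand' cap' u₀ (max u (dist y (S i).loc ^ 2)⁻¹) := by
  obtain ⟨g1, g2, g3, g4, g5, g6⟩ := h
  have hcand : cand' = cand ∧ ¬ (S i).Accepts m θ y c ∨
      cand' = 40 + 3 * i + 1 ∧ (S i).Accepts m θ y c := by
    by_cases e1 : (S i).col = c ∧ (S i).Covers m θ y
    · by_cases e2 : (S i).wt < (S i).cap ∨ y = (S i).loc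
      · exact Or.inr ⟨(h1 e1.1 ⟨e1.2, e2⟩).1, e1.1, e1.2, e2⟩
      · exact Or.inl ⟨(h2 e1.1 ⟨e1.2, e2⟩).1, fun h => e2 h.2.2⟩
    · exact Or.inl ⟨(h3 e1).1, fun h => e1 ⟨h.1, h.2.1⟩⟩
  have hcap : (cap' = cap ∧ ((S i).col = c → (S i).Covers m θ y → (S i).Accepts m θ y c)) ∨
      ((S i).col = c ∧ (S i).Covers m θ y ∧ cap' = max cap (2 * (S i).cap)) := by
    by_cases e1 : (S i).col = c ∧ (S i).Covers m θ y
    · by_cases e2 : (S i).wt < (S i).cap ∨ y = (S i).loc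
      · exact Or.inl ⟨(h1 e1.1 ⟨e1.2, e2⟩).2, fun _ _ => ⟨e1.1, e1.2, e2⟩⟩
      · exact Or.inr ⟨e1.1, e1.2, (h2 e1.1 ⟨e1.2, e2⟩).2⟩
    · exact Or.inl ⟨(h3 e1).2, fun e e' => absurd ⟨e, e'⟩ e1⟩
  have hge : cap ≤ cap' := by rcases hcap with ⟨h, -⟩ | ⟨-, -, h⟩ <;> omega
  refine ⟨?_, ?_, ?_, g4.trans (le_max_left _ _), ?_, ?_⟩
  · rcases hcand with ⟨rfl, h4⟩ | ⟨rfl, h4⟩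
    · rcases g1 with ⟨g0, g1⟩ | ⟨s, k1, k2, k3⟩
      · refine Or.inl ⟨g0, fun s k1 k2 => ?_⟩
        rcases Nat.lt_succ_iff_lt_or_eq.1 k2 with k2 | rfl
        · exact g1 s k1 k2
        · exact h4
      · exact Or.inr ⟨s, k1, by omega, k3⟩
    · exact Or.inr ⟨i, hi, by omega, h4, rfl⟩
  · intro s k1 k2 k3 k4 k5
    rcases Nat.lt_succ_iff_lt_or_eq.1 k2 with k2 | rfl
    · exact (g2 s k1 k2 k3 k4 k5).trans hge
    · rcases hcap with ⟨-, h⟩ | ⟨-, -, h⟩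
      · exact absurd (h k3 k4) k5
      · omega
  · have old : cap' = cap → (cap' = 1 ∨ ∃ s, b ≤ s ∧ s < i + 1 ∧ (S s).col = c ∧
        (S s).Covers m θ y ∧ cap' = 2 * (S s).cap) := by
      rintro rfl
      rcases g3 with g3 | ⟨s, k1, k2, k3⟩
      · exact Or.inl g3
      · exact Or.inr ⟨s, k1, by omega, k3⟩
    rcases hcap with ⟨h, -⟩ | ⟨e1, e2, h⟩
    · exact old h
    · rcases max_choice cap (2 * (S i).cap) with e | e
      · exact old (h.trans e)
      · exact Or.inr ⟨i, hi, by omega, e1, e2, h.trans e⟩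
  · intro s k1 k2
    rcases Nat.lt_succ_iff_lt_or_eq.1 k2 with k2 | rfl
    · exact (g5 s k1 k2).trans (le_max_left _ _)
    · exact le_max_right _ _
  · rcases max_choice u (dist y (S i).loc ^ 2)⁻¹ with e | e <;> rw [e]
    · rcases g6 with g6 | ⟨s, k1, k2, k3⟩
      · exact Or.inl g6
      · exact Or.inr ⟨s, k1, by omega, k3⟩
    · exact Or.inr ⟨i, hi, by omega, rfl⟩

end Scanned

/-- Compares the input with one representative. The reciprocal of the squared distance is taken
into account for all representatives, the other data only for those of the right colour. At
distance zero the reciprocal is zero, which does no harm. -/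
def scanBody (m : ℕ) : RamProg :=
  .seq (block [.rcopy (.ind 30) (.ind 36), .zcopy (.dir 20) (.dir 8), .zcopy (.dir 21) (.dir 17)])
  (.seq distProg
  (.seq (block [.rcast (.ind 31) (.dir 8), .rdiv (.ind 31) (.ind 31) (.ind 30)])
  (.seq (.ite (.rlt (.ind 32) (.ind 31)) (block [.rcopy (.ind 32) (.ind 31)]) .skip)
  (.seq (block [.zadd (.dir 22) (.dir 16) (.dir 8), .zadd (.dir 23) (.dir 22) (.dir 8)])
  (.seq (.ite (.zle (.ind 16) (.dir 3))
    (.ite (.zle (.dir 3) (.ind 16)) (selectProg m) .skip) .skip)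
  (block [.zadd (.dir 16) (.dir 16) (.dir 9), .zadd (.dir 17) (.dir 17) (.dir 0)]))))))

theorem dist_input_sq (d : ℕ) (σ : RamState) (i : ℕ) :
    dist (input d σ) (store d σ i).loc ^ 2 =
      ∑ j ∈ Finset.range d, (σ.R (1 + j) - σ.R (d + 9 + i * d + j)) ^ 2 := by
  rw [EuclideanSpace.dist_eq, Real.sq_sqrt (Finset.sum_nonneg fun _ _ => sq_nonneg _),
    ← Fin.sum_univ_eq_sum_range (fun j => (σ.R (1 + j) - σ.R (d + 9 + i * d + j)) ^ 2) d]
  refine Finset.sum_congr rfl fun j _ => ?_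
  simp [input, store, Real.dist_eq]

set_option maxHeartbeats 1000000 in
theorem scanBody_wp {m s d i b c : ℕ} {r u₀ : ℝ} {y : EuclideanSpace ℝ (Fin d)}
    {σ : RamState}
    (hm : m = 1 ∨ m = 2) (hr : 0 ≤ r) (hE : Env d σ) (hs : 40 ≤ s) (hs' : d + 9 ≤ s)
    (hi : 40 + 3 * i + 3 ≤ s) (hi' : d + 9 + i * d + d ≤ s) (hb : b ≤ i)
    (h16 : σ.Z 16 = 40 + 3 * i) (h17 : σ.Z 17 = d + 9 + i * d) (hr2 : σ.R (d + 4) = r ^ 2)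
    (hy : input d σ = y) (hc : σ.Z 3 = c)
    (hsc : Scanned m (r ^ m) b i (store d σ) y c (σ.Z 18) (σ.Z 19) u₀ (σ.R (d + 3))) :
    Wp s (scanBody m) σ (6 * d + 24) fun τ =>
      τ.Z 16 = 40 + 3 * (i + 1) ∧ τ.Z 17 = d + 9 + (i + 1) * d ∧
      Scanned m (r ^ m) b (i + 1) (store d σ) y c (τ.Z 18) (τ.Z 19) u₀ (τ.R (d + 3)) ∧
      (∀ a, a < 16 ∨ 23 < a → τ.Z a = σ.Z a) ∧
      (∀ a, a < d + 1 ∨ d + 3 < a → τ.R a = σ.R a) := by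
  have hE' := hE
  obtain ⟨z0, z8, z9, z28, z30, z31, z32, z33, z34, z35, z36, r7⟩ := hE'
  unfold scanBody
  refine Wp.seq 3 (6 * d + 21) (by omega) (Wp.block (by simp) ?_ ?_)
  · simp (disch := omega) [z30, z36]; omega
  set σ₁ := applyAll [.rcopy (.ind 30) (.ind 36), .zcopy (.dir 20) (.dir 8),
    .zcopy (.dir 21) (.dir 17)] σ with hσ₁
  have f1 : ∀ a, a < 20 ∨ 21 < a → σ₁.Z a = σ.Z a := fun a ha => by
    simp (disch := omega) [hσ₁]
  have f1' : ∀ a, a < d + 1 ∨ d + 1 < a → σ₁.R a = σ.R a := fun a ha => by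
    simp (disch := omega) [hσ₁, z30]
  have e20 : σ₁.Z 20 = 1 := by simp (disch := omega) [hσ₁, Function.update_self, z8]
  have e21 : σ₁.Z 21 = d + 9 + i * d := by simp (disch := omega) [hσ₁, Function.update_self, h17]
  have eD : σ₁.R (d + 1) = 0 := by
    simp (disch := omega) [hσ₁, Function.update_self, z30, z36, r7]
  have hE1 : Env d σ₁ := hE.of_frame (fun a ha _ _ => f1 a (by omega)) (f1' _ (by omega))
  refine Wp.seq (6 * d + 1) 20 (by omega) ((distProg_wp hE1 hs hs' e20 e21 (by omega) hi' eD).mono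
    le_rfl ?_)
  rintro σ₂ ⟨h2D, f2, f2'⟩
  have hD : σ₂.R (d + 1) = dist y (store d σ i).loc ^ 2 := by
    rw [h2D, ← hy, dist_input_sq]
    exact Finset.sum_congr rfl fun j hj => by
      rw [Finset.mem_range] at hj
      rw [f1' _ (by omega), f1' _ (by omega)]
  have g2 : ∀ a, a < 20 ∨ 21 < a → σ₂.Z a = σ.Z a := fun a ha => by rw [f2 a ha, f1 a ha]
  have g2' : ∀ a, a < d + 1 ∨ d + 2 < a → σ₂.R a = σ.R a := fun a ha => by
    rw [f2' a ha, f1' a (by omega)]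
  clear_value σ₁
  clear f1 f1' e20 e21 eD hE1 h2D f2 f2' hσ₁
  refine Wp.seq 2 18 (by omega) (Wp.block (by simp) ?_ ?_)
  · simp (disch := omega) [g2, z30, z31]; omega
  set σ₃ := applyAll [.rcast (.ind 31) (.dir 8), .rdiv (.ind 31) (.ind 31) (.ind 30)] σ₂ with hσ₃
  have f3 : ∀ a, σ₃.Z a = σ₂.Z a := fun a => by simp (disch := omega) [hσ₃]
  have f3' : ∀ a, a < d + 2 ∨ d + 2 < a → σ₃.R a = σ₂.R a := fun a ha => by
    simp (disch := omega) [hσ₃, g2, z31]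
  have e3 : σ₃.R (d + 2) = (dist y (store d σ i).loc ^ 2)⁻¹ := by
    simp (disch := omega) [hσ₃, g2, z30, z31, z8, Function.update_self, hD]
  clear_value σ₃
  -- the largest reciprocal of a squared distance
  have step : Wp s (.ite (.rlt (.ind 32) (.ind 31)) (block [.rcopy (.ind 32) (.ind 31)]) .skip) σ₃ 2
      fun τ => (∀ a, τ.Z a = σ₃.Z a) ∧ (∀ a, a < d + 3 ∨ d + 3 < a → τ.R a = σ₃.R a) ∧
        τ.R (d + 3) = max (σ.R (d + 3)) (dist y (store d σ i).loc ^ 2)⁻¹ := by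
    refine Wp.ite (T₁ := 1) ?_ le_rfl ?_ ?_
    · simp (disch := omega) [f3, g2, z31, z32]; omega
    · intro hlt
      simp (disch := omega) only [RamTest.Holds, RamState.getR, Addr.loc, f3, g2, z31, z32, f3',
        g2', e3] at hlt
      refine Wp.block (by simp) (by simp (disch := omega) [f3, g2, z31, z32]; omega) ?_
      refine ⟨fun a => by simp, fun a ha => by simp (disch := omega) [f3, g2, z32], ?_⟩
      simp (disch := omega) [f3, g2, z31, z32, Function.update_self, e3, hlt.le]
    · intro hlt
      simp (disch := omega) only [RamTest.Holds, RamState.getR, Addr.loc, f3, g2, z31, z32, f3',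
        g2', e3] at hlt
      refine Wp.skip ⟨fun _ => rfl, fun _ _ => rfl, ?_⟩
      rw [f3' _ (by omega), g2' _ (by omega), max_eq_left (not_lt.1 hlt)]
  refine Wp.seq 2 16 (by omega) (step.mono le_rfl ?_)
  rintro σ₄ ⟨f4, f4', e4⟩
  have g4 : ∀ a, a < 20 ∨ 21 < a → σ₄.Z a = σ.Z a := fun a ha => by rw [f4, f3, g2 a ha]
  have g4' : ∀ a, a < d + 1 ∨ d + 3 < a → σ₄.R a = σ.R a := fun a ha => by
    rw [f4' a (by omega), f3' a (by omega), g2' a (by omega)]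
  have hD4 : σ₄.R (d + 1) = dist y (store d σ i).loc ^ 2 := by
    rw [f4' _ (by omega), f3' _ (by omega), hD]
  clear f4 f4' f3 f3' e3 g2 g2' hD
  refine Wp.seq 2 14 (by omega) (Wp.block (by simp) ?_ ?_)
  · simp; omega
  set σ₅ := applyAll [.zadd (.dir 22) (.dir 16) (.dir 8), .zadd (.dir 23) (.dir 22) (.dir 8)] σ₄
    with hσ₅
  have f5 : ∀ a, a < 20 ∨ 23 < a → σ₅.Z a = σ.Z a := fun a ha => by
    simp (disch := omega) [hσ₅, g4]
  have f5' : ∀ a, σ₅.R a = σ₄.R a := fun a => by simp [hσ₅]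
  have e22 : σ₅.Z 22 = 40 + 3 * i + 1 := by
    simp (disch := omega) [hσ₅, g4, Function.update_self, h16, z8]
  have e23 : σ₅.Z 23 = 40 + 3 * i + 2 := by
    simp (disch := omega) [hσ₅, g4, Function.update_self, h16, z8]
  have g5' : ∀ a, a < d + 1 ∨ d + 3 < a → σ₅.R a = σ.R a := fun a ha => by
    rw [f5', g4' a ha]
  have hS5 : store d σ₅ = store d σ :=
    store_congr (fun a ha => f5 a (by omega)) fun a ha => g5' a (by omega)
  have hE5 : Env d σ₅ := hE.of_frame (fun a ha _ _ => f5 a (by omega)) (g5' _ (by omega))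
  have hD5 : σ₅.R (d + 1) = dist y (store d σ i).loc ^ 2 := by rw [f5', hD4]
  have hu5 : σ₅.R (d + 3) = max (σ.R (d + 3)) (dist y (store d σ i).loc ^ 2)⁻¹ := by
    rw [f5', e4]
  clear_value σ₅
  clear hσ₅ g4 g4' hD4 e4 f5'
  have hcoli : (store d σ i).col = σ.Z (40 + 3 * i) := rfl
  have step2 : Wp s (.ite (.zle (.ind 16) (.dir 3))
      (.ite (.zle (.dir 3) (.ind 16)) (selectProg m) .skip) .skip) σ₅ 12 fun τ =>
      Scanned m (r ^ m) b (i + 1) (store d σ) y c (τ.Z 18) (τ.Z 19) u₀ (τ.R (d + 3)) ∧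
      (∀ a, a < 18 ∨ 23 < a → τ.Z a = σ.Z a) ∧
      (∀ a, a < d + 1 ∨ d + 3 < a → τ.R a = σ.R a) := by
    have hskip : (store d σ i).col ≠ c → Wp s .skip σ₅ 10 (fun τ =>
        Scanned m (r ^ m) b (i + 1) (store d σ) y c (τ.Z 18) (τ.Z 19) u₀ (τ.R (d + 3)) ∧
        (∀ a, a < 18 ∨ 23 < a → τ.Z a = σ.Z a) ∧
        (∀ a, a < d + 1 ∨ d + 3 < a → τ.R a = σ.R a)) := by
      intro hne
      refine Wp.skip ⟨?_, fun a ha => f5 a (by omega), g5'⟩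
      rw [hu5, f5 _ (by omega), f5 _ (by omega)]
      exact hsc.step hb (fun e => absurd e hne) (fun e => absurd e hne) fun _ => ⟨rfl, rfl⟩
    refine Wp.ite (T₁ := 11) ?_ le_rfl ?_ ?_
    · simp (disch := omega) [f5, h16]; omega
    · intro hle1
      simp (disch := omega) only [RamTest.Holds, RamState.getZ, Addr.loc, f5, h16, hc] at hle1
      refine Wp.ite (T₁ := 10) ?_ le_rfl ?_ ?_
      · simp (disch := omega) [f5, h16]; omega
      · intro hle2
        simp (disch := omega) only [RamTest.Holds, RamState.getZ, Addr.loc, f5, h16, hc] at hle2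
        have hcc : (store d σ i).col = c := by rw [hcoli]; omega
        refine (selectProg_wp (i := i) (y := y) hm hr hE5 hs hs' hi e22 e23 (by rw [hD5, hS5])
          (by rw [g5' _ (by omega), hr2])).mono (by omega) ?_
        rintro τ ⟨k1, k2, k3, k4, k5⟩
        rw [hS5, f5 18 (by omega), f5 19 (by omega)] at k2
        rw [hS5, f5 19 (by omega)] at k1
        rw [hS5, f5 18 (by omega), f5 19 (by omega)] at k3
        refine ⟨?_, fun a ha => by rw [k4 a (by omega), f5 a (by omega)],
          fun a ha => by rw [k5 a (by omega), g5' a ha]⟩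
        rw [k5 _ (by omega), hu5]
        exact hsc.step hb (fun _ => k1) (fun _ => k2) fun h => k3 fun h' => h ⟨hcc, h'⟩
      · intro hle2
        simp (disch := omega) only [RamTest.Holds, RamState.getZ, Addr.loc, f5, h16, hc] at hle2
        exact hskip (by rw [hcoli]; omega)
    · intro hle1
      simp (disch := omega) only [RamTest.Holds, RamState.getZ, Addr.loc, f5, h16, hc] at hle1
      exact (hskip (by rw [hcoli]; omega)).mono (by omega) fun _ h => h
  refine Wp.seq 12 2 (by omega) (step2.mono le_rfl ?_)
  rintro σ₆ ⟨k1, k2, k3⟩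
  refine Wp.block (by simp) (by simp; omega) ?_
  refine ⟨?_, ?_, ?_, ?_, ?_⟩
  · simp (disch := omega) [k2, Function.update_self, h16, z9]; ring
  · simp (disch := omega) [k2, Function.update_self, h17, z0]; ring
  · simpa (disch := omega) using k1
  · intro a ha; simp (disch := omega) [k2]
  · intro a ha; simpa using k3 a ha

theorem store_update {d N : ℕ} {σ τ : RamState} {ρ : Delegate d}
    (hZ : ∀ a, 40 ≤ a → (a < 40 + 3 * N ∨ 40 + 3 * N + 3 ≤ a) → τ.Z a = σ.Z a)
    (hR : ∀ a, d + 9 ≤ a → (a < d + 9 + N * d ∨ d + 9 + N * d + d ≤ a) → τ.R a = σ.R a)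
    (hloc : ∀ j : Fin d, τ.R (d + 9 + N * d + j) = ρ.loc j) (hcol : τ.Z (40 + 3 * N) = ρ.col)
    (hwt : τ.Z (40 + 3 * N + 1) = ρ.wt) (hcap : τ.Z (40 + 3 * N + 2) = ρ.cap) :
    store d τ = Function.update (store d σ) N ρ := by
  funext i
  by_cases e : i = N
  · subst e
    rw [Function.update_self]
    ext1
    · ext j; exact hloc j
    · exact hcol
    · exact hwt
    · exact hcap
  · rw [Function.update_of_ne e]
    simp only [store]
    congr 1
    · congr 1; funext j
      have := coord_lt_or_le j e
      exact hR _ (by omega) (by omega)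
    all_goals exact hZ _ (by omega) (by omega)

/-- Copies `d` real cells from the address in `Z v` to the address in `Z u`, where `Z 20` runs
through `1, …, d` and is one of the two registers. -/
def copyProg (u v : ℕ) : RamProg :=
  .loop (.zle (.dir 20) (.dir 0)) (block [
    .rcopy (.ind u) (.ind v),
    .zadd (.dir 20) (.dir 20) (.dir 8),
    .zadd (.dir 21) (.dir 21) (.dir 8)])

theorem copyProg_wp {s d A u v P Q : ℕ} {σ : RamState} (hE : Env d σ) (hs : 40 ≤ s)
    (h20 : σ.Z 20 = 1) (h21 : σ.Z 21 = A) (hA : d + 9 ≤ A) (hA' : A + d ≤ s)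
    (huv : (u = 21 ∧ v = 20 ∧ P = A ∧ Q = 1) ∨ (u = 20 ∧ v = 21 ∧ P = 1 ∧ Q = A)) :
    Wp s (copyProg u v) σ (4 * d + 1) fun τ =>
      (∀ j, j < d → τ.R (P + j) = σ.R (Q + j)) ∧
      (∀ a, a < 20 ∨ 21 < a → τ.Z a = σ.Z a) ∧
      (∀ a, a < P ∨ P + d ≤ a → τ.R a = σ.R a) := by
  refine (Wp.loop_count (T₁ := 3) (n := d) (fun k τ => k ≤ d ∧
    τ.Z 20 = 1 + (d - k) ∧ τ.Z 21 = A + (d - k) ∧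
    (∀ j, j < d - k → τ.R (P + j) = σ.R (Q + j)) ∧
    (∀ a, a < 20 ∨ 21 < a → τ.Z a = σ.Z a) ∧
    (∀ a, a < P ∨ P + (d - k) ≤ a → τ.R a = σ.R a)) ?_ ?_ ?_ ?_ (by omega)).mono le_rfl ?_
  · rintro n τ ⟨-, h⟩
    simp only [RamTest.Fits, Addr.Fits]; omega
  · rintro n τ ⟨h1, h2, h3, h4, h5, h6⟩
    have := hE.z0
    simp only [RamTest.Holds, RamState.getZ, Addr.loc, h2, h5 0 (by omega), this]; omega
  · rintro n τ ⟨h1, h2, h3, h4, h5, h6⟩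
    have z8 := hE.z8
    rw [← h5 _ (by omega)] at z8
    have hz : τ.Z u = P + (d - (n + 1)) ∧ τ.Z v = Q + (d - (n + 1)) := by
      rcases huv with ⟨rfl, rfl, rfl, rfl⟩ | ⟨rfl, rfl, rfl, rfl⟩ <;> exact ⟨by omega, by omega⟩
    have hr := h6 (Q + (d - (n + 1))) (by omega)
    refine Wp.block le_rfl ?_ ?_
    · simp only [FitsAll, Instr.Fits, Addr.Fits, hz]; simp; omega
    · simp (disch := omega) only [applyAll, Instr.apply, RamState.setR,
        RamState.setZ, RamState.getR, RamState.getZ, Addr.loc, h2, h3, z8, hz,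
        Function.update_self, Function.update_of_ne, hr]
      refine ⟨by omega, by omega, by omega, ?_, ?_, ?_⟩
      · intro j hj
        by_cases e : j = d - (n + 1)
        · subst e; rw [Function.update_self]
        · rw [Function.update_of_ne (by omega), h4 j (by omega)]
      · intro a ha
        rw [Function.update_of_ne (by omega), Function.update_of_ne (by omega), h5 a ha]
      · intro a ha
        rw [Function.update_of_ne (by omega), h6 a (by omega)]
  · exact ⟨le_rfl, by omega, by omega, fun j hj => by omega, fun _ _ => rfl, fun _ _ => rfl⟩
  · rintro τ ⟨h1, h2, h3, h4, h5, h6⟩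
    exact ⟨fun j hj => h4 j (by omega), h5, fun a ha => h6 a (by omega)⟩

/-- Appends the input to the representatives, with weight one and the capacity in `Z 19`. -/
def appendProg : RamProg :=
  .seq (block [.zcopy (.ind 14) (.dir 3), .zadd (.dir 22) (.dir 14) (.dir 8),
    .zcopy (.ind 22) (.dir 8), .zadd (.dir 23) (.dir 22) (.dir 8), .zcopy (.ind 23) (.dir 19),
    .zcopy (.dir 20) (.dir 8), .zcopy (.dir 21) (.dir 15)])
  (.seq (copyProg 21 20)
  (block [.zadd (.dir 14) (.dir 14) (.dir 9), .zadd (.dir 15) (.dir 15) (.dir 0),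
    .zadd (.dir 13) (.dir 13) (.dir 8)]))

set_option maxHeartbeats 400000 in
theorem appendProg_wp {s d N c : ℕ} {y : EuclideanSpace ℝ (Fin d)} {σ : RamState}
    (hE : Env d σ) (hs : 40 ≤ s) (hN : 40 + 3 * N + 3 ≤ s)
    (hN' : d + 9 + N * d + d ≤ s) (h14 : σ.Z 14 = 40 + 3 * N) (h15 : σ.Z 15 = d + 9 + N * d)
    (hy : input d σ = y) (hc : σ.Z 3 = c) :
    Wp s appendProg σ (4 * d + 11) fun τ =>
      store d τ = Function.update (store d σ) N ⟨y, c, 1, σ.Z 19⟩ ∧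
      τ.Z 14 = 40 + 3 * (N + 1) ∧ τ.Z 15 = d + 9 + (N + 1) * d ∧ τ.Z 13 = σ.Z 13 + 1 ∧
      (∀ a, a < 40 → (a < 13 ∨ 23 < a) → τ.Z a = σ.Z a) ∧
      (∀ a, a < d + 9 → τ.R a = σ.R a) := by
  have hE' := hE
  obtain ⟨z0, z8, z9, z28, z30, z31, z32, z33, z34, z35, z36, r7⟩ := hE'
  refine Wp.seq 7 (4 * d + 4) (by omega) (Wp.block (by simp) ?_ ?_)
  · simp (disch := omega) [Function.update_self, h14, z8]; omega
  set σ₁ := applyAll [.zcopy (.ind 14) (.dir 3), .zadd (.dir 22) (.dir 14) (.dir 8),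
    .zcopy (.ind 22) (.dir 8), .zadd (.dir 23) (.dir 22) (.dir 8), .zcopy (.ind 23) (.dir 19),
    .zcopy (.dir 20) (.dir 8), .zcopy (.dir 21) (.dir 15)] σ with hσ₁
  have f1 : ∀ a, (a < 20 ∨ 23 < a) → (a < 40 + 3 * N ∨ 40 + 3 * N + 3 ≤ a) →
      σ₁.Z a = σ.Z a := fun a ha ha' => by
    simp (disch := omega) [hσ₁, Function.update_self, h14, z8]
  have f1' : ∀ a, σ₁.R a = σ.R a := fun a => by simp [hσ₁]
  have e20 : σ₁.Z 20 = 1 := by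
    simp (disch := omega) [hσ₁, Function.update_self, z8, h14]
  have e21 : σ₁.Z 21 = d + 9 + N * d := by
    simp (disch := omega) [hσ₁, Function.update_self, z8, h14, h15]
  have e0 : σ₁.Z (40 + 3 * N) = c := by
    simp (disch := omega) [hσ₁, Function.update_self, z8, h14, hc]
  have e1 : σ₁.Z (40 + 3 * N + 1) = 1 := by
    simp (disch := omega) [hσ₁, Function.update_self, z8, h14]
  have e2 : σ₁.Z (40 + 3 * N + 2) = σ.Z 19 := by
    simp (disch := omega) [hσ₁, Function.update_self, z8, h14]
  have hE1 : Env d σ₁ := hE.of_frame (fun a ha _ _ => f1 a (by omega) (by omega)) (f1' _)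
  clear_value σ₁
  refine Wp.seq (4 * d + 1) 3 (by omega) ((copyProg_wp hE1 hs e20 e21 (by omega) hN'
    (Or.inl ⟨rfl, rfl, rfl, rfl⟩)).mono le_rfl ?_)
  rintro σ₂ ⟨k1, k2, k3⟩
  refine Wp.block (by simp) (by simp; omega) ?_
  refine ⟨store_update ?_ ?_ ?_ ?_ ?_ ?_, ?_, ?_, ?_, ?_, ?_⟩
  · intro a h1 h2; simp (disch := omega) [k2, f1]
  · intro a h1 h2; simp (disch := omega) [k3, f1']
  · intro j; rw [← hy]; simpa [input, f1'] using k1 j j.2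
  · simp (disch := omega) [k2, e0]
  · simp (disch := omega) [k2, e1]
  · simp (disch := omega) [k2, e2]
  · simp (disch := omega) [k2, f1, Function.update_self, h14, z9]; ring
  · simp (disch := omega) [k2, f1, Function.update_self, h15, z0]; ring
  · simp (disch := omega) [k2, f1, Function.update_self, z8]
  · intro a h1 h2; simp (disch := omega) [k2, f1]
  · intro a h1; simp (disch := omega) [k3, f1']

/-- Inserts the input into the current block. The address zero in `Z 18` stands for no accepting
representative. -/
def insertProg (m : ℕ) : RamProg :=
  .seq (block [.zcopy (.dir 16) (.dir 10), .zcopy (.dir 17) (.dir 11),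
    .zcopy (.dir 18) (.dir 28), .zcopy (.dir 19) (.dir 8)])
  (.seq (.loop (.zlt (.dir 16) (.dir 14)) (scanBody m))
  (.ite (.zlt (.dir 28) (.dir 18)) (block [.zadd (.ind 18) (.ind 18) (.dir 8)]) appendProg))

/-- The current block consists of the representatives `b, …, N - 1`. -/
structure Bounds (d b N : ℕ) (σ : RamState) : Prop where
  le : b ≤ N
  z10 : σ.Z 10 = 40 + 3 * b
  z11 : σ.Z 11 = d + 9 + b * d
  z13 : σ.Z 13 = N - b
  z14 : σ.Z 14 = 40 + 3 * N
  z15 : σ.Z 15 = d + 9 + N * d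

/-- `N` representatives and one more fit into the memory. -/
structure Room (s d N : ℕ) : Prop where
  z : 40 + 3 * N + 3 ≤ s
  r : d + 9 + N * d + d ≤ s

theorem Room.mono {s d N M : ℕ} (h : Room s d N) (hM : M ≤ N) : Room s d M :=
  ⟨by have := h.z; omega, by have := h.r; have := Nat.mul_le_mul_right d hM; omega⟩

theorem insertProg_wp {m s d b N c : ℕ} {r : ℝ} {y : EuclideanSpace ℝ (Fin d)} {σ : RamState}
    (hm : m = 1 ∨ m = 2) (hr : 0 ≤ r) (hE : Env d σ) (hroom : Room s d N) (hB : Bounds d b N σ)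
    (hr2 : σ.R (d + 4) = r ^ 2) (hy : input d σ = y) (hc : σ.Z 3 = c) :
    Wp s (insertProg m) σ ((N - b + 1) * (6 * d + 25)) fun τ =>
      ∃ s₀ N', Inserts m (r ^ m) b N (store d σ) y c s₀ N' (store d τ) ∧ Bounds d b N' τ ∧
      σ.R (d + 3) ≤ τ.R (d + 3) ∧
      (∀ i, b ≤ i → i < N → (dist y (store d σ i).loc ^ 2)⁻¹ ≤ τ.R (d + 3)) ∧
      (τ.R (d + 3) = σ.R (d + 3) ∨
        ∃ i, b ≤ i ∧ i < N ∧ τ.R (d + 3) = (dist y (store d σ i).loc ^ 2)⁻¹) ∧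
      (∀ a, a < 40 → (a < 13 ∨ 23 < a) → τ.Z a = σ.Z a) ∧
      (∀ a, a < d + 9 → (a < d + 1 ∨ d + 3 < a) → τ.R a = σ.R a) := by
  obtain ⟨hbN, h10, h11, h13, h14, h15⟩ := hB
  have hN := hroom.z
  have hN' := hroom.r
  have hs : 40 ≤ s := by omega
  have hs' : d + 9 ≤ s := by omega
  have hE' := hE
  obtain ⟨z0, z8, z9, z28, z30, z31, z32, z33, z34, z35, z36, r7⟩ := hE'
  have hT : 4 + ((N - b) * (6 * d + 25) + 1 + (4 * d + 12)) ≤ (N - b + 1) * (6 * d + 25) := by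
    rw [Nat.add_mul, one_mul]; omega
  refine Wp.seq 4 ((N - b) * (6 * d + 25) + 1 + (4 * d + 12)) hT (Wp.block (by simp) ?_ ?_)
  · simp; omega
  set σ₁ := applyAll [.zcopy (.dir 16) (.dir 10), .zcopy (.dir 17) (.dir 11),
    .zcopy (.dir 18) (.dir 28), .zcopy (.dir 19) (.dir 8)] σ with hσ₁
  have f1 : ∀ a, a < 16 ∨ 19 < a → σ₁.Z a = σ.Z a := fun a ha => by
    simp (disch := omega) [hσ₁]
  have f1' : ∀ a, σ₁.R a = σ.R a := fun a => by simp [hσ₁]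
  have e16 : σ₁.Z 16 = 40 + 3 * b := by simp (disch := omega) [hσ₁, Function.update_self, h10]
  have e17 : σ₁.Z 17 = d + 9 + b * d := by
    simp (disch := omega) [hσ₁, Function.update_self, h11]
  have e18 : σ₁.Z 18 = 0 := by simp (disch := omega) [hσ₁, Function.update_self, z28]
  have e19 : σ₁.Z 19 = 1 := by simp (disch := omega) [hσ₁, Function.update_self, z8]
  clear_value σ₁
  refine Wp.seq _ _ le_rfl ((Wp.loop_count (T₁ := 6 * d + 24) (n := N - b) (fun k τ => k ≤ N - b ∧
    τ.Z 16 = 40 + 3 * (N - k) ∧ τ.Z 17 = d + 9 + (N - k) * d ∧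
    Scanned m (r ^ m) b (N - k) (store d σ) y c (τ.Z 18) (τ.Z 19) (σ.R (d + 3)) (τ.R (d + 3)) ∧
    (∀ a, a < 16 ∨ 23 < a → τ.Z a = σ.Z a) ∧
    (∀ a, a < d + 1 ∨ d + 3 < a → τ.R a = σ.R a)) ?_ ?_ ?_ ?_ le_rfl).mono le_rfl ?_)
  · rintro n τ ⟨-, h⟩
    simp only [RamTest.Fits, Addr.Fits]; omega
  · rintro n τ ⟨k0, k1, k2, k3, k4, k5⟩
    simp (disch := omega) only [RamTest.Holds, RamState.getZ, Addr.loc, k1, k4, h14]; omega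
  · rintro n τ ⟨k0, k1, k2, k3, k4, k5⟩
    have e : N - n = N - (n + 1) + 1 := by omega
    have hlt : N - (n + 1) ≤ N := by omega
    have hroom' := hroom.mono hlt
    have hS : store d τ = store d σ :=
      store_congr (fun a ha => k4 a (by omega)) fun a ha => k5 a (by omega)
    have hin : input d τ = y := by
      rw [← hy]; exact input_congr fun a h1 h2 => k5 a (by omega)
    refine (scanBody_wp (i := N - (n + 1)) (b := b) (c := c) (r := r) (u₀ := σ.R (d + 3)) hm hr
      (hE.of_frame (fun a ha _ _ => k4 a (by omega)) (k5 _ (by omega))) hs hs' hroom'.z hroom'.r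
      (by omega) k1 k2 (by rw [k5 _ (by omega), hr2]) hin (by rw [k4 _ (by omega), hc])
      (by rw [hS]; exact k3)).mono le_rfl ?_
    rintro τ' ⟨j1, j2, j3, j4, j5⟩
    rw [hS] at j3
    rw [e]
    exact ⟨by omega, j1, j2, j3, fun a ha => by rw [j4 a ha, k4 a ha],
      fun a ha => by rw [j5 a ha, k5 a ha]⟩
  · have e : N - (N - b) = b := by omega
    rw [e, e18, e19, f1']
    exact ⟨le_rfl, e16, e17, Scanned.start _ _ _ _ _ _ _, fun a ha => f1 a (by omega),
      fun a _ => f1' a⟩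
  rintro σ₂ ⟨-, -, -, k3, k4, k5⟩
  rw [Nat.sub_zero] at k3
  have hS : store d σ₂ = store d σ :=
    store_congr (fun a ha => k4 a (by omega)) fun a ha => k5 a (by omega)
  have hin : input d σ₂ = y := by
    rw [← hy]; exact input_congr fun a h1 h2 => k5 a (by omega)
  obtain ⟨g1, g2, g3, g4, g5, g6⟩ := k3
  refine Wp.ite (T₁ := 4 * d + 11) (by simp; omega) le_rfl ?_ ?_
  · intro hlt
    simp (disch := omega) only [RamTest.Holds, RamState.getZ, Addr.loc, k4, z28] at hlt
    rcases g1 with ⟨g1, -⟩ | ⟨i, i1, i2, i3, i4⟩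
    · omega
    have hri := hroom.mono (M := i) (by omega)
    have := hri.z
    refine Wp.block (by simp) (by simp [i4]; omega) ?_
    set σ₃ := applyAll [.zadd (.ind 18) (.ind 18) (.dir 8)] σ₂ with hσ₃
    have hZ : ∀ a, a ≠ 40 + 3 * i + 1 → σ₃.Z a = σ₂.Z a := fun a ha => by
      simp (disch := omega) [hσ₃, i4]
    have hR : σ₃.R = σ₂.R := by simp [hσ₃]
    refine ⟨i, N, ?_, ⟨hbN, ?_, ?_, ?_, ?_, ?_⟩, by rwa [hR], by rwa [hR], by rwa [hR], ?_, ?_⟩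
    · have := Inserts.join (N := N) i i1 i2 i3
      convert! this using 1
      rw [← hS]
      refine store_update (fun a _ ha => hZ a (by omega)) (fun a _ _ => by rw [hR]) ?_ ?_ ?_ ?_
      · intro j; rw [hR]; rfl
      · exact hZ _ (by omega)
      · simp (disch := omega) [hσ₃, i4, Function.update_self, k4, z8]; rw [hS]; rfl
      · exact hZ _ (by omega)
    · rw [hZ _ (by omega), k4 _ (by omega), h10]
    · rw [hZ _ (by omega), k4 _ (by omega), h11]
    · rw [hZ _ (by omega), k4 _ (by omega), h13]
    · rw [hZ _ (by omega), k4 _ (by omega), h14]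
    · rw [hZ _ (by omega), k4 _ (by omega), h15]
    · intro a h1 h2; rw [hZ _ (by omega), k4 a (by omega)]
    · intro a h1 h2; rw [hR, k5 a h2]
  · intro hlt
    simp (disch := omega) only [RamTest.Holds, RamState.getZ, Addr.loc, k4, z28] at hlt
    have g1' : ∀ i, b ≤ i → i < N → ¬ (store d σ i).Accepts m (r ^ m) y c := by
      rcases g1 with ⟨-, g1⟩ | ⟨i, i1, i2, i3, i4⟩
      · exact g1
      · omega
    refine (appendProg_wp (N := N) (hE.of_frame (fun a ha _ _ => k4 a (by omega)) (k5 _ (by omega)))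
      hs hN hN' (by rw [k4 _ (by omega), h14]) (by rw [k4 _ (by omega), h15]) hin
      (by rw [k4 _ (by omega), hc])).mono le_rfl ?_
    rintro τ ⟨j1, j2, j3, j4, j5, j6⟩
    have e3 := j6 (d + 3) (by omega)
    refine ⟨N, N + 1, ?_, ⟨by omega, ?_, ?_, ?_, j2, j3⟩, by rwa [e3], by rwa [e3], by rwa [e3],
      ?_, ?_⟩
    · rw [j1, hS]
      exact .new _ g1' (fun i i1 i2 i3 i4 => g2 i i1 i2 i3 i4 (g1' i i1 i2)) g3
    · rw [j5 _ (by omega) (by omega), k4 _ (by omega), h10]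
    · rw [j5 _ (by omega) (by omega), k4 _ (by omega), h11]
    · rw [j4, k4 _ (by omega), h13, Nat.sub_add_comm hbN]
    · intro a h1 h2; rw [j5 a h1 h2, k4 a (by omega)]
    · intro a h1 h2; rw [j6 a h1, k5 a h2]

/-! ### Rebuilding a block -/

theorem Inserts.eq_of_ne {d m b N c s N' : ℕ} {θ : ℝ} {S S' : ℕ → Delegate d}
    {y : EuclideanSpace ℝ (Fin d)} (h : Inserts m θ b N S y c s N' S') {i : ℕ}
    (hi : i < b ∨ N < i) (hb : b ≤ N) : S' i = S i := by
  cases h with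
  | join s hb hN h => exact Function.update_of_ne (by omega) _ _
  | new cp h hcp hcp' => exact Function.update_of_ne (by omega) _ _

/-- The state of a rebuild. The representatives `S₀ b, …, S₀ (o - 1)` have been inserted again,
with all points on them, and some of the points on `S₀ o` as well; they form the set `J` and
are now on `S b, …, S (N - 1)`. Since `S₀ o` opens at most one new representative, the
representatives that still have to be inserted are not overwritten. -/
structure Rebuilding {d : ℕ} {ι : Type*} [DecidableEq ι] (m : ℕ) (θ : ℝ) (b N₀ : ℕ)
    (S₀ : ℕ → Delegate d) (q : ι → EuclideanSpace ℝ (Fin d)) (col : ι → ℕ)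
    (o N : ℕ) (S : ℕ → Delegate d) (J : Finset ι) (tgt : ι → ℕ) : Prop where
  summary : Summary m θ b N S J q col tgt
  frozen : ∀ i, i < b → S i = S₀ i
  rest : ∀ i, o < i → S i = S₀ i
  source : ∀ s, b ≤ s → s < N → ∃ s', b ≤ s' ∧ s' < N₀ ∧ (S s).loc = (S₀ s').loc ∧
    (S s).col = (S₀ s').col
  room : (N ≤ o ∧ S o = S₀ o) ∨
    (N ≤ o + 1 ∧ ∃ s, b ≤ s ∧ s < N ∧ (S s).loc = (S₀ o).loc ∧ (S s).col = (S₀ o).col)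

theorem Rebuilding.inserts {d : ℕ} {ι : Type*} [DecidableEq ι] {m : ℕ} {θ : ℝ} {b N₀ : ℕ}
    {S₀ : ℕ → Delegate d} {q : ι → EuclideanSpace ℝ (Fin d)} {col : ι → ℕ}
    {o N : ℕ} {S : ℕ → Delegate d} {J : Finset ι} {tgt : ι → ℕ}
    (h : Rebuilding m θ b N₀ S₀ q col o N S J tgt) (hθ : 0 ≤ θ) (hm : m ≠ 0) (hob : b ≤ o)
    (hoN : o < N₀) {i₀ : ι} (hi₀ : i₀ ∉ J) (hq : q i₀ = (S₀ o).loc) (hc : col i₀ = (S₀ o).col)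
    {s₀ N' : ℕ} {S' : ℕ → Delegate d}
    (hins : Inserts m θ b N S (S₀ o).loc (S₀ o).col s₀ N' S') :
    Rebuilding m θ b N₀ S₀ q col o N' S' (insert i₀ J) (Function.update tgt i₀ s₀) := by
  have hNo : N ≤ o + 1 := by rcases h.room with h | h <;> omega
  have hb := h.summary.le
  refine ⟨h.summary.inserts hθ hm hi₀ (by rw [hq, hc]; exact hins), ?_, ?_, ?_, ?_⟩
  · intro i hi
    rw [hins.eq_of_ne (Or.inl hi) hb, h.frozen i hi]
  · intro i hi
    rw [← h.rest i hi]
    by_cases hN : N < i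
    · exact hins.eq_of_ne (Or.inr hN) hb
    · -- here `N = o + 1`, hence the point is accepted by the copy that exists already
      have hN' : N = o + 1 := by omega
      cases hins with
      | join s hb hN h => exact Function.update_of_ne (by omega) _ _
      | new cp hrej hcp hcp' =>
        rcases h.room with h1 | ⟨-, s, h1, h2, h3, h4⟩
        · omega
        · refine absurd ⟨h4, ?_, Or.inr h3.symm⟩ (hrej s h1 h2)
          rw [Delegate.Covers, h3, dist_self, zero_pow hm, zero_mul]; exact hθ
  · cases hins with
    | join _ hb hN hacc =>
      intro s hs hs'
      by_cases e : s = s₀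
      · subst e; simpa using h.source s hs hs'
      · simpa [e] using h.source s hs hs'
    | new cp hrej hcp hcp' =>
      intro s hs hs'
      by_cases e : s = N
      · subst e; exact ⟨o, hob, hoN, by simp⟩
      · simpa [e] using h.source s hs (by omega)
  · cases hins with
    | join _ hb hN hacc =>
      rcases h.room with ⟨h1, h2⟩ | ⟨h1, s, h2, h3, h4⟩
      · exact Or.inl ⟨h1, by rw [Function.update_of_ne (by omega), h2]⟩
      · refine Or.inr ⟨h1, s, h2, h3, ?_⟩
        by_cases e : s = s₀
        · subst e; simpa using h4
        · simpa [e] using h4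
    | new cp hrej hcp hcp' =>
      rcases h.room with ⟨h1, h2⟩ | ⟨-, s, h1, h2, h3, h4⟩
      · exact Or.inr ⟨by omega, N, hb, by omega, by simp⟩
      · refine absurd ⟨h4, ?_, Or.inr h3.symm⟩ (hrej s h1 h2)
        rw [Delegate.Covers, h3, dist_self, zero_pow hm, zero_mul]; exact hθ

/-- Inserts the point in the input cells as many times as `Z 27` tells. -/
def copiesProg (m : ℕ) : RamProg :=
  .loop (.zlt (.dir 28) (.dir 27)) (.seq (insertProg m)
    (block [.zsub (.dir 27) (.dir 27) (.dir 8)]))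

theorem copiesProg_wp {d : ℕ} {ι : Type*} [DecidableEq ι] {m s b N₀ o n : ℕ} {r : ℝ}
    {S₀ : ℕ → Delegate d} {q : ι → EuclideanSpace ℝ (Fin d)} {col : ι → ℕ} {σ : RamState}
    (hm : m = 1 ∨ m = 2) (hr : 0 ≤ r) (hE : Env d σ) (hroom : Room s d N₀)
    (hob : b ≤ o) (hoN : o < N₀) (hn : N₀ - b ≤ n)
    (J A : Finset ι) (hJA : Disjoint J A)
    (hq : ∀ i ∈ A, q i = (S₀ o).loc) (hc : ∀ i ∈ A, col i = (S₀ o).col)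
    {N : ℕ} {tgt : ι → ℕ} (hB : Bounds d b N σ)
    (hR : Rebuilding m (r ^ m) b N₀ S₀ q col o N (store d σ) J tgt)
    (hr2 : σ.R (d + 4) = r ^ 2) (hy : input d σ = (S₀ o).loc) (hc3 : σ.Z 3 = (S₀ o).col)
    (h27 : σ.Z 27 = A.card) :
    Wp s (copiesProg m) σ (A.card * ((n + 1) * (6 * d + 25) + 2) + 1) fun τ =>
      ∃ N' tgt', Bounds d b N' τ ∧
      Rebuilding m (r ^ m) b N₀ S₀ q col o N' (store d τ) (J ∪ A) tgt' ∧
      (∀ a, a < 40 → (a < 13 ∨ (23 < a ∧ a ≠ 27)) → τ.Z a = σ.Z a) ∧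
      (∀ a, a < d + 9 → (a < d + 1 ∨ d + 3 < a) → τ.R a = σ.R a) := by
  have hz := hroom.z
  have hm0 : m ≠ 0 := by omega
  refine (Wp.loop_count (T₁ := (n + 1) * (6 * d + 25) + 1) (n := A.card) (fun k τ =>
    ∃ (B : Finset ι) (N' : ℕ) (tgt' : ι → ℕ), B ⊆ A ∧ B.card + k = A.card ∧
      Bounds d b N' τ ∧
      Rebuilding m (r ^ m) b N₀ S₀ q col o N' (store d τ) (J ∪ B) tgt' ∧ τ.Z 27 = k ∧
      (∀ a, a < 40 → (a < 13 ∨ (23 < a ∧ a ≠ 27)) → τ.Z a = σ.Z a) ∧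
      (∀ a, a < d + 9 → (a < d + 1 ∨ d + 3 < a) → τ.R a = σ.R a)) ?_ ?_ ?_ ?_ le_rfl).mono
    le_rfl ?_
  · intro k τ _
    simp only [RamTest.Fits, Addr.Fits]; omega
  · rintro k τ ⟨B, N', tgt', h1, h2, h3, h4, h5, h6, h7⟩
    simp only [RamTest.Holds, RamState.getZ, Addr.loc, h5, h6 28 (by omega) (by omega), hE.z28]
    omega
  · rintro k τ ⟨B, N', tgt', h1, h2, h3, h4, h5, h6, h7⟩
    have hNo : N' ≤ N₀ := by rcases h4.room with h | h <;> omega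
    obtain ⟨i₀, hi₀, hi₀'⟩ : ∃ i ∈ A, i ∉ B := by
      by_contra hcon
      push Not at hcon
      have := Finset.card_le_card (s := A) (t := B) hcon
      omega
    have hin : input d τ = (S₀ o).loc := by
      rw [← hy]; exact input_congr fun a g1 g2 => h7 a (by omega) (by omega)
    refine Wp.seq ((n + 1) * (6 * d + 25)) 1 le_rfl
      ((insertProg_wp (y := (S₀ o).loc) (c := (S₀ o).col) hm hr
        (hE.of_frame (fun a _ _ _ => h6 a (by omega) (by omega)) (h7 _ (by omega) (by omega)))
        (hroom.mono hNo) h3 (by rw [h7 _ (by omega) (by omega), hr2]) hin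
        (by rw [h6 _ (by omega) (by omega), hc3])).mono
        (Nat.mul_le_mul_right _ (by omega)) ?_)
    rintro ρ ⟨s₀, N₁, k1, k2, -, -, -, k6, k7⟩
    have hno : i₀ ∉ J ∪ B := by
      rw [Finset.mem_union, not_or]
      exact ⟨fun h => Finset.disjoint_left.1 hJA h hi₀, hi₀'⟩
    have hnew := h4.inserts (pow_nonneg hr m) hm0 hob hoN hno (hq i₀ hi₀) (hc i₀ hi₀) k1
    refine Wp.block (by simp) (by simp; omega) ?_
    set ρ' := applyAll [.zsub (.dir 27) (.dir 27) (.dir 8)] ρ with hρ'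
    have f : ∀ a, a ≠ 27 → ρ'.Z a = ρ.Z a := fun a ha => by simp (disch := omega) [hρ']
    have f' : ρ'.R = ρ.R := by simp [hρ']
    have hS : store d ρ' = store d ρ :=
      store_congr (fun a _ => f a (by omega)) fun a _ => by rw [f']
    refine ⟨insert i₀ B, N₁, Function.update tgt' i₀ s₀, Finset.insert_subset hi₀ h1, ?_,
      ⟨k2.le, ?_, ?_, ?_, ?_, ?_⟩, ?_, ?_, ?_, ?_⟩
    · rw [Finset.card_insert_of_notMem hi₀']; omega
    · rw [f _ (by omega), k2.z10]
    · rw [f _ (by omega), k2.z11]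
    · rw [f _ (by omega), k2.z13]
    · rw [f _ (by omega), k2.z14]
    · rw [f _ (by omega), k2.z15]
    · rw [Finset.union_insert, hS]; exact hnew
    · have e8 : ρ.Z 8 = 1 := by rw [k6 _ (by omega) (by omega), h6 _ (by omega) (by omega), hE.z8]
      have e27 : ρ.Z 27 = k + 1 := by rw [k6 _ (by omega) (by omega), h5]
      simp (disch := omega) [hρ', Function.update_self, e8, e27]
    · intro a g1 g2; rw [f a (by omega), k6 a g1 (by omega), h6 a g1 g2]
    · intro a g1 g2; rw [f', k7 a g1 g2, h7 a g1 g2]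
  · exact ⟨∅, N, tgt, Finset.empty_subset _, by simp, hB, by simpa using hR, h27,
      fun _ _ _ => rfl, fun _ _ _ => rfl⟩
  · rintro τ ⟨B, N', tgt', h1, h2, h3, h4, h5, h6, h7⟩
    have : B = A := Finset.eq_of_subset_of_card_le h1 (by omega)
    subst this
    exact ⟨N', tgt', h3, h4, h6, h7⟩

/-- Inserts all representatives of the current block again, with their weights. The new ones
overwrite the old ones. -/
def rebuildProg (m : ℕ) : RamProg :=
  .seq (block [.zcopy (.dir 24) (.dir 10), .zcopy (.dir 25) (.dir 11), .zcopy (.dir 26) (.dir 14),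
    .zcopy (.dir 14) (.dir 10), .zcopy (.dir 15) (.dir 11), .zcopy (.dir 13) (.dir 28)])
  (.loop (.zlt (.dir 24) (.dir 26))
    (.seq (block [.zcopy (.dir 3) (.ind 24), .zadd (.dir 27) (.dir 24) (.dir 8),
      .zcopy (.dir 27) (.ind 27), .zcopy (.dir 20) (.dir 8), .zcopy (.dir 21) (.dir 25)])
    (.seq (copyProg 20 21)
    (.seq (copiesProg m)
    (block [.zadd (.dir 24) (.dir 24) (.dir 9), .zadd (.dir 25) (.dir 25) (.dir 0)])))))

/-- The time for rebuilding a block of at most `n` points. -/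
def rebuildTime (d n : ℕ) : ℕ :=
  n * (n * ((n + 1) * (6 * d + 25) + 2) + 4 * d + 11) + 7

set_option maxHeartbeats 1000000 in
theorem rebuildProg_wp {d : ℕ} {ι : Type*} [DecidableEq ι] {m s b N₀ n : ℕ} {r θ₀ : ℝ}
    {q₀ : ι → EuclideanSpace ℝ (Fin d)} {col : ι → ℕ} {σ : RamState} {I : Finset ι}
    {tgt₀ : ι → ℕ}
    (hm : m = 1 ∨ m = 2) (hr : 0 ≤ r) (hE : Env d σ) (hroom : Room s d N₀)
    (hB : Bounds d b N₀ σ) (hS : Summary m θ₀ b N₀ (store d σ) I q₀ col tgt₀)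
    (hn : I.card ≤ n) (hr2 : σ.R (d + 4) = r ^ 2) :
    Wp s (rebuildProg m) σ (rebuildTime d n) fun τ =>
      ∃ N tgt, Bounds d b N τ ∧ N ≤ N₀ ∧
      Summary m (r ^ m) b N (store d τ) I (fun i => (store d σ (tgt₀ i)).loc) col tgt ∧
      (∀ i, i < b → store d τ i = store d σ i) ∧
      (∀ s, b ≤ s → s < N → ∃ s', b ≤ s' ∧ s' < N₀ ∧
        (store d τ s).loc = (store d σ s').loc ∧ (store d τ s).col = (store d σ s').col) ∧
      (∀ a, a < 40 → (a < 13 ∨ 27 < a) → a ≠ 3 → τ.Z a = σ.Z a) ∧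
      (∀ a, a < d + 9 → (a < 1 ∨ d + 3 < a) → τ.R a = σ.R a) := by
  classical
  obtain ⟨hbN, h10, h11, h13, h14, h15⟩ := hB
  have hm0 : m ≠ 0 := by omega
  have hz := hroom.z
  have hzr := hroom.r
  have hNn : N₀ - b ≤ n := hS.sub_le_card.trans hn
  have hE' := hE
  obtain ⟨z0, z8, z9, z28, z30, z31, z32, z33, z34, z35, z36, r7⟩ := hE'
  set S₀ := store d σ with hS₀
  set q : ι → EuclideanSpace ℝ (Fin d) := fun i => (S₀ (tgt₀ i)).loc with hq
  refine Wp.seq 6 (n * (n * ((n + 1) * (6 * d + 25) + 2) + 4 * d + 11) + 1)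
    (by unfold rebuildTime; omega) (Wp.block (by simp) ?_ ?_)
  · simp; omega
  set σ₁ := applyAll [.zcopy (.dir 24) (.dir 10), .zcopy (.dir 25) (.dir 11),
    .zcopy (.dir 26) (.dir 14), .zcopy (.dir 14) (.dir 10), .zcopy (.dir 15) (.dir 11),
    .zcopy (.dir 13) (.dir 28)] σ with hσ₁
  have f1 : ∀ a, a < 13 ∨ a = 27 ∨ 27 < a → σ₁.Z a = σ.Z a := fun a ha => by
    simp (disch := omega) [hσ₁]
  have f1' : σ₁.R = σ.R := by simp [hσ₁]
  have e24 : σ₁.Z 24 = 40 + 3 * b := by simp (disch := omega) [hσ₁, Function.update_self, h10]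
  have e25 : σ₁.Z 25 = d + 9 + b * d := by simp (disch := omega) [hσ₁, Function.update_self, h11]
  have e26 : σ₁.Z 26 = 40 + 3 * N₀ := by simp (disch := omega) [hσ₁, Function.update_self, h14]
  have hB1 : Bounds d b b σ₁ := by
    refine ⟨le_rfl, by rw [f1 _ (by omega), h10], by rw [f1 _ (by omega), h11], ?_, ?_, ?_⟩
    · simp (disch := omega) [hσ₁, Function.update_self, z28]
    · simp (disch := omega) [hσ₁, Function.update_self, h10]
    · simp (disch := omega) [hσ₁, Function.update_self, h11]
  have hS1 : store d σ₁ = S₀ := store_congr (fun a ha => f1 a (by omega)) fun a _ => by rw [f1']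
  clear_value σ₁
  refine (Wp.loop_count (T₁ := n * ((n + 1) * (6 * d + 25) + 2) + 4 * d + 10) (n := N₀ - b)
    (fun k τ => ∃ N tgt, k ≤ N₀ - b ∧ Bounds d b N τ ∧ N ≤ N₀ - k ∧
      Summary m (r ^ m) b N (store d τ) (I.filter fun i => tgt₀ i < N₀ - k) q col tgt ∧
      (∀ i, i < b → store d τ i = S₀ i) ∧
      (∀ i, N₀ - k ≤ i → store d τ i = S₀ i) ∧
      (∀ s, b ≤ s → s < N → ∃ s', b ≤ s' ∧ s' < N₀ ∧ (store d τ s).loc = (S₀ s').loc ∧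
        (store d τ s).col = (S₀ s').col) ∧
      τ.Z 24 = 40 + 3 * (N₀ - k) ∧ τ.Z 25 = d + 9 + (N₀ - k) * d ∧ τ.Z 26 = 40 + 3 * N₀ ∧
      (∀ a, a < 40 → (a < 13 ∨ 27 < a) → a ≠ 3 → τ.Z a = σ.Z a) ∧
      (∀ a, a < d + 9 → (a < 1 ∨ d + 3 < a) → τ.R a = σ.R a)) ?_ ?_ ?_ ?_
    (Nat.add_le_add_right (Nat.mul_le_mul_right _ hNn) 1)).mono le_rfl ?_
  · intro k τ _
    simp only [RamTest.Fits, Addr.Fits]; omega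
  · rintro k τ ⟨N, tgt, g0, g1, g2, g3, g4, g5, g6, g7, g8, g9, g10, g11⟩
    simp only [RamTest.Holds, RamState.getZ, Addr.loc, g7, g9]
    clear g6
    omega
  · rintro k τ ⟨N, tgt, g0, g1, g2, g3, g4, g5, g6, g7, g8, g9, g10, g11⟩
    have eo : N₀ - k = N₀ - (k + 1) + 1 := by omega
    set o := N₀ - (k + 1) with ho
    have hob : b ≤ o := by omega
    have hoN : o < N₀ := by omega
    have hro := hroom.mono hoN.le
    have hroz := hro.z
    have hror := hro.r
    have y8 : τ.Z 8 = 1 := by rw [g10 _ (by omega) (by omega) (by omega), z8]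
    have y0 : τ.Z 0 = d := by rw [g10 _ (by omega) (by omega) (by omega), z0]
    have y9 : τ.Z 9 = 3 := by rw [g10 _ (by omega) (by omega) (by omega), z9]
    refine Wp.seq 5 (n * ((n + 1) * (6 * d + 25) + 2) + 4 * d + 5) (by omega)
      (Wp.block (by simp) ?_ ?_)
    · simp (disch := omega) [Function.update_self, g7, y8]; omega
    set τ₁ := applyAll [.zcopy (.dir 3) (.ind 24), .zadd (.dir 27) (.dir 24) (.dir 8),
      .zcopy (.dir 27) (.ind 27), .zcopy (.dir 20) (.dir 8), .zcopy (.dir 21) (.dir 25)] τ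
      with hτ₁
    have k1 : ∀ a, a ≠ 3 → a ≠ 27 → a ≠ 20 → a ≠ 21 → τ₁.Z a = τ.Z a :=
      fun a h1 h2 h3 h4 => by simp (disch := omega) [hτ₁]
    have k1' : τ₁.R = τ.R := by simp [hτ₁]
    have c3 : τ₁.Z 3 = (S₀ o).col := by
      rw [← g5 o le_rfl]
      simp (disch := omega) [hτ₁, Function.update_self, g7]; rfl
    have c27 : τ₁.Z 27 = (S₀ o).wt := by
      rw [← g5 o le_rfl]
      simp (disch := omega) [hτ₁, Function.update_self, g7, y8]; rfl
    have c20 : τ₁.Z 20 = 1 := by simp (disch := omega) [hτ₁, Function.update_self, y8]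
    have c21 : τ₁.Z 21 = d + 9 + o * d := by
      simp (disch := omega) [hτ₁, Function.update_self, g8]
    clear_value τ₁
    have hE1 : Env d τ₁ := hE.of_frame (fun a h1 h2 h3 => by
        rw [k1 a h3 (by omega) (by omega) (by omega), g10 a h2 (by omega) h3])
      (by rw [k1', g11 _ (by omega) (by omega)])
    refine Wp.seq (4 * d + 1) (n * ((n + 1) * (6 * d + 25) + 2) + 4) (by omega)
      ((copyProg_wp hE1 (by omega) c20 c21 (by omega) (by omega)
        (Or.inr ⟨rfl, rfl, rfl, rfl⟩)).mono le_rfl ?_)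
    rintro τ₂ ⟨l1, l2, l3⟩
    have m1 : ∀ a, a ≠ 3 → a ≠ 27 → a ≠ 20 → a ≠ 21 → τ₂.Z a = τ.Z a :=
      fun a h1 h2 h3 h4 => by rw [l2 a (by omega), k1 a h1 h2 h3 h4]
    have m1' : ∀ a, a < 1 ∨ d < a → τ₂.R a = τ.R a := fun a ha => by
      rw [l3 a (by omega), k1']
    have hS2 : store d τ₂ = store d τ :=
      store_congr (fun a ha => m1 a (by omega) (by omega) (by omega) (by omega))
        fun a ha => m1' a (by omega)
    have hin : input d τ₂ = (S₀ o).loc := by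
      rw [← g5 o le_rfl]
      ext j
      simp only [input, store]
      rw [l1 j j.2, k1']
    have hE2 : Env d τ₂ := hE1.of_frame (fun a h1 h2 _ => l2 a (by omega)) (l3 _ (by omega))
    have hB2 : Bounds d b N τ₂ := by
      refine ⟨g1.le, ?_, ?_, ?_, ?_, ?_⟩ <;> rw [m1 _ (by omega) (by omega) (by omega) (by omega)]
      exacts [g1.z10, g1.z11, g1.z13, g1.z14, g1.z15]
    set A := I.filter fun i => tgt₀ i = o with hA
    have hAw : (S₀ o).wt = A.card := hS.wt_eq o hob hoN
    have hAn : A.card ≤ n := (Finset.card_filter_le _ _).trans hn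
    have hJA : Disjoint (I.filter fun i => tgt₀ i < o) A := by
      rw [Finset.disjoint_left]
      intro i h1 h2
      have := (Finset.mem_filter.1 h1).2
      have := (Finset.mem_filter.1 h2).2
      omega
    have hJA' : (I.filter fun i => tgt₀ i < o) ∪ A = I.filter fun i => tgt₀ i < o + 1 := by
      ext i
      simp only [hA, Finset.mem_union, Finset.mem_filter]
      constructor
      · rintro (h | h) <;> exact ⟨h.1, by omega⟩
      · rintro ⟨h1, h2⟩
        rcases Nat.lt_succ_iff_lt_or_eq.1 h2 with h2 | h2
        · exact Or.inl ⟨h1, h2⟩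
        · exact Or.inr ⟨h1, h2⟩
    have hR2 : Rebuilding m (r ^ m) b N₀ S₀ q col o N (store d τ₂)
        (I.filter fun i => tgt₀ i < o) tgt := by
      rw [hS2]
      exact ⟨g3, g4, fun i hi => g5 i hi.le, g6, Or.inl ⟨g2, g5 o le_rfl⟩⟩
    refine Wp.seq (A.card * ((n + 1) * (6 * d + 25) + 2) + 1) 2
      (by have := Nat.mul_le_mul_right ((n + 1) * (6 * d + 25) + 2) hAn; omega)
      ((copiesProg_wp hm hr hE2 hroom hob hoN hNn _ A hJA ?_ ?_ hB2 hR2 ?_ hin ?_ ?_).mono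
        le_rfl ?_)
    · intro i hi; rw [hq]; simp only [(Finset.mem_filter.1 hi).2]
    · intro i hi
      rw [← hS.col_eq i (Finset.mem_filter.1 hi).1, (Finset.mem_filter.1 hi).2]
    · rw [m1' _ (by omega), g11 _ (by omega) (by omega), hr2]
    · rw [l2 _ (by omega), c3]
    · rw [l2 _ (by omega), c27, hAw]
    rintro τ₃ ⟨N', tgt', n1, n2, n3, n4⟩
    have p24 : τ₃.Z 24 = 40 + 3 * o := by
      rw [n3 _ (by omega) (by omega), m1 _ (by omega) (by omega) (by omega) (by omega), g7]
    have p25 : τ₃.Z 25 = d + 9 + o * d := by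
      rw [n3 _ (by omega) (by omega), m1 _ (by omega) (by omega) (by omega) (by omega), g8]
    have p26 : τ₃.Z 26 = 40 + 3 * N₀ := by
      rw [n3 _ (by omega) (by omega), m1 _ (by omega) (by omega) (by omega) (by omega), g9]
    have p0 : τ₃.Z 0 = d := by
      rw [n3 _ (by omega) (by omega), m1 _ (by omega) (by omega) (by omega) (by omega), y0]
    have p9 : τ₃.Z 9 = 3 := by
      rw [n3 _ (by omega) (by omega), m1 _ (by omega) (by omega) (by omega) (by omega), y9]
    refine Wp.block (by simp) (by simp; omega) ?_
    set τ₄ := applyAll [.zadd (.dir 24) (.dir 24) (.dir 9), .zadd (.dir 25) (.dir 25) (.dir 0)] τ₃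
      with hτ₄
    have u1 : ∀ a, a ≠ 24 → a ≠ 25 → τ₄.Z a = τ₃.Z a := fun a h1 h2 => by
      simp (disch := omega) [hτ₄]
    have u1' : τ₄.R = τ₃.R := by simp [hτ₄]
    have hS4 : store d τ₄ = store d τ₃ :=
      store_congr (fun a ha => u1 a (by omega) (by omega)) fun a ha => by rw [u1']
    have hN' : N' ≤ o + 1 := by rcases n2.room with h | h <;> omega
    rw [eo]
    refine ⟨N', tgt', by omega, ⟨n1.le, ?_, ?_, ?_, ?_, ?_⟩, hN', ?_, ?_, ?_, ?_, ?_, ?_, ?_, ?_,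
      ?_⟩
    · rw [u1 _ (by omega) (by omega), n1.z10]
    · rw [u1 _ (by omega) (by omega), n1.z11]
    · rw [u1 _ (by omega) (by omega), n1.z13]
    · rw [u1 _ (by omega) (by omega), n1.z14]
    · rw [u1 _ (by omega) (by omega), n1.z15]
    · rw [hS4, ← hJA']; exact n2.summary
    · intro i hi; rw [hS4, n2.frozen i hi]
    · intro i hi; rw [hS4, n2.rest i (by omega)]
    · rw [hS4]; exact n2.source
    · simp (disch := omega) [hτ₄, Function.update_self, p24, p9]; ring
    · simp (disch := omega) [hτ₄, Function.update_self, p25, p0]; ring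
    · rw [u1 _ (by omega) (by omega), p26]
    · intro a h1 h2 h3
      rw [u1 _ (by omega) (by omega), n3 _ h1 (by omega),
        m1 _ h3 (by omega) (by omega) (by omega), g10 a h1 h2 h3]
    · intro a h1 h2
      rw [u1', n4 _ h1 (by omega), m1' _ (by omega), g11 a h1 h2]
  · have e : N₀ - (N₀ - b) = b := by omega
    refine ⟨b, tgt₀, le_rfl, hB1, by omega, ?_, ?_, ?_, ?_, ?_, ?_, e26, ?_, ?_⟩
    · have : (I.filter fun i => tgt₀ i < N₀ - (N₀ - b)) = ∅ := by
        rw [Finset.filter_eq_empty_iff]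
        intro i hi
        have := (hS.tgt_mem i hi).1
        omega
      rw [this]; exact Summary.empty _ _ _ _ _ _ _
    · intro i _; rw [hS1]
    · intro i _; rw [hS1]
    · intro s h1 h2; omega
    · rw [e, e24]
    · rw [e, e25]
    · intro a h1 h2 h3; exact f1 a (by omega)
    · intro a h1 h2; rw [f1']
  · rintro τ ⟨N, tgt, g0, g1, g2, g3, g4, g5, g6, g7, g8, g9, g10, g11⟩
    have : (I.filter fun i => tgt₀ i < N₀ - 0) = I := by
      rw [Finset.filter_eq_self]
      intro i hi
      have := (hS.tgt_mem i hi).2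
      omega
    rw [this] at g3
    exact ⟨N, tgt, g1, g2, g3, g4, g6, g10, g11⟩

/-! ### Growing the radius -/

theorem exists_card_eq_and_mem {d k : ℕ} (hd : 1 ≤ d) (hk : 1 ≤ k)
    (c : EuclideanSpace ℝ (Fin d)) :
    ∃ C : Finset (EuclideanSpace ℝ (Fin d)), C.card = k ∧ c ∈ C := by
  have : Nonempty (Fin d) := ⟨⟨0, hd⟩⟩
  have : Infinite (EuclideanSpace ℝ (Fin d)) := Module.Free.infinite ℝ _
  obtain ⟨C, h1, h2⟩ := Infinite.exists_superset_card_eq ({c} : Finset (EuclideanSpace ℝ (Fin d)))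
    k (by simpa using hk)
  exact ⟨C, h2, h1 (Finset.mem_singleton_self c)⟩

/-- The radius of a block is at most a multiple of the diameter times the number of points, since
the radius is bounded by the cost of every set of centres, also of one that contains a point of
the block. -/
theorem Block.radius_le {d : ℕ} {ι : Type*} [DecidableEq ι] {m k : ℕ} {ε K : ℝ}
    {x : ι → EuclideanSpace ℝ (Fin d)} {col : ι → ℕ} {r u : ℝ} {b N : ℕ} {S : ℕ → Delegate d}
    {I : Finset ι} {q : ι → EuclideanSpace ℝ (Fin d)} {tgt : ι → ℕ}
    (h : Block m k ε K x col r u b N S I q tgt) (hm : m = 1 ∨ m = 2) (hd : 1 ≤ d) (hk : 1 ≤ k)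
    (hε : 0 < ε) (hK : 1 ≤ K) {D : ℝ} (hD0 : 0 ≤ D) (hD : ∀ i j, dist (x i) (x j) ≤ D) {n : ℕ}
    (hn : I.card ≤ n) : r ≤ n * D * ε / 4 := by
  have hm0 : m ≠ 0 := by omega
  have hr := h.r_nonneg
  have hcost : ∃ C : Finset (EuclideanSpace ℝ (Fin d)), C.card = k ∧
      costOn m I x C ≤ n * D ^ m := by
    rcases I.eq_empty_or_nonempty with rfl | ⟨i₀, hi₀⟩
    · obtain ⟨C, hC, -⟩ := exists_card_eq_and_mem hd hk (0 : EuclideanSpace ℝ (Fin d))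
      exact ⟨C, hC, by simp only [costOn, Finset.sum_empty]; positivity⟩
    · obtain ⟨C, hC, hmem⟩ := exists_card_eq_and_mem hd hk (x i₀)
      refine ⟨C, hC, ?_⟩
      have h1 : costOn m I x C ≤ ∑ i ∈ I, D ^ m := Finset.sum_le_sum fun i _ =>
        pow_le_pow_left₀ Metric.infDist_nonneg
          ((Metric.infDist_le_dist_of_mem (by exact_mod_cast hmem)).trans (hD i i₀)) m
      rw [Finset.sum_const, nsmul_eq_mul] at h1
      have h2 : (I.card : ℝ) ≤ n := by exact_mod_cast hn
      exact h1.trans (mul_le_mul_of_nonneg_right h2 (by positivity))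
  obtain ⟨C, hC, hcost⟩ := hcost
  have h1 := (h.lower C hC).trans hcost
  have hn' : (n : ℝ) ≤ (n : ℝ) ^ m := by exact_mod_cast Nat.le_self_pow hm0 n
  have h2 : (4 * m / ε * r) ^ m ≤ (n * D) ^ m := by
    have h3 : (4 * m / ε * r) ^ m ≤ (4 * m / ε) ^ m * (2 * K) * r ^ m := by
      rw [mul_pow]
      refine mul_le_mul_of_nonneg_right ?_ (by positivity)
      exact le_mul_of_one_le_right (by positivity) (by linarith)
    rw [mul_pow (n : ℝ)]
    exact h3.trans (h1.trans (mul_le_mul_of_nonneg_right hn' (by positivity)))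
  have h3 := (pow_le_pow_iff_left₀ (by positivity) (by positivity) hm0).1 h2
  have hm1 : (1 : ℝ) ≤ m := by exact_mod_cast Nat.one_le_iff_ne_zero.2 hm0
  rw [div_mul_eq_mul_div, div_le_iff₀ hε] at h3
  nlinarith

/-- Doubles the radius, or replaces radius zero by `ε / K ^ 2` times the least distance of two
representatives, and rebuilds. Only the square of the radius is stored. -/
def growBody (m : ℕ) : RamProg :=
  .seq (.ite (.rle (.ind 33) (.ind 36))
    (block [.rdiv (.ind 31) (.dir 0) (.ind 34), .rdiv (.ind 31) (.ind 31) (.ind 34),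
      .rmul (.ind 31) (.ind 31) (.ind 31), .rdiv (.ind 33) (.ind 31) (.ind 32)])
    (block [.radd (.ind 33) (.ind 33) (.ind 33), .radd (.ind 33) (.ind 33) (.ind 33)]))
  (.seq (rebuildProg m) (block [.rcast (.ind 31) (.dir 13)]))

/-- Grows the radius until the current block has few representatives. -/
def growProg (m : ℕ) : RamProg :=
  .seq (block [.rcast (.ind 31) (.dir 13)]) (.loop (.rlt (.ind 34) (.ind 31)) (growBody m))

/-- The memory holds a block of at most `2 K` representatives. The number `e` counts how often
its radius has grown from `ρ₀`. -/
structure Current {d : ℕ} {ι : Type*} [DecidableEq ι] (m k : ℕ) (ε K : ℝ)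
    (x : ι → EuclideanSpace ℝ (Fin d)) (col : ι → ℕ) (ρ₀ : ℝ) (I : Finset ι) (b N e : ℕ) (r : ℝ)
    (q : ι → EuclideanSpace ℝ (Fin d)) (tgt : ι → ℕ) (σ : RamState) : Prop where
  env : Env d σ
  bounds : Bounds d b N σ
  r2 : σ.R (d + 4) = r ^ 2
  rK : σ.R (d + 5) = K
  rε : σ.R 0 = ε
  block : Block m k ε K x col r (σ.R (d + 3)) b N (store d σ) I q tgt
  grown : (r = 0 ∧ e = 0) ∨ (1 ≤ e ∧ ρ₀ * 2 ^ (e - 1) ≤ r)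

set_option maxHeartbeats 1000000 in
theorem growBody_wp {d : ℕ} {ι : Type*} [DecidableEq ι] {m s k ℓ L b N e n : ℕ} {ε K r ρ₀ δ₀ : ℝ}
    {x : ι → EuclideanSpace ℝ (Fin d)} {col : ι → ℕ} {I : Finset ι}
    {q : ι → EuclideanSpace ℝ (Fin d)} {tgt : ι → ℕ} {σ : RamState}
    (hm : m = 1 ∨ m = 2) (hx : Function.Injective x) (hε : 0 < ε) (hε1 : ε ≤ 1) (hd : 1 ≤ d)
    (hk : 1 ≤ k) (hL : 1 ≤ L) (hKeq : K = levelBound d k ℓ ε * L) (hK16 : 16 * (k : ℝ) ≤ K)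
    (hcol : ∀ i, col i < ℓ) (hI : I.card ≤ 2 ^ L) (hn : I.card ≤ n)
    (hδ : ∀ i j, i ≠ j → δ₀ ≤ dist (x i) (x j)) (hδ0 : 0 < δ₀)
    (hρ : ρ₀ = ε / n / n * δ₀) (hroom : Room s d N)
    (h : Current m k ε K x col ρ₀ I b N e r q tgt σ) (hN2 : ((N - b : ℕ) : ℝ) ≤ 2 * K)
    (hN : K < (N - b : ℕ)) :
    Wp s (growBody m) σ (rebuildTime d n + 6) fun τ => ∃ N' r' q' tgt',
      Current m k ε K x col ρ₀ I b N' (e + 1) r' q' tgt' τ ∧ N' ≤ N ∧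
      (∀ i, i < b → store d τ i = store d σ i) ∧
      (∀ a, a < 40 → (a < 13 ∨ 27 < a) → a ≠ 3 → τ.Z a = σ.Z a) ∧
      (∀ a, a < d + 9 → (a < 1 ∨ d + 4 < a) → τ.R a = σ.R a) ∧
      τ.R (d + 2) = (N' - b : ℕ) := by
  obtain ⟨hE, hB, hr2, hrK, hrε, hBl, hg⟩ := h
  have hE' := hE
  obtain ⟨z0, z8, z9, z28, z30, z31, z32, z33, z34, z35, z36, r7⟩ := hE'
  have hz := hroom.z
  have hzr := hroom.r
  have hr := hBl.r_nonneg
  have hk' : (1 : ℝ) ≤ k := by exact_mod_cast hk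
  have hKn : K < n := lt_of_lt_of_le hN (by exact_mod_cast hBl.summary.sub_le_card.trans hn)
  have hK0 : 0 < K := by linarith
  have hN2' : 2 ≤ N - b := by
    have : (1 : ℝ) < (N - b : ℕ) := by linarith
    exact_mod_cast this
  have step : Wp s (.ite (.rle (.ind 33) (.ind 36))
      (block [.rdiv (.ind 31) (.dir 0) (.ind 34), .rdiv (.ind 31) (.ind 31) (.ind 34),
        .rmul (.ind 31) (.ind 31) (.ind 31), .rdiv (.ind 33) (.ind 31) (.ind 32)])
      (block [.radd (.ind 33) (.ind 33) (.ind 33), .radd (.ind 33) (.ind 33) (.ind 33)])) σ 5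
      fun τ => ∃ r', 0 < r' ∧ (r = 0 → r' ^ 2 = (ε / K / K) ^ 2 / σ.R (d + 3)) ∧
        (r ≠ 0 → r' = 2 * r) ∧ ρ₀ * 2 ^ e ≤ r' ∧ τ.R (d + 4) = r' ^ 2 ∧ τ.Z = σ.Z ∧
        (∀ a, (a < d + 2 ∨ d + 2 < a) → a ≠ d + 4 → τ.R a = σ.R a) := by
    refine Wp.ite (T₁ := 4) (by simp [z33, z36]; omega) le_rfl ?_ ?_
    · intro hle
      simp only [RamTest.Holds, RamState.getR, Addr.loc, z33, z36, hr2, r7] at hle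
      have hr0 : r = 0 := pow_eq_zero_iff two_ne_zero |>.1 (le_antisymm hle (sq_nonneg r))
      subst hr0
      obtain ⟨hu, i, j, hij, hu'⟩ := hBl.exists_gap_eq hx hN2'
      have hdist := hδ i j hij
      have hroot : (ε / K / K * dist (x i) (x j)) ^ 2 = (ε / K / K) ^ 2 / σ.R (d + 3) := by
        rw [hu', div_inv_eq_mul, mul_pow]
      refine Wp.block (by simp) (by simp (disch := omega) [z31, z32, z33, z34]; omega) ?_
      refine ⟨ε / K / K * dist (x i) (x j), ?_, fun _ => hroot, fun h => absurd rfl h, ?_, ?_, ?_,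
        ?_⟩
      · have : 0 < dist (x i) (x j) := by linarith
        positivity
      · have he : e = 0 := by
          rcases hg with h | ⟨h1, h2⟩
          · exact h.2
          · have : 0 < ρ₀ := by
              have : (0 : ℝ) < n := by linarith
              rw [hρ]; positivity
            have : 0 < ρ₀ * 2 ^ (e - 1) := by positivity
            linarith
        rw [he, pow_zero, mul_one, hρ]
        gcongr
      · rw [hroot]
        simp (disch := omega) [z31, z32, z33, z34, Function.update_self, hrK, hrε, sq]
      · simp
      · intro a h1 h2
        simp (disch := omega) [z31, z33]
    · intro hle
      simp only [RamTest.Holds, RamState.getR, Addr.loc, z33, z36, hr2, r7] at hle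
      have hr0 : r ≠ 0 := by rintro rfl; simp at hle
      refine Wp.block (by simp) (by simp (disch := omega) [z33]; omega) ?_
      refine ⟨2 * r, by positivity, fun h => absurd h hr0, fun _ => rfl, ?_, ?_, ?_, ?_⟩
      · rcases hg with h | ⟨h1, h2⟩
        · exact absurd h.1 hr0
        · obtain ⟨e', rfl⟩ := Nat.exists_eq_succ_of_ne_zero (by omega : e ≠ 0)
          rw [Nat.succ_sub_one] at h2
          rw [pow_succ]; linarith
      · simp (disch := omega) [z33, Function.update_self, hr2]; ring
      · simp
      · intro a h1 h2
        simp (disch := omega) [z33]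
  refine Wp.seq 5 (rebuildTime d n + 1) (by omega) (step.mono le_rfl ?_)
  rintro σ₁ ⟨r', hr', h0, h1, hge, h4, hZ, hR⟩
  have hS1 : store d σ₁ = store d σ :=
    store_congr (fun a _ => by rw [hZ]) fun a ha => hR a (by omega) (by omega)
  have hE1 : Env d σ₁ := hE.of_frame (fun a _ _ _ => by rw [hZ]) (hR _ (by omega) (by omega))
  have hB1 : Bounds d b N σ₁ := by
    refine ⟨hB.le, ?_, ?_, ?_, ?_, ?_⟩ <;> rw [hZ]
    exacts [hB.z10, hB.z11, hB.z13, hB.z14, hB.z15]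
  refine Wp.seq _ 1 le_rfl ((rebuildProg_wp hm hr'.le hE1 hroom hB1
    (by rw [hS1]; exact hBl.summary) hn h4).mono le_rfl ?_)
  rintro σ₂ ⟨N', tgt', k1, k2, k3, k4, k5, k6, k7⟩
  rw [hS1] at k3 k4 k5
  have y31 : σ₂.Z 31 = d + 2 := by rw [k6 _ (by omega) (by omega) (by omega), hZ, z31]
  refine Wp.block (by simp) (by simp [y31]; omega) ?_
  set σ₃ := applyAll [.rcast (.ind 31) (.dir 13)] σ₂ with hσ₃
  have f : σ₃.Z = σ₂.Z := by simp [hσ₃]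
  have f' : ∀ a, a < d + 2 ∨ d + 2 < a → σ₃.R a = σ₂.R a := fun a ha => by
    simp (disch := omega) [hσ₃, y31]
  have hS3 : store d σ₃ = store d σ₂ :=
    store_congr (fun a _ => by rw [f]) fun a ha => f' a (by omega)
  have g1 : ∀ a, a < 40 → (a < 13 ∨ 27 < a) → a ≠ 3 → σ₃.Z a = σ.Z a := fun a p1 p2 p3 => by
    rw [f, k6 a p1 p2 p3, hZ]
  have g2 : ∀ a, a < d + 9 → (a < 1 ∨ d + 4 < a) → σ₃.R a = σ.R a := fun a p1 p2 => by
    rw [f' a (by omega), k7 a p1 (by omega), hR a (by omega) (by omega)]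
  refine ⟨N', r', fun i => (store d σ (tgt i)).loc, tgt',
    ⟨?_, ⟨k1.le, ?_, ?_, ?_, ?_, ?_⟩, ?_, ?_, ?_, ?_, ?_⟩, k2, ?_, g1, g2, ?_⟩
  · exact hE.of_frame (fun a p1 p2 p3 => g1 a p2 (by omega) p3) (g2 _ (by omega) (by omega))
  · rw [f, k1.z10]
  · rw [f, k1.z11]
  · rw [f, k1.z13]
  · rw [f, k1.z14]
  · rw [f, k1.z15]
  · rw [f' _ (by omega), k7 _ (by omega) (by omega), h4]
  · rw [g2 _ (by omega) (by omega), hrK]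
  · rw [g2 _ (by omega) (by omega), hrε]
  · exact hBl.rescale hm hx hε hε1 hd hk hL hKeq hK16 (fun i _ => hcol i) hI hN hN2 hr' h0 h1
      (fun i _ => rfl) (by rw [hS3]; exact k5) (by rw [hS3]; exact k3) _
  · exact Or.inr ⟨by omega, hge⟩
  · intro i hi; rw [hS3, k4 i hi]
  · simp (disch := omega) [hσ₃, y31, Function.update_self, k1.z13]

theorem growProg_wp {d : ℕ} {ι : Type*} [DecidableEq ι] {m s k ℓ L b N e n E₀ : ℕ}
    {ε K r ρ₀ δ₀ D : ℝ}
    {x : ι → EuclideanSpace ℝ (Fin d)} {col : ι → ℕ} {I : Finset ι}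
    {q : ι → EuclideanSpace ℝ (Fin d)} {tgt : ι → ℕ} {σ : RamState}
    (hm : m = 1 ∨ m = 2) (hx : Function.Injective x) (hε : 0 < ε) (hε1 : ε ≤ 1) (hd : 1 ≤ d)
    (hk : 1 ≤ k) (hL : 1 ≤ L) (hKeq : K = levelBound d k ℓ ε * L) (hK16 : 16 * (k : ℝ) ≤ K)
    (hcol : ∀ i, col i < ℓ) (hI : I.card ≤ 2 ^ L) (hn : I.card ≤ n)
    (hδ : ∀ i j, i ≠ j → δ₀ ≤ dist (x i) (x j)) (hδ0 : 0 < δ₀)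
    (hD0 : 0 ≤ D) (hD : ∀ i j, dist (x i) (x j) ≤ D)
    (hρ : ρ₀ = ε / n / n * δ₀)
    (hE₀ : ∀ e : ℕ, 1 ≤ e → ρ₀ * 2 ^ (e - 1) ≤ n * D * ε / 4 → e ≤ E₀) (hroom : Room s d N)
    (h : Current m k ε K x col ρ₀ I b N e r q tgt σ) (hN2 : ((N - b : ℕ) : ℝ) ≤ 2 * K) :
    Wp s (growProg m) σ ((E₀ + 1) * (rebuildTime d n + 7) + 2) fun τ => ∃ N' e' r' q' tgt',
      Current m k ε K x col ρ₀ I b N' e' r' q' tgt' τ ∧ N' ≤ N ∧ ((N' - b : ℕ) : ℝ) ≤ K ∧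
      (∀ i, i < b → store d τ i = store d σ i) ∧
      (∀ a, a < 40 → (a < 13 ∨ 27 < a) → a ≠ 3 → τ.Z a = σ.Z a) ∧
      (∀ a, a < d + 9 → (a < 1 ∨ d + 4 < a) → τ.R a = σ.R a) := by
  have hz := hroom.z
  have hzr := hroom.r
  have hk' : (1 : ℝ) ≤ k := by exact_mod_cast hk
  have z31 := h.env.z31
  have hlev : ∀ {b N e : ℕ} {r : ℝ} {q : ι → EuclideanSpace ℝ (Fin d)} {tgt : ι → ℕ}
      {τ : RamState}, Current m k ε K x col ρ₀ I b N e r q tgt τ → e ≤ E₀ := by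
    intro b N e r q tgt τ hc
    rcases hc.grown with ⟨-, rfl⟩ | ⟨h1, h2⟩
    · exact Nat.zero_le _
    · exact hE₀ e h1 (h2.trans (hc.block.radius_le hm hd hk hε (by linarith) hD0 hD hn))
  have hT : 1 + ((E₀ + 1) * (rebuildTime d n + 6 + 1) + 1) ≤
      (E₀ + 1) * (rebuildTime d n + 7) + 2 := by
    rw [add_assoc _ 6 1]; omega
  refine Wp.seq 1 ((E₀ + 1) * (rebuildTime d n + 6 + 1) + 1) hT (Wp.block (by simp)
    (by simp [z31]; omega) ?_)
  set σ₁ := applyAll [.rcast (.ind 31) (.dir 13)] σ with hσ₁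
  have f : σ₁.Z = σ.Z := by simp [hσ₁]
  have f' : ∀ a, a < d + 2 ∨ d + 2 < a → σ₁.R a = σ.R a := fun a ha => by
    simp (disch := omega) [hσ₁, z31]
  have hS1 : store d σ₁ = store d σ :=
    store_congr (fun a _ => by rw [f]) fun a ha => f' a (by omega)
  have hC1 : Current m k ε K x col ρ₀ I b N e r q tgt σ₁ := by
    obtain ⟨c1, c2, c3, c4, c5, c6, c7⟩ := h
    refine ⟨c1.of_frame (fun a _ _ _ => by rw [f]) (f' _ (by omega)), ⟨c2.le, ?_, ?_, ?_, ?_, ?_⟩,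
      ?_, ?_, ?_, ?_, c7⟩
    · rw [f, c2.z10]
    · rw [f, c2.z11]
    · rw [f, c2.z13]
    · rw [f, c2.z14]
    · rw [f, c2.z15]
    · rw [f' _ (by omega), c3]
    · rw [f' _ (by omega), c4]
    · rw [f' _ (by omega), c5]
    · rw [f' _ (by omega), hS1]; exact c6
  have e2 : σ₁.R (d + 2) = (N - b : ℕ) := by
    simp (disch := omega) [hσ₁, z31, Function.update_self, h.bounds.z13]
  clear_value σ₁
  have he := hlev h
  refine (Wp.loop (T₁ := rebuildTime d n + 6) (fun f τ => ∃ N' e' r' q' tgt',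
      Current m k ε K x col ρ₀ I b N' e' r' q' tgt' τ ∧ e' + f = E₀ + 1 ∧ N' ≤ N ∧
      (∀ i, i < b → store d τ i = store d σ i) ∧
      (∀ a, a < 40 → (a < 13 ∨ 27 < a) → a ≠ 3 → τ.Z a = σ.Z a) ∧
      (∀ a, a < d + 9 → (a < 1 ∨ d + 4 < a) → τ.R a = σ.R a) ∧
      τ.R (d + 2) = (N' - b : ℕ)) ?_ ?_ ?_ (E₀ + 1 - e) ?_ ?_).mono le_rfl ?_
  · rintro g τ ⟨N', e', r', q', tgt', c1, -⟩
    simp only [RamTest.Fits, Addr.Fits, c1.env.z31, c1.env.z34]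
    omega
  · rintro τ ⟨N', e', r', q', tgt', c1, c2, -⟩
    have := hlev c1
    omega
  · rintro g τ ⟨N', e', r', q', tgt', c1, c2, c3, c4, c5, c6, c7⟩ hlt
    simp only [RamTest.Holds, RamState.getR, Addr.loc, c1.env.z31, c1.env.z34, c7, c1.rK] at hlt
    have hsub : ((N' - b : ℕ) : ℝ) ≤ (N - b : ℕ) := by exact_mod_cast Nat.sub_le_sub_right c3 b
    refine (growBody_wp hm hx hε hε1 hd hk hL hKeq hK16 hcol hI hn hδ hδ0 hρ (hroom.mono c3) c1
      (hsub.trans hN2) hlt).mono le_rfl ?_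
    rintro τ' ⟨N'', r'', q'', tgt'', d1, d2, d3, d4, d5, d6⟩
    exact ⟨N'', e' + 1, r'', q'', tgt'', d1, by omega, d2.trans c3,
      fun i hi => by rw [d3 i hi, c4 i hi], fun a p1 p2 p3 => by rw [d4 a p1 p2 p3, c5 a p1 p2 p3],
      fun a p1 p2 => by rw [d5 a p1 p2, c6 a p1 p2], d6⟩
  · exact ⟨N, e, r, q, tgt, hC1, by omega, le_rfl, fun i _ => by rw [hS1], fun a _ _ _ => by rw [f],
      fun a _ _ => f' a (by omega), e2⟩
  · exact Nat.add_le_add_right (Nat.mul_le_mul_right _ (Nat.sub_le _ _)) 1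
  · rintro τ ⟨g, ⟨N', e', r', q', tgt', c1, c2, c3, c4, c5, c6, c7⟩, hlt⟩
    simp only [RamTest.Holds, RamState.getR, Addr.loc, c1.env.z31, c1.env.z34, c7, c1.rK,
      not_lt] at hlt
    exact ⟨N', e', r', q', tgt', c1, c3, hlt, c4, c5, c6⟩

/-! ### Finished blocks -/

/-- The representatives `S 0, …, S (b - 1)` are final: the points `i ∈ F` stay on the
representatives `tgt i`. -/
structure Frozen {d : ℕ} {ι : Type*} [DecidableEq ι] (m k : ℕ) (ε : ℝ)
    (x : ι → EuclideanSpace ℝ (Fin d)) (col : ι → ℕ) (b : ℕ) (S : ℕ → Delegate d)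
    (F : Finset ι) (tgt : ι → ℕ) : Prop where
  tgt_lt : ∀ i ∈ F, tgt i < b
  col_eq : ∀ i ∈ F, (S (tgt i)).col = col i
  wt_eq : ∀ s, s < b → (S s).wt = (F.filter fun i => tgt i = s).card
  wt_pos : ∀ s, s < b → 0 < (S s).wt
  source : ∀ s, s < b → ∃ i ∈ F, (S s).loc = x i ∧ (S s).col = col i
  ne_loc : ∀ s, s < b → ∀ s', s' < b → s ≠ s' → (S s).loc ≠ (S s').loc
  movement_le : ∀ C : Finset (EuclideanSpace ℝ (Fin d)), C.card = k →
    ∑ i ∈ F, dist (x i) (S (tgt i)).loc ^ m ≤ (ε / (2 * m)) ^ m * costOn m F x C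

namespace Frozen

variable {d : ℕ} {ι : Type*} [DecidableEq ι] {m k : ℕ} {ε : ℝ}
  {x : ι → EuclideanSpace ℝ (Fin d)} {col : ι → ℕ} {b : ℕ} {S : ℕ → Delegate d}
  {F : Finset ι} {tgt : ι → ℕ}

theorem empty (S : ℕ → Delegate d) (tgt : ι → ℕ) : Frozen m k ε x col 0 S ∅ tgt := by
  constructor <;> simp [costOn]

theorem congr (h : Frozen m k ε x col b S F tgt) {S' : ℕ → Delegate d}
    (hS : ∀ s, s < b → S' s = S s) : Frozen m k ε x col b S' F tgt := by
  have hT : ∀ i ∈ F, S' (tgt i) = S (tgt i) := fun i hi => hS _ (h.tgt_lt i hi)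
  constructor
  · exact h.tgt_lt
  · intro i hi; rw [hT i hi]; exact h.col_eq i hi
  · intro s hs; rw [hS s hs]; exact h.wt_eq s hs
  · intro s hs; rw [hS s hs]; exact h.wt_pos s hs
  · intro s hs; rw [hS s hs]; exact h.source s hs
  · intro s hs s' hs'; rw [hS s hs, hS s' hs']; exact h.ne_loc s hs s' hs'
  · intro C hC
    rw [Finset.sum_congr rfl fun i hi => by rw [hT i hi]]
    exact h.movement_le C hC

/-- A block becomes final. The bounds on the movements add up, since the points of the two
parts are served by the same centres. -/
theorem append (h : Frozen m k ε x col b S F tgt) {K r u : ℝ} {N : ℕ} {I : Finset ι}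
    {q : ι → EuclideanSpace ℝ (Fin d)} {tgt' : ι → ℕ}
    (hB : Block m k ε K x col r u b N S I q tgt') (hx : Function.Injective x)
    (hFI : Disjoint F I) (hm : m = 1 ∨ m = 2) (hε : 0 < ε) (hK : ((N - b : ℕ) : ℝ) ≤ 2 * K) :
    Frozen m k ε x col N S (F ∪ I) (F.piecewise tgt tgt') := by
  have hI : ∀ i ∈ I, F.piecewise tgt tgt' i = tgt' i := fun i hi =>
    Finset.piecewise_eq_of_notMem _ _ _ (Finset.disjoint_right.1 hFI hi)
  have hF : ∀ i ∈ F, F.piecewise tgt tgt' i = tgt i := fun i hi =>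
    Finset.piecewise_eq_of_mem _ _ _ hi
  have hbN := hB.summary.le
  have hne : ∀ s, s < b → ∀ s', b ≤ s' → s' < N → (S s).loc ≠ (S s').loc := by
    intro s hs s' h1 h2 e
    obtain ⟨i, hi, h3, -⟩ := h.source s hs
    obtain ⟨j, hj, h4, -⟩ := hB.source s' h1 h2
    have : i = j := hx (by rw [← h3, ← h4, e])
    exact Finset.disjoint_left.1 hFI hi (this ▸ hj)
  constructor
  · intro i hi
    rcases Finset.mem_union.1 hi with hi | hi
    · rw [hF i hi]; exact (h.tgt_lt i hi).trans_le hbN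
    · rw [hI i hi]; exact (hB.summary.tgt_mem i hi).2
  · intro i hi
    rcases Finset.mem_union.1 hi with hi | hi
    · rw [hF i hi]; exact h.col_eq i hi
    · rw [hI i hi]; exact hB.summary.col_eq i hi
  · intro s hs
    rw [Finset.filter_union, Finset.filter_congr fun i hi => by rw [hF i hi],
      Finset.filter_congr (s := I) fun i hi => by rw [hI i hi]]
    rcases lt_or_ge s b with hsb | hsb
    · have : (I.filter fun i => tgt' i = s) = ∅ := by
        rw [Finset.filter_eq_empty_iff]
        intro i hi e
        have := (hB.summary.tgt_mem i hi).1
        omega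
      rw [this, Finset.union_empty]; exact h.wt_eq s hsb
    · have : (F.filter fun i => tgt i = s) = ∅ := by
        rw [Finset.filter_eq_empty_iff]
        intro i hi e
        have := h.tgt_lt i hi
        omega
      rw [this, Finset.empty_union]; exact hB.summary.wt_eq s hsb hs
  · intro s hs
    rcases lt_or_ge s b with hsb | hsb
    · exact h.wt_pos s hsb
    · exact hB.summary.wt_pos s hsb hs
  · intro s hs
    rcases lt_or_ge s b with hsb | hsb
    · obtain ⟨i, hi, h1⟩ := h.source s hsb
      exact ⟨i, Finset.mem_union_left _ hi, h1⟩
    · obtain ⟨i, hi, h1⟩ := hB.source s hsb hs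
      exact ⟨i, Finset.mem_union_right _ hi, h1⟩
  · intro s hs s' hs' hss
    rcases lt_or_ge s b with hsb | hsb <;> rcases lt_or_ge s' b with hsb' | hsb'
    · exact h.ne_loc s hsb s' hsb' hss
    · exact hne s hsb s' hsb' hs'
    · exact (hne s' hsb' s hsb hs).symm
    · exact hB.ne_loc hx hsb hs hsb' hs' hss
  · intro C hC
    have h1 := h.movement_le C hC
    have h2 := hB.movement_le hm hε hK hC
    rw [costOn, Finset.sum_union hFI, Finset.sum_union hFI, mul_add]
    refine add_le_add ?_ ?_
    · rw [Finset.sum_congr rfl fun i hi => by rw [hF i hi]]; exact h1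
    · rw [Finset.sum_congr rfl fun i hi => by rw [hI i hi]]; exact h2

end Frozen

/-! ### Processing a point of the stream -/

/-- Starts a new block, whose level is twice that of the current one: the bound on its number of
representatives is doubled, that on its number of points is squared. -/
def restartProg : RamProg :=
  block [.zcopy (.dir 10) (.dir 14), .zcopy (.dir 11) (.dir 15), .zcopy (.dir 13) (.dir 28),
    .zcopy (.dir 12) (.dir 28), .rcopy (.ind 33) (.ind 36), .rcopy (.ind 32) (.ind 36),
    .radd (.ind 34) (.ind 34) (.ind 34), .rmul (.ind 35) (.ind 35) (.ind 35)]

/-- Processes the input: inserts it, grows the radius if necessary, and ends the block if it has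
all its points. -/
def updateProg (m : ℕ) : RamProg :=
  .seq (insertProg m) (.seq (block [.zadd (.dir 12) (.dir 12) (.dir 8)])
  (.seq (growProg m) (.seq (block [.rcast (.ind 31) (.dir 12)])
  (.ite (.rle (.ind 35) (.ind 31)) restartProg .skip))))

/-- The memory after the first `t` points of the stream: the points of `F` are on the final
representatives, the others are in the current block, which ends after `2 ^ L` points. -/
structure Streamed {d n : ℕ} (m k ℓ : ℕ) (ε : ℝ) (x : Fin n → EuclideanSpace ℝ (Fin d))
    (col : Fin n → ℕ) (ρ₀ : ℝ) (t L : ℕ) (F I : Finset (Fin n)) (b N e : ℕ) (r : ℝ)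
    (q : Fin n → EuclideanSpace ℝ (Fin d)) (ftgt tgt : Fin n → ℕ) (σ : RamState) : Prop where
  current : Current m k ε (levelBound d k ℓ ε * L) x col ρ₀ I b N e r q tgt σ
  frozen : Frozen m k ε x col b (store d σ) F ftgt
  disjoint : Disjoint F I
  mem_iff : ∀ i, i ∈ F ∪ I ↔ i.val < t
  count : σ.Z 12 = I.card
  nmax : σ.R (d + 6) = 2 ^ L
  card_lt : I.card < 2 ^ L
  /-- together the finished blocks have no more representatives than the current one may have -/
  frozen_le : (b : ℝ) ≤ levelBound d k ℓ ε * L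
  sub_le : ((N - b : ℕ) : ℝ) ≤ levelBound d k ℓ ε * L
  one_le : 1 ≤ L
  /-- the level doubled when the number of points had reached `2 ^ (L / 2)` -/
  level_le : L = 1 ∨ 2 ^ L ≤ t ^ 2

theorem Inserts.le_succ {d m b N c s N' : ℕ} {θ : ℝ} {S S' : ℕ → Delegate d}
    {y : EuclideanSpace ℝ (Fin d)} (h : Inserts m θ b N S y c s N' S') : N' ≤ N + 1 := by
  cases h <;> omega

/-- The time for processing a point, when the radius of a block grows at most `E` times. -/
def updateTime (d n E : ℕ) : ℕ := (n + 1) * (6 * d + 25) + (E + 1) * (rebuildTime d n + 7) + 14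

set_option maxHeartbeats 1000000 in
theorem updateProg_wp {d n m s k ℓ t L b N e E M : ℕ} {ε r ρ₀ δ₀ D : ℝ}
    {x : Fin n → EuclideanSpace ℝ (Fin d)} {f : Fin n → Fin ℓ} {F I : Finset (Fin n)}
    {q : Fin n → EuclideanSpace ℝ (Fin d)} {ftgt tgt : Fin n → ℕ} {σ : RamState}
    (hm : m = 1 ∨ m = 2) (hx : Function.Injective x) (hε : 0 < ε) (hε1 : ε ≤ 1) (hd : 1 ≤ d)
    (hk : 1 ≤ k) (hℓ : 1 ≤ ℓ)
    (hδ : ∀ i j, i ≠ j → δ₀ ≤ dist (x i) (x j)) (hδ0 : 0 < δ₀)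
    (hD0 : 0 ≤ D) (hD : ∀ i j, dist (x i) (x j) ≤ D) (hρ : ρ₀ = ε / n / n * δ₀)
    (hE : ∀ e : ℕ, 1 ≤ e → ρ₀ * 2 ^ (e - 1) ≤ n * D * ε / 4 → e ≤ E) (hroom : Room s d M)
    (hM : ∀ L N : ℕ, (L = 1 ∨ 2 ^ L ≤ n ^ 2) → (N : ℝ) ≤ 2 * (levelBound d k ℓ ε * L) + 1 → N ≤ M)
    (h : Streamed m k ℓ ε x (fun i => (f i : ℕ)) ρ₀ t L F I b N e r q ftgt tgt σ) (ht : t < n) :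
    Wp s (updateProg m) (σ.load (x ⟨t, ht⟩) (f ⟨t, ht⟩)) (updateTime d n E) fun τ =>
      ∃ L' F' I' b' N' e' r' q' ftgt' tgt',
        Streamed m k ℓ ε x (fun i => (f i : ℕ)) ρ₀ (t + 1) L' F' I' b' N' e' r' q' ftgt' tgt'
          τ := by
  obtain ⟨hC, hFr, hFI, hmem, hcnt, hnmax, hcard, hbK, hNK, hL, hLt⟩ := h
  have hz := hroom.z
  have hzr := hroom.r
  have hm0 : m ≠ 0 := by omega
  set i₀ : Fin n := ⟨t, ht⟩ with hi₀
  set σ₀ := σ.load (x i₀) (f i₀) with hσ₀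
  have a1 : ∀ a, a ≠ 3 → σ₀.Z a = σ.Z a := fun a ha => by
    simp [hσ₀, RamState.load, ha]
  have a2 : ∀ a, a < 1 ∨ d < a → σ₀.R a = σ.R a := fun a ha => by
    simp only [hσ₀, RamState.load]; rw [dif_neg (by omega)]
  have a3 : σ₀.Z 3 = f i₀ := by simp [hσ₀, RamState.load]
  have a4 : input d σ₀ = x i₀ := by
    ext j
    simp [input, hσ₀, RamState.load]
  clear_value σ₀
  have hS0 : store d σ₀ = store d σ :=
    store_congr (fun a ha => a1 a (by omega)) fun a ha => a2 a (by omega)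
  set K := levelBound d k ℓ ε * L with hK
  have hK16 : 16 * (k : ℝ) ≤ K := by
    have h1 := levelBound_ge hd hk hℓ hε hε1
    have h2 : (1 : ℝ) ≤ L := by exact_mod_cast hL
    have h3 : (0 : ℝ) ≤ k := Nat.cast_nonneg k
    rw [hK]; nlinarith
  have hk' : (1 : ℝ) ≤ k := by exact_mod_cast hk
  obtain ⟨hEn, hB, hr2, hrK, hrε, hBl, hg⟩ := hC
  have hEn0 : Env d σ₀ := hEn.of_frame (fun a _ _ h3 => a1 a h3) (a2 _ (by omega))
  have hB0 : Bounds d b N σ₀ := by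
    refine ⟨hB.le, ?_, ?_, ?_, ?_, ?_⟩ <;> rw [a1 _ (by omega)]
    exacts [hB.z10, hB.z11, hB.z13, hB.z14, hB.z15]
  have hLn : L = 1 ∨ 2 ^ L ≤ n ^ 2 := hLt.imp id fun h =>
    h.trans (Nat.pow_le_pow_left ht.le 2)
  have hbN := hB.le
  have hNcast : (N : ℝ) = b + (N - b : ℕ) := by
    rw [← Nat.cast_add]; congr 1; omega
  have hNM : N + 1 ≤ M := by
    refine hM L (N + 1) hLn ?_
    push_cast
    linarith
  have hIn : I.card ≤ n := (Finset.card_le_univ I).trans (by simp)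
  have hNbn : N - b ≤ n := hBl.summary.sub_le_card.trans hIn
  have hi₀I : i₀ ∉ F ∪ I := by rw [hmem]; simp [hi₀]
  rw [Finset.mem_union, not_or] at hi₀I
  have hT : (N - b + 1) * (6 * d + 25) +
      (1 + ((E + 1) * (rebuildTime d n + 7) + 2 + (1 + 9))) ≤ updateTime d n E := by
    have := Nat.mul_le_mul_right (6 * d + 25) (Nat.add_le_add_right hNbn 1)
    unfold updateTime; omega
  refine Wp.seq _ _ hT ((insertProg_wp hm hBl.r_nonneg hEn0
    (hroom.mono (by omega : N ≤ M)) hB0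
    (by rw [a2 _ (by omega), hr2]) a4 a3).mono le_rfl ?_)
  rintro σ₁ ⟨s₀, N₁, hins, hB1, hu1, hu2, hu3, b1, b2⟩
  rw [hS0] at hins hu2 hu3
  rw [a2 _ (by omega)] at hu1 hu3
  have hN1 : N₁ ≤ N + 1 := hins.le_succ
  have hBl1 := hBl.inserts hm0 hx hi₀I.2 hins hu1 hu2 hu3
  have c2 : ∀ a, a < d + 9 → (a < 1 ∨ d + 3 < a) → σ₁.R a = σ.R a := fun a h1 h2 => by
    rw [b2 a h1 (by omega), a2 a (by omega)]
  have hS1 : ∀ i, i < b → store d σ₁ i = store d σ i := fun i hi =>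
    hins.eq_of_ne (Or.inl hi) hbN
  refine Wp.seq 1 _ le_rfl (Wp.block (by simp) (by simp; omega) ?_)
  set σ₂ := applyAll [.zadd (.dir 12) (.dir 12) (.dir 8)] σ₁ with hσ₂
  have d1 : ∀ a, a ≠ 12 → σ₂.Z a = σ₁.Z a := fun a ha => by simp (disch := omega) [hσ₂]
  have d1' : σ₂.R = σ₁.R := by simp [hσ₂]
  have d12 : σ₂.Z 12 = I.card + 1 := by
    simp (disch := omega) [hσ₂, Function.update_self, b1, a1, hcnt, hEn.z8]
  clear_value σ₂
  have hS2 : store d σ₂ = store d σ₁ :=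
    store_congr (fun a ha => d1 a (by omega)) fun a ha => by rw [d1']
  have hcardI : (insert i₀ I).card = I.card + 1 := Finset.card_insert_of_notMem hi₀I.2
  have hC2 : Current m k ε K x (fun i => (f i : ℕ)) ρ₀ (insert i₀ I) b N₁ e r
      (Function.update q i₀ (x i₀)) (Function.update tgt i₀ s₀) σ₂ := by
    refine ⟨?_, ⟨hB1.le, ?_, ?_, ?_, ?_, ?_⟩, ?_, ?_, ?_, ?_, hg⟩
    · refine hEn.of_frame (fun a h1 h2 h3 => ?_) ?_
      · rw [d1 a (by omega), b1 a h2 (by omega), a1 a h3]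
      · rw [d1', c2 _ (by omega) (by omega)]
    · rw [d1 _ (by omega), hB1.z10]
    · rw [d1 _ (by omega), hB1.z11]
    · rw [d1 _ (by omega), hB1.z13]
    · rw [d1 _ (by omega), hB1.z14]
    · rw [d1 _ (by omega), hB1.z15]
    · rw [d1', c2 _ (by omega) (by omega), hr2]
    · rw [d1', c2 _ (by omega) (by omega), hrK]
    · rw [d1', c2 _ (by omega) (by omega), hrε]
    · rw [d1', hS2]; exact hBl1
  have hin' : (insert i₀ I).card ≤ n := (Finset.card_le_univ _).trans (by simp)
  have hN1b : ((N₁ - b : ℕ) : ℝ) ≤ 2 * K := by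
    have h1 : N₁ - b ≤ N - b + 1 := by omega
    have h2 : ((N₁ - b : ℕ) : ℝ) ≤ (N - b : ℕ) + 1 := by exact_mod_cast h1
    linarith
  refine Wp.seq _ _ le_rfl ((growProg_wp hm hx hε hε1 hd hk hL hK hK16 (fun i => (f i).2)
    (by rw [hcardI]; exact hcard) hin' hδ hδ0 hD0 hD hρ hE (hroom.mono (hN1.trans hNM)) hC2
    hN1b).mono le_rfl ?_)
  rintro σ₃ ⟨N₃, e₃, r₃, q₃, tgt₃, hC3, hN3, hN3K, g3, g1, g2⟩
  have z31 := hC3.env.z31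
  refine Wp.seq 1 9 (by omega) (Wp.block (by simp) (by simp [z31]; omega) ?_)
  set σ₄ := applyAll [.rcast (.ind 31) (.dir 12)] σ₃ with hσ₄
  have h1 : σ₄.Z = σ₃.Z := by simp [hσ₄]
  have h1' : ∀ a, a ≠ d + 2 → σ₄.R a = σ₃.R a := fun a ha => by
    simp (disch := omega) [hσ₄, z31]
  have h12 : σ₃.Z 12 = I.card + 1 := by rw [g1 _ (by omega) (by omega) (by omega), d12]
  have hr31 : σ₄.R (d + 2) = (I.card + 1 : ℕ) := by
    simp (disch := omega) [hσ₄, z31, Function.update_self, h12]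
  clear_value σ₄
  have hS4 : store d σ₄ = store d σ₃ :=
    store_congr (fun a ha => by rw [h1]) fun a ha => h1' a (by omega)
  have hS4b : ∀ i, i < b → store d σ₄ i = store d σ i := fun i hi => by
    rw [hS4, g3 i hi, hS2, hS1 i hi]
  have hFr4 := hFr.congr hS4b
  have hnm4 : σ₄.R (d + 6) = 2 ^ L := by
    rw [h1' _ (by omega), g2 _ (by omega) (by omega), d1', c2 _ (by omega) (by omega), hnmax]
  obtain ⟨m1, m2, m3, m4, m5, m6, m7⟩ := hC3
  have hFI' : Disjoint F (insert i₀ I) := Finset.disjoint_insert_right.2 ⟨hi₀I.1, hFI⟩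
  have hmem' : ∀ i, i ∈ F ∪ insert i₀ I ↔ i.val < t + 1 := by
    intro i
    rw [Finset.union_insert, Finset.mem_insert, hmem, Fin.ext_iff, hi₀]
    simp only
    omega
  have hBl4 : Block m k ε K x (fun i => (f i : ℕ)) r₃ (σ₄.R (d + 3)) b N₃ (store d σ₄)
      (insert i₀ I) q₃ tgt₃ := by
    rw [h1' _ (by omega), hS4]; exact m6
  have hIt : I.card + 1 ≤ t + 1 := by
    rw [← hcardI]
    have h1 : (insert i₀ I).card ≤ (Finset.univ.filter fun i : Fin n => i.val < t + 1).card :=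
      Finset.card_le_card fun i hi => by
        rw [Finset.mem_filter]
        exact ⟨Finset.mem_univ _, (hmem' i).1 (Finset.mem_union_right _ hi)⟩
    refine h1.trans ?_
    have h2 : ((Finset.univ.filter fun i : Fin n => i.val < t + 1).map Fin.valEmbedding) ⊆
        Finset.range (t + 1) := by
      intro a ha
      simp only [Finset.mem_map, Finset.mem_filter, Finset.mem_univ, true_and,
        Fin.valEmbedding_apply] at ha
      obtain ⟨i, hi, rfl⟩ := ha
      exact Finset.mem_range.2 hi
    simpa using Finset.card_le_card h2
  obtain ⟨z0, z8, z9, z28, z30, z31', z32, z33, z34, z35, z36, r7⟩ := m1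
  refine Wp.ite (T₁ := 8) (by simp [h1, z35, z31]; omega) le_rfl ?_ ?_
  · intro hle
    simp only [RamTest.Holds, RamState.getR, Addr.loc, h1, z35, z31, hnm4, hr31] at hle
    have hle' : 2 ^ L ≤ I.card + 1 := by exact_mod_cast hle
    -- the block is complete
    refine Wp.block (by simp) (by simp (disch := omega) [h1, z32, z33, z34, z35, z36]; omega) ?_
    set σ₅ := applyAll _ σ₄ with hσ₅
    have k1 : ∀ a, (a < 10 ∨ 13 < a) → σ₅.Z a = σ₃.Z a := fun a ha => by
      simp (disch := omega) [hσ₅, h1]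
    have k2 : ∀ a, (a < d + 3 ∨ d + 6 < a) → σ₅.R a = σ₄.R a := fun a ha => by
      simp (disch := omega) [hσ₅, h1, z32, z33, z34, z35, z36]
    have k3 : σ₅.R (d + 3) = 0 := by
      simp (disch := omega) [hσ₅, h1, z32, z33, z34, z35, z36, h1', r7]
    have k4 : σ₅.R (d + 4) = 0 := by
      simp (disch := omega) [hσ₅, h1, z32, z33, z34, z35, z36, h1', r7]
    have k5 : σ₅.R (d + 5) = K + K := by
      simp (disch := omega) [hσ₅, h1, z32, z33, z34, z35, z36, h1', m4]
    have k6 : σ₅.R (d + 6) = 2 ^ L * 2 ^ L := by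
      simp (disch := omega) [hσ₅, h1, z32, z33, z34, z35, z36, hnm4]
    have k10 : σ₅.Z 10 = 40 + 3 * N₃ := by simp (disch := omega) [hσ₅, h1, m2.z14]
    have k11 : σ₅.Z 11 = d + 9 + N₃ * d := by simp (disch := omega) [hσ₅, h1, m2.z15]
    have k12 : σ₅.Z 12 = 0 := by simp (disch := omega) [hσ₅, h1, z28]
    have k13 : σ₅.Z 13 = 0 := by simp (disch := omega) [hσ₅, h1, z28]
    clear_value σ₅
    have hS5 : store d σ₅ = store d σ₄ :=
      store_congr (fun a ha => by rw [k1 a (by omega), h1]) fun a ha => k2 a (by omega)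
    have hcast : levelBound d k ℓ ε * (2 * L : ℕ) = K + K := by rw [hK]; push_cast; ring
    have hFr5 := hFr4.append hBl4 hx hFI' hm hε (by linarith)
    have hN3cast : (N₃ : ℝ) = b + (N₃ - b : ℕ) := by
      rw [← Nat.cast_add]; congr 1; have := m2.le; omega
    refine ⟨2 * L, F ∪ insert i₀ I, ∅, N₃, N₃, 0, 0, q₃, _, tgt₃, ⟨?_, ⟨le_rfl, ?_, ?_, ?_, ?_, ?_⟩,
      ?_, ?_, ?_, ?_, Or.inl ⟨rfl, rfl⟩⟩, (by rw [hS5]; exact hFr5), Finset.disjoint_empty_right _,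
      ?_, ?_, ?_, ?_, ?_, ?_, by omega, Or.inr ?_⟩
    · constructor <;> first | rw [k1 _ (by omega)]; assumption | skip
      rw [k2 _ (by omega), h1' _ (by omega)]; exact r7
    · exact k10
    · exact k11
    · rw [k13, Nat.sub_self]
    · rw [k1 _ (by omega), m2.z14]
    · rw [k1 _ (by omega), m2.z15]
    · rw [k4]; simp
    · rw [k5, hcast]
    · rw [k2 _ (by omega), h1' _ (by omega), m5]
    · rw [k3]; exact Block.empty hm0 _ _ _ _
    · intro i; rw [Finset.union_empty]; exact hmem' i
    · rw [k12, Finset.card_empty]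
    · rw [k6, ← pow_add, two_mul]
    · simp
    · rw [hcast]; linarith
    · rw [hcast, Nat.sub_self, Nat.cast_zero]; linarith
    · calc 2 ^ (2 * L) = (2 ^ L) ^ 2 := by rw [mul_comm, pow_mul]
        _ ≤ (t + 1) ^ 2 := Nat.pow_le_pow_left (hle'.trans hIt) 2
  · intro hlt
    simp only [RamTest.Holds, RamState.getR, Addr.loc, h1, z35, z31, hnm4, hr31, not_le] at hlt
    have hlt' : I.card + 1 < 2 ^ L := by exact_mod_cast hlt
    refine Wp.skip ⟨L, F, insert i₀ I, b, N₃, e₃, r₃, q₃, ftgt, tgt₃,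
      ⟨?_, ⟨m2.le, ?_, ?_, ?_, ?_, ?_⟩, ?_, ?_, ?_, hBl4, m7⟩, hFr4, hFI', hmem', ?_, hnm4, ?_, hbK,
      hN3K, hL, ?_⟩
    · constructor <;> first | rw [h1]; assumption | skip
      rw [h1' _ (by omega)]; exact r7
    · rw [h1, m2.z10]
    · rw [h1, m2.z11]
    · rw [h1, m2.z13]
    · rw [h1, m2.z14]
    · rw [h1, m2.z15]
    · rw [h1' _ (by omega), m3]
    · rw [h1' _ (by omega), m4]
    · rw [h1' _ (by omega), m5]
    · rw [h1, h12, hcardI]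
    · rw [hcardI]; exact hlt'
    · exact hLt.imp id fun h => h.trans (Nat.pow_le_pow_left (Nat.le_succ t) 2)

/-! ### Initialization -/

/-- Multiplies the real cell at the address in `Z u` by the `d`-th power of the one at the
address in `Z v`. -/
def powProg (u v : ℕ) : RamProg :=
  .seq (block [.zcopy (.dir 20) (.dir 8)])
  (.loop (.zle (.dir 20) (.dir 0)) (block [
    .rmul (.ind u) (.ind u) (.ind v), .zadd (.dir 20) (.dir 20) (.dir 8)]))

theorem powProg_wp {s d u v A B : ℕ} {σ : RamState} (h0 : σ.Z 0 = d) (h8 : σ.Z 8 = 1)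
    (hs : 21 ≤ s) (hu : σ.Z u = A) (hv : σ.Z v = B) (hus : u < s) (hvs : v < s) (hAs : A < s)
    (hBs : B < s) (hu20 : u ≠ 20) (hv20 : v ≠ 20) (hAB : A ≠ B) :
    Wp s (powProg u v) σ (3 * d + 2) fun τ => τ.R A = σ.R A * σ.R B ^ d ∧
      (∀ a, a ≠ 20 → τ.Z a = σ.Z a) ∧ ∀ a, a ≠ A → τ.R a = σ.R a := by
  refine Wp.seq 1 (3 * d + 1) (by omega) (Wp.block (by simp) (by simp; omega) ?_)
  set σ₁ := applyAll [.zcopy (.dir 20) (.dir 8)] σ with hσ₁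
  have f1 : ∀ a, a ≠ 20 → σ₁.Z a = σ.Z a := fun a ha => by simp (disch := omega) [hσ₁]
  have f2 : σ₁.R = σ.R := by simp [hσ₁]
  have e20 : σ₁.Z 20 = 1 := by simp [hσ₁, h8]
  clear_value σ₁
  refine (Wp.loop_count (T₁ := 2) (n := d) (fun k τ => k ≤ d ∧ τ.Z 20 = 1 + (d - k) ∧
    τ.R A = σ.R A * σ.R B ^ (d - k) ∧
    (∀ a, a ≠ 20 → τ.Z a = σ.Z a) ∧ ∀ a, a ≠ A → τ.R a = σ.R a) ?_ ?_ ?_ ?_ (by omega)).mono le_rfl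
    ?_
  · rintro n τ ⟨-, h⟩
    simp only [RamTest.Fits, Addr.Fits]; omega
  · rintro n τ ⟨h1, h2, h3, h4, h5⟩
    simp only [RamTest.Holds, RamState.getZ, Addr.loc, h2, h4 0 (by omega), h0]; omega
  · rintro n τ ⟨h1, h2, h3, h4, h5⟩
    have y8 : τ.Z 8 = 1 := by rw [h4 _ (by omega), h8]
    have yu : τ.Z u = A := by rw [h4 _ hu20, hu]
    have yv : τ.Z v = B := by rw [h4 _ hv20, hv]
    have e : d - n = d - (n + 1) + 1 := by omega
    refine Wp.block (by simp) (by simp [yu, yv]; omega) ?_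
    refine ⟨by omega, ?_, ?_, ?_, ?_⟩
    · simp [h2, y8]; omega
    · rw [e, pow_succ, ← mul_assoc, ← h3, ← h5 B hAB.symm]
      simp [yu, yv]
    · intro a ha; simp [ha, h4]
    · intro a ha; simp [ha, yu, h5]
  · exact ⟨le_rfl, by omega, by simp [f2], f1, fun a _ => by rw [f2]⟩
  · rintro τ ⟨h1, h2, h3, h4, h5⟩
    exact ⟨by simpa using h3, h4, h5⟩

/-- Sets up the cells that are constant while the stream is processed. -/
def constProg : RamProg :=
  block [.zconst (.dir 8) 1, .zconst (.dir 9) 3, .zadd (.dir 30) (.dir 0) (.dir 8),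
    .zadd (.dir 31) (.dir 30) (.dir 8), .zadd (.dir 32) (.dir 31) (.dir 8),
    .zadd (.dir 33) (.dir 32) (.dir 8), .zadd (.dir 34) (.dir 33) (.dir 8),
    .zadd (.dir 35) (.dir 34) (.dir 8), .zadd (.dir 36) (.dir 35) (.dir 8)]

theorem constProg_wp {s d : ℕ} {σ : RamState} (hs : 40 ≤ s) (h0 : σ.Z 0 = d) (h28 : σ.Z 28 = 0)
    (hr : σ.R (d + 7) = 0) :
    Wp s constProg σ 9 fun τ => Env d τ ∧ τ.R = σ.R ∧
      ∀ a, (a < 8 ∨ 9 < a) → (a < 30 ∨ 36 < a) → τ.Z a = σ.Z a := by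
  refine Wp.block (by simp) (by simp (disch := omega); omega) ?_
  refine ⟨?_, ?_, fun a h1 h2 => ?_⟩
  · constructor <;> simp (disch := omega) [h0, h28, hr]
  · simp
  · simp (disch := omega)

/-- Puts the first address of the representatives into the registers of the first block. -/
def addressProg : RamProg :=
  block [.zconst (.dir 10) 40, .zcopy (.dir 14) (.dir 10), .zconst (.dir 11) 9,
    .zadd (.dir 11) (.dir 0) (.dir 11), .zcopy (.dir 15) (.dir 11)]

theorem addressProg_wp {s d : ℕ} {σ : RamState} (hs : 40 ≤ s) (h0 : σ.Z 0 = d)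
    (h13 : σ.Z 13 = 0) :
    Wp s addressProg σ 5 fun τ => Bounds d 0 0 τ ∧ τ.R = σ.R ∧
      ∀ a, (a < 10 ∨ 11 < a) → (a < 14 ∨ 15 < a) → τ.Z a = σ.Z a := by
  refine Wp.block (by simp) (by simp (disch := omega); omega) ?_
  refine ⟨⟨le_rfl, ?_, ?_, ?_, ?_, ?_⟩, ?_, fun a h1 h2 => ?_⟩ <;>
    simp (disch := omega) [h0, h13]

/-- Computes `levelBound` and the number of points of the first block. -/
def levelProg : RamProg :=
  .seq (block [.zconst (.dir 16) 131072, .rcast (.ind 31) (.dir 16), .rcast (.ind 30) (.dir 8)])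
  (.seq (powProg 30 31)
  (.seq (block [.rdiv (.ind 31) (.ind 30) (.dir 0), .rcast (.ind 34) (.dir 8)])
  (.seq (powProg 34 31)
  (block [.rcast (.ind 31) (.dir 2), .rcast (.ind 30) (.dir 1), .rmul (.ind 31) (.ind 31) (.ind 30),
    .rmul (.ind 34) (.ind 34) (.ind 31), .zadd (.dir 16) (.dir 8) (.dir 8),
    .rcast (.ind 35) (.dir 16)]))))

set_option maxHeartbeats 1000000 in
theorem levelProg_wp {s d k ℓ : ℕ} {ε : ℝ} {σ : RamState} (hs : 40 ≤ s) (hs' : d + 9 ≤ s)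
    (hE : Env d σ) (h1 : σ.Z 1 = k) (h2 : σ.Z 2 = ℓ) (hε : σ.R 0 = ε) :
    Wp s levelProg σ (6 * d + 15) fun τ => τ.R (d + 5) = levelBound d k ℓ ε ∧ τ.R (d + 6) = 2 ∧
      (∀ a, a ≠ 16 → a ≠ 20 → τ.Z a = σ.Z a) ∧
      ∀ a, (a < d + 1 ∨ d + 2 < a) → (a < d + 5 ∨ d + 6 < a) → τ.R a = σ.R a := by
  obtain ⟨z0, z8, z9, z28, z30, z31, z32, z33, z34, z35, z36, r7⟩ := hE
  refine Wp.seq 3 (6 * d + 12) (by omega) (Wp.block (by simp)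
    (by simp (disch := omega) [z30, z31]; omega) ?_)
  set σ₁ := applyAll _ σ with hσ₁
  have b1 : ∀ a, a ≠ 16 → σ₁.Z a = σ.Z a := fun a ha => by simp (disch := omega) [hσ₁]
  have r1 : σ₁.R (d + 1) = 1 := by simp (disch := omega) [hσ₁, z8, z30]
  have r2 : σ₁.R (d + 2) = 131072 := by simp (disch := omega) [hσ₁, z30, z31]
  have r3 : ∀ a, a < d + 1 ∨ d + 2 < a → σ₁.R a = σ.R a := fun a ha => by
    simp (disch := omega) [hσ₁, z30, z31]
  clear_value σ₁
  refine Wp.seq (3 * d + 2) (3 * d + 10) (by omega) ((powProg_wp (by rw [b1 _ (by omega), z0])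
    (by rw [b1 _ (by omega), z8]) (by omega) (by rw [b1 _ (by omega), z30])
    (by rw [b1 _ (by omega), z31]) (by omega) (by omega) (by omega) (by omega) (by omega)
    (by omega) (by omega)).mono le_rfl ?_)
  rintro σ₂ ⟨c1, c2, c3⟩
  rw [r1, r2, one_mul] at c1
  have y1 : ∀ a, a ≠ 16 → a ≠ 20 → σ₂.Z a = σ.Z a := fun a h1 h2 => by rw [c2 a h2, b1 a h1]
  have y30 : σ₂.Z 30 = d + 1 := by rw [y1 _ (by omega) (by omega), z30]
  have y31 : σ₂.Z 31 = d + 2 := by rw [y1 _ (by omega) (by omega), z31]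
  have y34 : σ₂.Z 34 = d + 5 := by rw [y1 _ (by omega) (by omega), z34]
  have y8 : σ₂.Z 8 = 1 := by rw [y1 _ (by omega) (by omega), z8]
  refine Wp.seq 2 (3 * d + 8) (by omega) (Wp.block (by simp)
    (by simp (disch := omega) [y30, y31, y34]; omega) ?_)
  set σ₃ := applyAll _ σ₂ with hσ₃
  have d1 : σ₃.Z = σ₂.Z := by simp [hσ₃]
  have d2 : σ₃.R (d + 2) = 131072 ^ d / ε := by
    simp (disch := omega) [hσ₃, y30, y31, y34, c1, c3, r3, hε]
  have d3 : σ₃.R (d + 5) = 1 := by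
    simp (disch := omega) [hσ₃, y34, y8]
  have d4 : ∀ a, a ≠ d + 1 → a ≠ d + 2 → a ≠ d + 5 → σ₃.R a = σ.R a := fun a h1 h2 h3 => by
    simp (disch := omega) [hσ₃, y30, y31, y34, c3, r3]
  clear_value σ₃
  refine Wp.seq (3 * d + 2) 6 (by omega) ((powProg_wp
    (by rw [d1, y1 _ (by omega) (by omega), z0])
    (by rw [d1, y8])
    (by omega) (by rw [d1, y34]) (by rw [d1, y31]) (by omega) (by omega) (by omega) (by omega)
    (by omega) (by omega) (by omega)).mono le_rfl ?_)
  rintro σ₄ ⟨e1, e2, e3⟩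
  rw [d2, d3, one_mul] at e1
  have x1 : ∀ a, a ≠ 16 → a ≠ 20 → σ₄.Z a = σ.Z a := fun a h h' => by rw [e2 a h', d1, y1 a h h']
  refine Wp.block (by simp)
    (by simp (disch := omega) [x1, z30, z31, z34, z35]; omega) ?_
  refine ⟨?_, ?_, fun a h1 h2 => ?_, fun a h1 h2 => ?_⟩
  · simp (disch := omega) [x1, z30, z31, z34, z35, h1, h2, e1, levelBound]
  · simp (disch := omega) [x1, z35, z8]
  · simp (disch := omega) [x1]
  · simp (disch := omega) [x1, z30, z31, z34, z35, e3, d4]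

/-- Prepares the memory for the stream. -/
def initProg : RamProg := .seq constProg (.seq addressProg levelProg)

theorem initProg_wp {s d n m k ℓ : ℕ} {ε ρ₀ : ℝ} {x : Fin n → EuclideanSpace ℝ (Fin d)}
    {col : Fin n → ℕ} (hm : m ≠ 0) (hs : 40 ≤ s) (hs' : d + 9 ≤ s) (hε : 0 < ε) :
    Wp s initProg (RamState.start d k ℓ ε) (6 * d + 29) fun τ => ∃ L F I b N e r q ftgt tgt,
      Streamed m k ℓ ε x col ρ₀ 0 L F I b N e r q ftgt tgt τ := by
  have s0 : (RamState.start d k ℓ ε).Z 0 = d := rfl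
  have s1 : (RamState.start d k ℓ ε).Z 1 = k := rfl
  have s2 : (RamState.start d k ℓ ε).Z 2 = ℓ := rfl
  have s3 : ∀ a, 2 < a → (RamState.start d k ℓ ε).Z a = 0 := fun a ha => by
    simp only [RamState.start]; rw [if_neg (by omega), if_neg (by omega), if_neg (by omega)]
  have s4 : (RamState.start d k ℓ ε).R 0 = ε := rfl
  have s5 : ∀ a, a ≠ 0 → (RamState.start d k ℓ ε).R a = 0 := fun a ha => by
    simp only [RamState.start]; rw [if_neg ha]
  generalize RamState.start d k ℓ ε = σ at *
  refine Wp.seq 9 (6 * d + 20) (by omega) ((constProg_wp hs s0 (s3 _ (by omega))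
    (s5 _ (by omega))).mono le_rfl ?_)
  rintro σ₁ ⟨hE1, b1, b2⟩
  refine Wp.seq 5 (6 * d + 15) (by omega) ((addressProg_wp hs hE1.z0
    (by rw [b2 _ (by omega) (by omega), s3 _ (by omega)])).mono le_rfl ?_)
  rintro σ₂ ⟨hB2, c1, c2⟩
  have hE2 : Env d σ₂ := hE1.of_frame (fun a h1 h2 h3 => c2 a (by omega) (by omega)) (by rw [c1])
  refine (levelProg_wp (k := k) (ℓ := ℓ) (ε := ε) hs hs' hE2
    (by rw [c2 _ (by omega) (by omega), b2 _ (by omega) (by omega), s1])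
    (by rw [c2 _ (by omega) (by omega), b2 _ (by omega) (by omega), s2])
    (by rw [c1, b1, s4])).mono le_rfl ?_
  rintro σ₃ ⟨d1, d2, d3, d4⟩
  have d5 : ∀ a, a ≠ 0 → (a < d + 1 ∨ d + 2 < a) → (a < d + 5 ∨ d + 6 < a) → σ₃.R a = 0 :=
    fun a h1 h2 h3 => by rw [d4 a h2 h3, c1, b1, s5 a h1]
  have hlb : 0 ≤ levelBound d k ℓ ε := by unfold levelBound; positivity
  refine ⟨1, ∅, ∅, 0, 0, 0, 0, fun _ => 0, fun _ => 0, fun _ => 0,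
    ⟨?_, ⟨le_rfl, ?_, ?_, ?_, ?_, ?_⟩, ?_, ?_, ?_, ?_, Or.inl ⟨rfl, rfl⟩⟩, Frozen.empty _ _,
    Finset.disjoint_empty_right _, ?_, ?_, ?_, ?_, ?_, ?_, le_rfl, Or.inl rfl⟩
  · exact hE2.of_frame (fun a h1 h2 h3 => d3 a (by omega) (by omega)) (d4 _ (by omega) (by omega))
  · rw [d3 _ (by omega) (by omega), hB2.z10]
  · rw [d3 _ (by omega) (by omega), hB2.z11]
  · rw [d3 _ (by omega) (by omega), hB2.z13]
  · rw [d3 _ (by omega) (by omega), hB2.z14]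
  · rw [d3 _ (by omega) (by omega), hB2.z15]
  · rw [d5 _ (by omega) (by omega) (by omega), zero_pow two_ne_zero]
  · rw [d1, Nat.cast_one, mul_one]
  · rw [d4 _ (by omega) (by omega), c1, b1, s4]
  · rw [d5 _ (by omega) (by omega) (by omega)]
    exact Block.empty hm _ _ _ _
  · simp
  · rw [d3 _ (by omega) (by omega), c2 _ (by omega) (by omega), b2 _ (by omega) (by omega),
      s3 _ (by omega), Finset.card_empty]
  · rw [d2, pow_one]
  · simp
  · simpa using hlb
  · simpa using hlb

/-! ### Output -/

/-- Unpacks the colours and the weights of the representatives into arrays behind the integer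
array of the representatives, which ends before the address `a` in `Z 14`: the colours start at
`a`, and the weights at `2 * a`, as there are fewer than `a` representatives. The coordinates stay
in place. -/
def reportProg : RamProg :=
  .seq (block [.zcopy (.dir 4) (.dir 28), .zcopy (.dir 6) (.dir 14),
    .zadd (.dir 7) (.dir 14) (.dir 14), .zconst (.dir 16) 40, .zcopy (.dir 22) (.dir 6),
    .zcopy (.dir 23) (.dir 7), .zconst (.dir 5) 9, .zadd (.dir 5) (.dir 0) (.dir 5)])
  (.loop (.zlt (.dir 16) (.dir 14)) (block [.zcopy (.ind 22) (.ind 16),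
    .zadd (.dir 17) (.dir 16) (.dir 8), .zcopy (.ind 23) (.ind 17),
    .zadd (.dir 16) (.dir 16) (.dir 9), .zadd (.dir 22) (.dir 22) (.dir 8),
    .zadd (.dir 23) (.dir 23) (.dir 8), .zadd (.dir 4) (.dir 4) (.dir 8)]))

theorem reportProg_wp {s d b N : ℕ} {σ : RamState} (hE : Env d σ) (hB : Bounds d b N σ)
    (hs : 80 + 7 * N ≤ s) :
    Wp s reportProg σ (8 * N + 9) fun τ => τ.Z 4 = N ∧ τ.Z 5 = d + 9 ∧ τ.Z 6 = 40 + 3 * N ∧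
      τ.Z 7 = 80 + 6 * N ∧
      (∀ i, i < N → τ.Z (40 + 3 * N + i) = (store d σ i).col) ∧
      (∀ i, i < N → τ.Z (80 + 6 * N + i) = (store d σ i).wt) ∧ τ.R = σ.R := by
  obtain ⟨z0, z8, z9, z28, z30, z31, z32, z33, z34, z35, z36, r7⟩ := hE
  have z14 := hB.z14
  refine Wp.seq 8 (8 * N + 1) (by omega) (Wp.block (by simp) (by simp; omega) ?_)
  set σ₁ := applyAll _ σ with hσ₁
  have f1 : ∀ a, (a < 4 ∨ 7 < a) → a ≠ 16 → a ≠ 22 → a ≠ 23 → σ₁.Z a = σ.Z a :=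
    fun a h1 h2 h3 h4 => by simp (disch := omega) [hσ₁]
  have f2 : σ₁.R = σ.R := by simp [hσ₁]
  have e4 : σ₁.Z 4 = 0 := by simp (disch := omega) [hσ₁, z28]
  have e5 : σ₁.Z 5 = d + 9 := by simp (disch := omega) [hσ₁, z0]
  have e6 : σ₁.Z 6 = 40 + 3 * N := by simp (disch := omega) [hσ₁, z14]
  have e7 : σ₁.Z 7 = 80 + 6 * N := by simp (disch := omega) [hσ₁, z14]; omega
  have e16 : σ₁.Z 16 = 40 := by simp (disch := omega) [hσ₁]
  have e22 : σ₁.Z 22 = 40 + 3 * N := by simp (disch := omega) [hσ₁, z14]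
  have e23 : σ₁.Z 23 = 80 + 6 * N := by simp (disch := omega) [hσ₁, z14]; omega
  clear_value σ₁
  refine (Wp.loop_count (T₁ := 7) (n := N) (fun k τ => k ≤ N ∧ τ.Z 4 = N - k ∧
    τ.Z 16 = 40 + 3 * (N - k) ∧ τ.Z 22 = 40 + 3 * N + (N - k) ∧ τ.Z 23 = 80 + 6 * N + (N - k) ∧
    (∀ i, i < N - k → τ.Z (40 + 3 * N + i) = (store d σ i).col) ∧
    (∀ i, i < N - k → τ.Z (80 + 6 * N + i) = (store d σ i).wt) ∧
    (∀ a, 4 < a → a < 40 + 3 * N → a ≠ 16 → a ≠ 17 → a ≠ 22 → a ≠ 23 → τ.Z a = σ₁.Z a) ∧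
    τ.R = σ.R) ?_ ?_ ?_ ?_ (by omega)).mono le_rfl ?_
  · rintro n τ -
    simp only [RamTest.Fits, Addr.Fits]; omega
  · rintro n τ ⟨h1, h2, h3, h4, h5, h6, h7, h8, h9⟩
    simp (disch := omega) only [RamTest.Holds, RamState.getZ, Addr.loc, h3, h8, f1, z14]; omega
  · rintro n τ ⟨h1, h2, h3, h4, h5, h6, h7, h8, h9⟩
    have e : N - n = N - (n + 1) + 1 := by omega
    have y8 : τ.Z 8 = 1 := by
      rw [h8 _ (by omega) (by omega) (by omega) (by omega) (by omega) (by omega),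
        f1 _ (by omega) (by omega) (by omega) (by omega), z8]
    have y9 : τ.Z 9 = 3 := by
      rw [h8 _ (by omega) (by omega) (by omega) (by omega) (by omega) (by omega),
        f1 _ (by omega) (by omega) (by omega) (by omega), z9]
    set o := N - (n + 1) with ho
    have hc : τ.Z (40 + 3 * o) = (store d σ o).col := by
      rw [h8 _ (by omega) (by omega) (by omega) (by omega) (by omega) (by omega),
        f1 _ (by omega) (by omega) (by omega) (by omega)]; rfl
    have hw : τ.Z (40 + 3 * o + 1) = (store d σ o).wt := by
      rw [h8 _ (by omega) (by omega) (by omega) (by omega) (by omega) (by omega),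
        f1 _ (by omega) (by omega) (by omega) (by omega)]; rfl
    rw [e]
    refine Wp.block (by simp) (by simp (disch := omega) [h3, h4, h5, y8]; omega) ?_
    refine ⟨by omega, ?_, ?_, ?_, ?_, ?_, ?_, ?_, ?_⟩
    · simp (disch := omega) [h2, h3, h4, h5, y8]
    · simp (disch := omega) [h3, h4, h5, y8, y9]; ring
    · simp (disch := omega) [h3, h4, h5, y8]; ring
    · simp (disch := omega) [h3, h4, h5, y8]; ring
    · intro i hi
      by_cases ei : i = o
      · subst ei; simp (disch := omega) [h3, h4, h5, y8, hc]
      · simp (disch := omega) [h3, h4, h5, y8, h6]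
    · intro i hi
      by_cases ei : i = o
      · subst ei; simp (disch := omega) [h3, h4, h5, y8, hw]
      · simp (disch := omega) [h3, h4, h5, y8, h7]
    · intro a p1 p2 p3 p4 p5 p6
      simp (disch := omega) [h3, h4, h5, y8, h8]
    · simp [h9]
  · refine ⟨le_rfl, by omega, by omega, by omega, by omega, ?_, ?_, fun _ _ _ _ _ _ _ => rfl, f2⟩
    · intro i hi; omega
    · intro i hi; omega
  · rintro τ ⟨h1, h2, h3, h4, h5, h6, h7, h8, h9⟩
    refine ⟨by omega, ?_, ?_, ?_, h6, h7, h9⟩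
    · rw [h8 _ (by omega) (by omega) (by omega) (by omega) (by omega) (by omega), e5]
    · rw [h8 _ (by omega) (by omega) (by omega) (by omega) (by omega) (by omega), e6]
    · rw [h8 _ (by omega) (by omega) (by omega) (by omega) (by omega) (by omega), e7]

/-! ### The whole stream -/

/-- An invariant that every update preserves holds after the whole stream. -/
theorem StreamAlg.feed_of_wp {d n ℓ s T : ℕ} (M : StreamAlg) {x : Fin n → EuclideanSpace ℝ (Fin d)}
    {f : Fin n → Fin ℓ} (Inv : ℕ → RamState → Prop)
    (h : ∀ t (ht : t < n) σ, Inv t σ →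
      Wp s M.update (σ.load (x ⟨t, ht⟩) (f ⟨t, ht⟩)) T (Inv (t + 1))) {j t : ℕ}
    (hj : t + j = n) {σ : RamState} (hσ : Inv t σ) :
    ∃ t' τ, M.Feed s ((List.ofFn fun i => (x i, f i)).drop t) σ t' τ ∧ t' ≤ j * (d + 1 + T) ∧
      Inv n τ := by
  induction j generalizing t σ with
  | zero =>
    refine ⟨0, σ, ?_, by omega, by rwa [← hj]⟩
    rw [List.drop_of_length_le (by simp; omega)]
    exact .nil σ
  | succ j ih =>
    have ht : t < n := by omega
    obtain ⟨t₁, σ₁, h1, h2, h3⟩ := h t ht σ hσ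
    obtain ⟨t₂, σ₂, h4, h5, h6⟩ := ih (by omega) h3
    refine ⟨d + 1 + t₁ + t₂, σ₂, ?_, ?_, h6⟩
    · rw [List.drop_eq_getElem_cons (by simpa using ht), List.getElem_ofFn]
      exact .cons h1 h4
    · rw [Nat.succ_mul]; omega

/-! ### The output is a coreset -/

/-- The streaming algorithm for the exponent `m`. -/
def coresetAlg (m : ℕ) : StreamAlg := ⟨initProg, updateProg m, reportProg⟩

/-- When all blocks are finished, the representatives form a coreset, because the bound on the
movement holds for every set of centres, hence for the infimum. -/
theorem Frozen.isMovementColorCoreset {d n ℓ N m k : ℕ} {ε : ℝ}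
    {x : Fin n → EuclideanSpace ℝ (Fin d)} {f : Fin n → Fin ℓ} {S : ℕ → Delegate d}
    {F : Finset (Fin n)} {tgt : Fin n → ℕ}
    (h : Frozen m k ε x (fun i => (f i : ℕ)) N S F tgt) (hF : ∀ i, i ∈ F) (hd : 1 ≤ d)
    (hk : 1 ≤ k) (hm : m ≠ 0) (hε : 0 < ε) {g : Fin N → Fin ℓ} (hg : ∀ s, (g s : ℕ) = (S s).col) :
    N ≤ n ∧ IsMovementColorCoreset m k ε x f (fun s : Fin N => (S s).loc) g
      fun s => (S s).wt := by
  have hFu : F = Finset.univ := Finset.eq_univ_of_forall hF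
  subst hFu
  have hgf : ∀ i, g ⟨tgt i, h.tgt_lt i (hF i)⟩ = f i := fun i => by
    rw [Fin.ext_iff, hg, h.col_eq i (hF i)]
  refine ⟨?_, fun s => h.wt_pos s s.2, ?_, fun i => ⟨tgt i, h.tgt_lt i (hF i)⟩, hgf, ?_, ?_⟩
  · have hsurj : Function.Surjective fun i => (⟨tgt i, h.tgt_lt i (hF i)⟩ : Fin N) := by
      intro s
      have h1 := h.wt_pos s s.2
      rw [h.wt_eq s s.2, Finset.card_pos] at h1
      obtain ⟨i, hi⟩ := h1
      exact ⟨i, Fin.ext (Finset.mem_filter.1 hi).2⟩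
    simpa using Fintype.card_le_of_surjective _ hsurj
  · intro s s' e
    by_contra hne
    exact h.ne_loc s s.2 s' s'.2 (fun e => hne (Fin.ext e)) (congrArg Prod.fst e)
  · intro s
    rw [h.wt_eq s s.2]
    congr 1
    ext i
    simp only [Finset.mem_filter, Finset.mem_univ, true_and, Fin.ext_iff]
    refine ⟨fun h => h.1, fun e => ⟨e, ?_⟩⟩
    rw [hg, ← e, h.col_eq i (hF i)]
  · have : Nonempty {C : Finset (EuclideanSpace ℝ (Fin d)) // C.card = k} := by
      obtain ⟨C, hC, -⟩ := exists_card_eq_and_mem hd hk (0 : EuclideanSpace ℝ (Fin d))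
      exact ⟨⟨C, hC⟩⟩
    have hm' : (0 : ℝ) < m := by exact_mod_cast Nat.pos_of_ne_zero hm
    have hc : 0 < (ε / (2 * m)) ^ m := by positivity
    rw [← div_le_iff₀' hc]
    refine le_ciInf fun C => ?_
    rw [div_le_iff₀' hc]
    exact h.movement_le C.1 C.2

/-- A run of the algorithm with room for `M` representatives. -/
theorem coresetAlg_runs {d n m k ℓ E M : ℕ} {ε ρ₀ δ₀ D : ℝ}
    {x : Fin n → EuclideanSpace ℝ (Fin d)} (f : Fin n → Fin ℓ)
    (hm : m = 1 ∨ m = 2) (hx : Function.Injective x) (hε : 0 < ε) (hε1 : ε ≤ 1) (hd : 1 ≤ d)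
    (hk : 1 ≤ k) (hℓ : 1 ≤ ℓ)
    (hδ : ∀ i j, i ≠ j → δ₀ ≤ dist (x i) (x j)) (hδ0 : 0 < δ₀)
    (hD0 : 0 ≤ D) (hD : ∀ i j, dist (x i) (x j) ≤ D) (hρ : ρ₀ = ε / n / n * δ₀)
    (hE : ∀ e : ℕ, 1 ≤ e → ρ₀ * 2 ^ (e - 1) ≤ n * D * ε / 4 → e ≤ E)
    (hM : ∀ L N : ℕ, (L = 1 ∨ 2 ^ L ≤ n ^ 2) → (N : ℝ) ≤ 2 * (levelBound d k ℓ ε * L) + 1 →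
      N ≤ M) :
    ∃ (t : ℕ) (τ : RamState) (N L : ℕ) (p : Fin N → EuclideanSpace ℝ (Fin d))
      (g : Fin N → Fin ℓ) (w : Fin N → ℕ),
      (coresetAlg m).Runs (92 + 7 * M + (M + 2) * d) k ε x f t τ ∧
      τ.Outputs (92 + 7 * M + (M + 2) * d) p g w ∧
      IsMovementColorCoreset m k ε x f p g w ∧ (L = 1 ∨ 2 ^ L ≤ n ^ 2) ∧
      (N : ℝ) ≤ 2 * (levelBound d k ℓ ε * L) ∧
      t ≤ 6 * d + 38 + n * (d + 1 + updateTime d n E) + 8 * n := by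
  have hMd : (M + 2) * d = M * d + 2 * d := by ring
  set s := 92 + 7 * M + (M + 2) * d with hs
  have hroom : Room s d M := ⟨by omega, by omega⟩
  have hm0 : m ≠ 0 := by omega
  obtain ⟨t₁, σ₁, i1, i2, i3⟩ := initProg_wp (n := n) (k := k) (ℓ := ℓ) (x := x)
    (col := fun i => (f i : ℕ)) (ρ₀ := ρ₀) hm0 (by omega : 40 ≤ s) (by omega : d + 9 ≤ s) hε
  obtain ⟨t₂, σ₂, j1, j2, j3⟩ := (coresetAlg m).feed_of_wp (s := s) (T := updateTime d n E) (x := x)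
    (f := f)
    (fun t τ => ∃ L F I b N e r q ftgt tgt,
      Streamed m k ℓ ε x (fun i => (f i : ℕ)) ρ₀ t L F I b N e r q ftgt tgt τ)
    (fun t ht σ ⟨L, F, I, b, N, e, r, q, ftgt, tgt, h⟩ =>
      updateProg_wp hm hx hε hε1 hd hk hℓ hδ hδ0 hD0 hD hρ hE hroom hM h ht)
    (Nat.zero_add n) i3
  obtain ⟨L, F, I, b, N, e, r, q, ftgt, tgt, h⟩ := j3
  have hlb : 0 ≤ levelBound d k ℓ ε * L := by unfold levelBound; positivity
  have hfin := h.frozen.append h.current.block hx h.disjoint hm hε (by have := h.sub_le; linarith)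
  have hbN := h.current.bounds.le
  have hN : (N : ℝ) ≤ 2 * (levelBound d k ℓ ε * L) := by
    have h1 : (N : ℝ) = b + (N - b : ℕ) := by rw [← Nat.cast_add]; congr 1; omega
    have := h.sub_le
    have := h.frozen_le
    linarith
  have hNM : N ≤ M := hM L N h.level_le (by linarith)
  have hall : ∀ i, i ∈ F ∪ I := fun i => (h.mem_iff i).2 i.2
  have hcol : ∀ s, s < N → (store d σ₂ s).col < ℓ := by
    intro s hs
    obtain ⟨i, -, -, h1⟩ := hfin.source s hs
    rw [h1]; exact (f i).2
  obtain ⟨hNn, hcore⟩ := hfin.isMovementColorCoreset hall hd hk hm0 hε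
    (g := fun s => ⟨(store d σ₂ s).col, hcol s s.2⟩) fun _ => rfl
  obtain ⟨t₃, τ, k1, k2, k4, k5, k6, k7, k8, k9, k10⟩ := reportProg_wp h.current.env
    h.current.bounds (by omega : 80 + 7 * N ≤ s)
  have hNd : N * d ≤ M * d := Nat.mul_le_mul_right d hNM
  refine ⟨t₁ + t₂ + t₃, τ, N, L, _, _, _, ⟨by omega, t₁, t₂, t₃, σ₁, σ₂, i1, j1, k1, rfl⟩,
    ⟨k4, by omega, by omega, by omega, ?_, ?_, ?_⟩, hcore, h.level_le, hN, by omega⟩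
  · intro i j
    rw [k5, k10]; rfl
  · intro i
    rw [k6, k8 i i.2]
  · intro i
    rw [k7, k9 i i.2]

/-! ### Size, time and space -/

/-- The level of the last block is at most `2 log₂ n`, and `2 / log 2 < 3`. -/
theorem le_three_mul_log {n L : ℕ} (hn : 2 ≤ n) (hL : L = 1 ∨ 2 ^ L ≤ n ^ 2) :
    (L : ℝ) ≤ 3 * Real.log n := by
  have h2 := Real.log_two_gt_d9
  have hn' : (2 : ℝ) ≤ n := by exact_mod_cast hn
  have h3 : Real.log 2 ≤ Real.log n := Real.log_le_log (by norm_num) hn'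
  rcases hL with rfl | hL
  · push_cast; linarith
  · have h4 : ((2 : ℝ) ^ L) ≤ (n : ℝ) ^ 2 := by exact_mod_cast hL
    have h5 := Real.log_le_log (by positivity) h4
    rw [Real.log_pow, Real.log_pow] at h5
    push_cast at h5
    have : (0 : ℝ) ≤ L := Nat.cast_nonneg L
    nlinarith

/-- The least and the largest distance of two points, whose quotient is the spread. -/
theorem exists_dist_bounds {d n : ℕ} {x : Fin n → EuclideanSpace ℝ (Fin d)}
    (hx : Function.Injective x) (hn : 2 ≤ n) : ∃ δ₀ D : ℝ, 0 < δ₀ ∧ δ₀ ≤ D ∧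
      (∀ i j, i ≠ j → δ₀ ≤ dist (x i) (x j)) ∧ (∀ i j, dist (x i) (x j) ≤ D) ∧
      spread x = D / δ₀ := by
  set g : {p : Fin n × Fin n // p.1 ≠ p.2} → ℝ := fun p => dist (x p.1.1) (x p.1.2) with hg
  let p₀ : {p : Fin n × Fin n // p.1 ≠ p.2} :=
    ⟨(⟨0, by omega⟩, ⟨1, by omega⟩), by simp [Fin.ext_iff]⟩
  have : Nonempty {p : Fin n × Fin n // p.1 ≠ p.2} := ⟨p₀⟩
  have hlow := (Set.finite_range g).bddBelow
  have hupp := (Set.finite_range g).bddAbove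
  obtain ⟨p₁, h₁⟩ := exists_eq_ciInf_of_finite (f := g)
  refine ⟨⨅ p, g p, ⨆ p, g p, ?_, (ciInf_le hlow p₀).trans (le_ciSup hupp p₀), ?_, ?_, rfl⟩
  · rw [← h₁]; exact dist_pos.2 (hx.ne p₁.2)
  · intro i j hij; exact ciInf_le hlow ⟨(i, j), hij⟩
  · intro i j
    by_cases hij : i = j
    · subst hij
      rw [dist_self]
      exact dist_nonneg.trans (le_ciSup hupp p₀)
    · exact le_ciSup hupp ⟨(i, j), hij⟩

/-- The running time is at most a polynomial of degree five in a number `X` that bounds the number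
of points and, up to a factor, the number `E` of radii of a block, times `d + 1 ≤ a ^ d`. -/
theorem runTime_le {d n E t a : ℕ} {X : ℝ} (ha : 1000 ≤ a) (hX2 : 2 ≤ X) (hnX : (n : ℝ) ≤ X)
    (hEX : (E : ℝ) + 1 ≤ 7 * X) (ht : t ≤ 6 * d + 38 + n * (d + 1 + updateTime d n E) + 8 * n) :
    (t : ℝ) ≤ (a : ℝ) ^ (d + 1) * X ^ a := by
  have ha' : (1000 : ℝ) ≤ a := by exact_mod_cast ha
  have hX1 : 1 ≤ X := by linarith
  set y : ℝ := d + 1 with hy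
  have hy1 : 1 ≤ y := by rw [hy]; linarith [(Nat.cast_nonneg d : (0 : ℝ) ≤ d)]
  have hdy : (d : ℝ) = y - 1 := by rw [hy]; ring
  have hyd : y ≤ (a : ℝ) ^ d := by
    have : d + 1 ≤ a ^ d := Nat.lt_pow_self (by omega)
    rw [hy]; exact_mod_cast this
  have hn1 : (n : ℝ) + 1 ≤ 2 * X := by linarith
  have hn0 : (0 : ℝ) ≤ n := Nat.cast_nonneg n
  have p2 : X ≤ X ^ 2 := le_self_pow₀ hX1 two_ne_zero
  have p3 : X ^ 2 ≤ X ^ 3 := pow_le_pow_right₀ hX1 (by norm_num)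
  have p4 : X ^ 3 ≤ X ^ 4 := pow_le_pow_right₀ hX1 (by norm_num)
  have p5 : X ^ 4 ≤ X ^ 5 := pow_le_pow_right₀ hX1 (by norm_num)
  have hq : (6 * (d : ℝ) + 25) ≤ 25 * y := by linarith
  have hscan : ((n : ℝ) + 1) * (6 * d + 25) ≤ 50 * (X * y) := by
    calc ((n : ℝ) + 1) * (6 * d + 25) ≤ (2 * X) * (25 * y) := by gcongr
      _ = _ := by ring
  have hXy : 1 ≤ X * y := one_le_mul_of_one_le_of_one_le hX1 hy1
  have hyX : y ≤ X * y := le_mul_of_one_le_left (by linarith) hX1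
  have hyX2 : X * y ≤ X ^ 2 * y := mul_le_mul_of_nonneg_right p2 (by linarith)
  have hyX3 : X ^ 2 * y ≤ X ^ 3 * y := mul_le_mul_of_nonneg_right p3 (by linarith)
  have hyX4 : X ^ 3 * y ≤ X ^ 4 * y := mul_le_mul_of_nonneg_right p4 (by linarith)
  have hyX5 : X ^ 4 * y ≤ X ^ 5 * y := mul_le_mul_of_nonneg_right p5 (by linarith)
  have hreb : (rebuildTime d n : ℝ) + 7 ≤ 81 * (X ^ 3 * y) := by
    have e1 : (n : ℝ) * ((n + 1) * (6 * d + 25) + 2) ≤ X * (50 * (X * y) + 2 * (X * y)) := by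
      gcongr
      linarith
    have e2 : (n : ℝ) * (n * ((n + 1) * (6 * d + 25) + 2) + 4 * d + 11) ≤
        X * (X * (50 * (X * y) + 2 * (X * y)) + 4 * (X ^ 2 * y) + 11 * (X ^ 2 * y)) := by
      gcongr
      · linarith
      · linarith
    unfold rebuildTime
    push_cast
    have e3 : X * (X * (50 * (X * y) + 2 * (X * y)) + 4 * (X ^ 2 * y) + 11 * (X ^ 2 * y)) =
      67 * (X ^ 3 * y) := by ring
    linarith
  have hupd : (updateTime d n E : ℝ) ≤ 631 * (X ^ 4 * y) := by
    have e1 : ((E : ℝ) + 1) * (rebuildTime d n + 7) ≤ 7 * X * (81 * (X ^ 3 * y)) := by gcongr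
    have e3 : 7 * X * (81 * (X ^ 3 * y)) = 567 * (X ^ 4 * y) := by ring
    unfold updateTime
    push_cast
    linarith
  have htot : (t : ℝ) ≤ 1000 * (X ^ 5 * y) := by
    have e0 : (t : ℝ) ≤ 6 * d + 38 + n * (d + 1 + updateTime d n E) + 8 * n := by
      exact_mod_cast ht
    have e1 : (n : ℝ) * (d + 1 + updateTime d n E) ≤ X * (X ^ 4 * y + 631 * (X ^ 4 * y)) := by
      gcongr
      linarith
    have e2 : X * (X ^ 4 * y + 631 * (X ^ 4 * y)) = 632 * (X ^ 5 * y) := by ring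
    have e3 : X ≤ X * y := le_mul_of_one_le_right (by linarith) hy1
    linarith
  have hXa : X ^ 5 ≤ X ^ a := pow_le_pow_right₀ hX1 (by omega)
  calc (t : ℝ) ≤ 1000 * (X ^ 5 * y) := htot
    _ ≤ a * (X ^ a * a ^ d) := by gcongr
    _ = a ^ (d + 1) * X ^ a := by ring

/-- The memory for `M` representatives. The factors `ε⁻¹` and `ℓ * k * lg` of the bound for `M` are
at most twice their product, so that `d + 1` powers of it suffice. -/
theorem space_le {d k ℓ M : ℕ} {ε c lg : ℝ} (hk : (1 : ℝ) ≤ k) (hℓ : (1 : ℝ) ≤ ℓ) (hε : 0 < ε)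
    (hε1 : ε ≤ 1) (hlg : 1 ≤ 2 * lg) (hc0 : 0 ≤ c)
    (hM : (M : ℝ) ≤ 6 * (c * (ℓ * k * (ε ^ d)⁻¹)) * lg + 1) :
    ((92 + 7 * M + (M + 2) * d : ℕ) : ℝ) ≤ 2 ^ (d + 1) * (99 + 42 * c + (6 * c + 3) * d) *
      (ℓ * k * ε⁻¹ * lg) ^ (d + 1) := by
  set G : ℝ := ℓ * k * ε⁻¹ * lg with hG
  have hlg0 : 0 < lg := by linarith
  have hεinv : 1 ≤ ε⁻¹ := (one_le_inv₀ hε).2 hε1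
  have hlk : (1 : ℝ) ≤ ℓ * k := one_le_mul_of_one_le_of_one_le hℓ hk
  have hεG : ε⁻¹ ≤ 2 * G := by
    calc ε⁻¹ = 1 * ε⁻¹ * 1 := by ring
      _ ≤ (ℓ * k) * ε⁻¹ * (2 * lg) := by gcongr
      _ = 2 * G := by rw [hG]; ring
  have hG1 : 1 ≤ 2 * G := hεinv.trans hεG
  have hlkG : ℓ * k * lg ≤ 2 * G := by
    calc ℓ * k * lg = ℓ * k * 1 * lg := by ring
      _ ≤ ℓ * k * ε⁻¹ * lg := by gcongr
      _ ≤ 2 * G := by linarith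
  have hKG : c * (ℓ * k * (ε ^ d)⁻¹) * lg ≤ c * (2 * G) ^ (d + 1) := by
    calc c * (ℓ * k * (ε ^ d)⁻¹) * lg = c * (ε⁻¹ ^ d * (ℓ * k * lg)) := by
          rw [inv_pow]; ring
      _ ≤ c * ((2 * G) ^ d * (2 * G)) := by gcongr
      _ = _ := by rw [pow_succ]
  have hP1 : 1 ≤ (2 * G) ^ (d + 1) := one_le_pow₀ hG1
  have hMle : (M : ℝ) ≤ (6 * c + 1) * (2 * G) ^ (d + 1) := by
    linarith
  have hM2 : (M : ℝ) + 2 ≤ (6 * c + 3) * (2 * G) ^ (d + 1) := by linarith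
  have hd0 : (0 : ℝ) ≤ d := Nat.cast_nonneg d
  push_cast
  calc (92 : ℝ) + 7 * M + (M + 2) * d
      ≤ 92 * (2 * G) ^ (d + 1) + 7 * ((6 * c + 1) * (2 * G) ^ (d + 1)) +
        (6 * c + 3) * (2 * G) ^ (d + 1) * d := by gcongr; linarith
    _ = _ := by rw [mul_pow]; ring

/-- The bounds for both exponents, with a single logarithm in the size. -/
theorem coresetAlg_constructs {d k ℓ n m a : ℕ} {ε : ℝ} (x : Fin n → EuclideanSpace ℝ (Fin d))
    (f : Fin n → Fin ℓ) (hm : m = 1 ∨ m = 2) (hk : 1 ≤ k) (hε : 0 < ε) (hε1 : ε ≤ 1) (hn : 2 ≤ n)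
    (hx : Function.Injective x) (ha : 1000 ≤ a) :
    ∃ (s t : ℕ) (τ : RamState) (N : ℕ) (p : Fin N → EuclideanSpace ℝ (Fin d))
      (g : Fin N → Fin ℓ) (w : Fin N → ℕ),
      (coresetAlg m).Runs s k ε x f t τ ∧ τ.Outputs s p g w ∧
      IsMovementColorCoreset m k ε x f p g w ∧
      (N : ℝ) ≤ 6 * (131072 ^ d) ^ d * (ℓ * k * (ε ^ d)⁻¹ * Real.log n) ∧
      (t : ℝ) ≤ (a : ℝ) ^ (d + 1) * (n + k + ℓ + Real.log (spread x)) ^ a ∧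
      (s : ℝ) ≤ 2 ^ (d + 1) * (99 + 42 * (131072 ^ d) ^ d + (6 * (131072 ^ d) ^ d + 3) * d) *
        (ℓ * k * ε⁻¹ * Real.log n) ^ (d + 1) := by
  -- `ℝ^0` does not have two points
  have hd : 1 ≤ d := by
    by_contra hd
    obtain rfl : d = 0 := by omega
    have := hx (Subsingleton.elim (x ⟨0, by omega⟩) (x ⟨1, by omega⟩))
    simp [Fin.ext_iff] at this
  have hℓ : 1 ≤ ℓ := by
    have := (f ⟨0, by omega⟩).2
    omega
  obtain ⟨δ₀, D, hδ0, hδD, hδ, hD, hΔ⟩ := exists_dist_bounds hx hn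
  have hD0 : 0 < D := hδ0.trans_le hδD
  have hn' : (2 : ℝ) ≤ n := by exact_mod_cast hn
  have hk' : (1 : ℝ) ≤ k := by exact_mod_cast hk
  have hℓ' : (1 : ℝ) ≤ ℓ := by exact_mod_cast hℓ
  have hlog2 := Real.log_two_gt_d9
  have hlogn : (1 : ℝ) ≤ 2 * Real.log n := by
    have := Real.log_le_log (by norm_num) hn'
    linarith
  set Λ := Real.log (spread x) with hΛ
  have hΛ0 : 0 ≤ Λ := by
    rw [hΛ, hΔ]; exact Real.log_nonneg ((one_le_div hδ0).2 hδD)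
  have hlevel : levelBound d k ℓ ε = (131072 ^ d) ^ d * (ℓ * k * (ε ^ d)⁻¹) := by
    rw [levelBound, div_pow, div_eq_mul_inv]; ring
  have hlb : 0 ≤ levelBound d k ℓ ε := by unfold levelBound; positivity
  set M := ⌊6 * levelBound d k ℓ ε * Real.log n + 1⌋₊ with hM
  set E := ⌊6 * (n : ℝ) + 2 * Λ⌋₊ + 1 with hE
  have hbound : ∀ L : ℕ, (L = 1 ∨ 2 ^ L ≤ n ^ 2) →
      2 * (levelBound d k ℓ ε * L) ≤ 6 * levelBound d k ℓ ε * Real.log n := fun L hL => by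
    have := mul_le_mul_of_nonneg_left (le_three_mul_log hn hL) hlb
    linarith
  obtain ⟨t, τ, N, L, p, g, w, h1, h2, h3, h4, h5, h6⟩ := coresetAlg_runs (E := E) (M := M)
    (ρ₀ := ε / n / n * δ₀) f hm hx hε hε1 hd hk hℓ hδ hδ0 hD0.le hD rfl (by
      intro e he hle
      -- the radius grows by factors of two, from `ε δ₀ / n ^ 2` to at most `n D ε / 4`
      have hq : (2 : ℝ) ^ (e - 1) ≤ n ^ 3 * (D / δ₀) := by
        have h1 : ε / n / n * δ₀ * 2 ^ (e - 1) ≤ n * D * ε := by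
          refine hle.trans ?_
          have : 0 < n * D * ε := by positivity
          linarith
        have h2 : ε / n / n * δ₀ * 2 ^ (e - 1) = ε * (δ₀ * 2 ^ (e - 1) / n ^ 2) := by
          field_simp
        rw [h2, mul_comm (n * D : ℝ)] at h1
        have h3 := le_of_mul_le_mul_left h1 hε
        rw [div_le_iff₀ (by positivity)] at h3
        rw [← mul_div_assoc, le_div_iff₀ hδ0]
        linarith
      have hlog := Real.log_le_log (by positivity) hq
      rw [Real.log_mul (by positivity) (by positivity), Real.log_pow, Real.log_pow, ← hΔ,
        ← hΛ] at hlog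
      have h4 := Real.log_le_self (by linarith : (0 : ℝ) ≤ n)
      have h5 : ((e - 1 : ℕ) : ℝ) ≤ 6 * n + 2 * Λ := by
        have : (0 : ℝ) ≤ (e - 1 : ℕ) := Nat.cast_nonneg _
        push_cast at hlog
        nlinarith
      have h6 := Nat.le_floor h5
      omega) (by
      intro L N hL hN
      exact Nat.le_floor (hN.trans (by linarith [hbound L hL])))
  refine ⟨_, t, τ, N, p, g, w, h1, h2, h3, ?_, ?_, ?_⟩
  · refine h5.trans ((hbound L h4).trans (le_of_eq ?_))
    rw [hlevel]; ring
  · have hEX : (E : ℝ) + 1 ≤ 7 * (n + k + ℓ + Λ) := by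
      have h := Nat.floor_le (by positivity : 0 ≤ 6 * (n : ℝ) + 2 * Λ)
      rw [hE]; push_cast
      linarith
    exact runTime_le ha (by linarith) (by linarith) hEX h6
  · refine space_le hk' hℓ' hε hε1 hlogn (by positivity) ?_
    rw [← hlevel]
    exact Nat.floor_le (by positivity)

/-- The constants `A d, B d, e d` depend only on the dimension, and `a` is absolute. -/
theorem mainTheorem4 :
    (∃ (M : StreamAlg) (A B : ℕ → ℝ) (e : ℕ → ℕ) (a : ℕ),
      M.ConstructsColorCoresets 1
        (fun d k ℓ ε n => A d * (ℓ * k * (ε ^ d)⁻¹ * Real.log n ^ 2))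
        (fun d k ℓ n Δ => (a : ℝ) ^ (d + 1) * (n + k + ℓ + Real.log Δ) ^ a)
        (fun d k ℓ ε n => B d * (ℓ * k * ε⁻¹ * Real.log n) ^ e d)) ∧
    (∃ (M : StreamAlg) (A B : ℕ → ℝ) (e : ℕ → ℕ) (a : ℕ),
      M.ConstructsColorCoresets 2
        (fun d k ℓ ε n => A d * (ℓ * k * (ε ^ d)⁻¹ * Real.log n))
        (fun d k ℓ n Δ => (a : ℝ) ^ (d + 1) * (n + k + ℓ + Real.log Δ) ^ a)
        (fun d k ℓ ε n => B d * (ℓ * k * ε⁻¹ * Real.log n) ^ e d)) := by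
  -- the exponent is kept opaque, as unification may unfold a power with a numeral as exponent
  obtain ⟨a, ha⟩ : ∃ a : ℕ, 1000 ≤ a := ⟨1000, le_rfl⟩
  refine ⟨⟨coresetAlg 1, fun d => 2 * (6 * (131072 ^ d) ^ d),
    fun d => 2 ^ (d + 1) * (99 + 42 * (131072 ^ d) ^ d + (6 * (131072 ^ d) ^ d + 3) * d),
    fun d => d + 1, a, ?_⟩, ⟨coresetAlg 2, fun d => 6 * (131072 ^ d) ^ d,
    fun d => 2 ^ (d + 1) * (99 + 42 * (131072 ^ d) ^ d + (6 * (131072 ^ d) ^ d + 3) * d),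
    fun d => d + 1, a, ?_⟩⟩
  · intro d k ℓ ε n x f hk hε hε1 hn hx
    obtain ⟨s, t, τ, N, p, g, w, h1, h2, h3, h4, h5, h6⟩ :=
      coresetAlg_constructs x f (Or.inl rfl) hk hε hε1 hn hx ha
    refine ⟨s, t, τ, N, p, g, w, h1, h2, h3, h4.trans ?_, h5, h6⟩
    -- for `k`-median the bound with a single logarithm is stronger, as `log n ≥ 1 / 2`
    have hn' : (2 : ℝ) ≤ n := by exact_mod_cast hn
    have hlog := Real.log_two_gt_d9
    have hlog' := Real.log_le_log (by norm_num) hn'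
    have h7 : Real.log n ≤ 2 * Real.log n ^ 2 := by nlinarith
    calc 6 * (131072 ^ d) ^ d * (ℓ * k * (ε ^ d)⁻¹ * Real.log n)
        ≤ 6 * (131072 ^ d) ^ d * (ℓ * k * (ε ^ d)⁻¹ * (2 * Real.log n ^ 2)) := by gcongr
      _ = _ := by ring
  · intro d k ℓ ε n x f hk hε hε1 hn hx
    exact coresetAlg_constructs x f (Or.inr rfl) hk hε hε1 hn hx ha
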